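/- Let $\mathbb H$ be the real quaternions and $\mathbf H^1_{\mathbb H}=\{q\in\mathbb H:\operatorname{Re}q>0\}$ the half-space model of hyperbolic 4-space. Let $PSL(2,\mathfrak L)$ be the group of transformations of $\mathbf H^1_{\mathbb H}$ generated by the inversion $T(q)=q^{-1}$ and the translations $q\mapsto q+\omega$ with $\omega=a\mathbf i+b\mathbf j+c\mathbf k$, $a,b,c\in\mathbb Z$. Let $PSL(2,\mathfrak H)$ be the group generated by these transformations together with the maps $D_u:q\mapsto uqu^{-1}$, where $u$ runs over the 24 Hurwitz units $\pm1,\pm\mathbf i,\pm\mathbf j,\pm\mathbf k,\tfrac12(\pm1\pm\mathbf i\pm\mathbf j\pm\mathbf k)$. For an orbifold $\mathcal O=X/\Gamma$ that is decomposed, as a CW complex, into finitely many open cells $c$ such that the local (isotropy) group is constant, up to isomorphism, on each open cell, with value $\Gamma_c$, the orbifold Euler characteristic is $$\chi^{\mathrm{orb}}(\mathcal O)=\sum_c\frac{(-1)^{\dim c}}{|\Gamma_c|}.$$ If $\mathcal O$ is not compact, cells may be asymptotic to an end: the decomposition is then a finite CW structure on the one-point compactification $\mathcal O\cup\{\infty\}$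 relative to the point $\infty$, and $\infty$ is not counted as a cell. **Theorem.** The Lipschitz and Hurwitz quaternionic modular orbifolds $\mathcal O^4_{\mathfrak L}=\mathbf H^1_{\mathbb H}/PSL(2,\mathfrak L)$ and $\mathcal O^4_{\mathfrak H}=\mathbf H^1_{\mathbb H}/PSL(2,\mathfrak H)$ admit such decompositions, compatible with their stratification by isotropy groups, and these give $$\chi^{\mathrm{orb}}(\mathcal O^4_{\mathfrak L})=\frac1{96},\qquad \chi^{\mathrm{orb}}(\mathcal O^4_{\mathfrak H})=\frac1{288}.$$ -/

import Mathlib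

open Topology
open scoped Quaternion OnePoint

noncomputable section

namespace QuaternionicModular

/-! ### Orbifold Euler characteristic of a quotient `X / Γ` -/

section Orbifold

universe u v

/-- The underlying space `|X / Γ|` of the quotient orbifold, with the quotient topology. -/
abbrev OrbitSpace (Γ : Type v) (X : Type u) [Group Γ] [MulAction Γ X] : Type u :=
  Quotient (MulAction.orbitRel Γ X)

/-- The orbit of `x`, as a point of the orbit space. -/
def orbitMk (Γ : Type v) {X : Type u} [Group Γ] [MulAction Γ X] (x : X) : OrbitSpace Γ X :=
  Quotient.mk (MulAction.orbitRel Γ X) x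

/-- A decomposition of the quotient orbifold `X / Γ` into finitely many open cells, as a
CW complex, such that the local group is constant on each open cell.

If `X / Γ` is compact this is a finite CW structure on `X / Γ` (the point `∞` is then isolated).
If `X / Γ` is not compact, cells may be asymptotic to the ends (they may have ideal vertices):
characteristic maps of cells take values in the one-point compactification, and we have a finite
CW structure on it relative to the point `∞`, which itself is not one of the cells. In either
case the open cells form a partition of the orbit space. -/
structure OrbifoldCWDecomposition (Γ : Type v) (X : Type u) [Group Γ] [MulAction Γ X]
    [TopologicalSpace X] where
  /-- The CW structure: cells, and characteristic maps from closed balls. -/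
  [cw : RelCWComplex (Set.univ : Set (OnePoint (OrbitSpace Γ X))) {∞}]
  /-- There are finitely many cells. -/
  finite_cw : RelCWComplex.Finite (Set.univ : Set (OnePoint (OrbitSpace Γ X)))
  /-- The local group `Γ_c` on the open cell `c`. -/
  localGroup (n : ℕ)
    (c : RelCWComplex.cell (Set.univ : Set (OnePoint (OrbitSpace Γ X))) n) : Subgroup Γ
  /-- The local groups of an orbifold are finite. -/
  finite_localGroup (n : ℕ)
    (c : RelCWComplex.cell (Set.univ : Set (OnePoint (OrbitSpace Γ X))) n) :
    Finite (localGroup n c)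
  /-- The isotropy group at every point lying over the open cell `c` is isomorphic to `Γ_c`. -/
  isotropy_iso (n : ℕ)
    (c : RelCWComplex.cell (Set.univ : Set (OnePoint (OrbitSpace Γ X))) n) (x : X) :
    (orbitMk Γ x : OnePoint (OrbitSpace Γ X)) ∈ RelCWComplex.openCell n c →
      Nonempty (MulAction.stabilizer Γ x ≃* localGroup n c)

/-- The orbifold Euler characteristic `∑_c (-1) ^ (dim c) / |Γ_c|`, the (finite) sum being over
all the cells `c` of the decomposition. -/
def OrbifoldCWDecomposition.eulerChar {Γ : Type v} {X : Type u} [Group Γ] [MulAction Γ X]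
    [TopologicalSpace X] (D : OrbifoldCWDecomposition Γ X) : ℚ :=
  ∑ᶠ c : (Σ n, D.cw.cell n), (-1 : ℚ) ^ c.1 / (Nat.card (D.localGroup c.1 c.2) : ℚ)

/-- The orbifold Euler characteristic of `X / Γ` is `r`: there is a decomposition of `X / Γ` into
finitely many cells with constant local groups, and the alternating sum over its cells of the
inverses of the orders of the local groups is `r`. -/
def HasOrbifoldEulerChar (Γ : Type v) (X : Type u) [Group Γ] [MulAction Γ X]
    [TopologicalSpace X] (r : ℚ) : Prop :=
  ∃ D : OrbifoldCWDecomposition Γ X, D.eulerChar = r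

end Orbifold

/-! ### The half-space and the two modular groups -/

/-- The half-space model `{q ∈ ℍ : Re q > 0}` of hyperbolic 4-space. -/
abbrev HalfSpace : Type := {q : ℍ[ℝ] // 0 < q.re}

lemma re_inv_pos {q : ℍ[ℝ]} (hq : 0 < q.re) : 0 < (q⁻¹).re := by
  have h0 : q ≠ 0 := by
    rintro rfl
    simp at hq
  have h : 0 < Quaternion.normSq q :=
    lt_of_le_of_ne Quaternion.normSq_nonneg (Ne.symm (Quaternion.normSq_ne_zero.mpr h0))
  rw [show q⁻¹ = (Quaternion.normSq q)⁻¹ • star q from rfl]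
  simp only [Quaternion.re_smul, Quaternion.re_star, smul_eq_mul]
  positivity

lemma re_conj {u : ℍ[ℝ]} (hu : u ≠ 0) (q : ℍ[ℝ]) : (u * q * u⁻¹).re = q.re := by
  have h : Quaternion.normSq u ≠ 0 := Quaternion.normSq_ne_zero.mpr hu
  rw [show u⁻¹ = (Quaternion.normSq u)⁻¹ • star u from rfl, mul_smul_comm, Quaternion.re_smul,
    smul_eq_mul, inv_mul_eq_iff_eq_mul₀ h, Quaternion.normSq_def']
  simp only [Quaternion.re_mul, Quaternion.imI_mul, Quaternion.imJ_mul, Quaternion.imK_mul,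
    Quaternion.re_star, Quaternion.imI_star, Quaternion.imJ_star, Quaternion.imK_star]
  ring

/-- The inversion `T : q ↦ q⁻¹`, induced by the matrix `(0, 1; 1, 0)`. -/
def inversion : Equiv.Perm HalfSpace where
  toFun q := ⟨q.1⁻¹, re_inv_pos q.2⟩
  invFun q := ⟨q.1⁻¹, re_inv_pos q.2⟩
  left_inv q := by simp
  right_inv q := by simp

/-- The translation `q ↦ q + ω`, for `Re ω = 0`, induced by the matrix `(1, ω; 0, 1)`. -/
def translation (ω : ℍ[ℝ]) (hω : ω.re = 0) : Equiv.Perm HalfSpace where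
  toFun q := ⟨q.1 + ω, by simpa [hω] using q.2⟩
  invFun q := ⟨q.1 - ω, by simpa [hω] using q.2⟩
  left_inv q := by simp
  right_inv q := by simp

/-- The transformation `D_u : q ↦ u q u⁻¹`, induced by the matrix `(u, 0; 0, u)`. -/
def diagonal (u : ℍ[ℝ]) (hu : u ≠ 0) : Equiv.Perm HalfSpace where
  toFun q := ⟨u * q.1 * u⁻¹, by simpa only [re_conj hu] using q.2⟩
  invFun q := ⟨u⁻¹ * q.1 * u, by
    have h := re_conj (inv_ne_zero hu) q.1
    rw [inv_inv] at h
    rw [h]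
    exact q.2⟩
  left_inv q := Subtype.ext (by simp [mul_assoc, hu])
  right_inv q := Subtype.ext (by simp [mul_assoc, hu])

/-- The translations by the imaginary Lipschitz integers `a i + b j + c k`, `a b c ∈ ℤ`. -/
def lipschitzTranslations : Set (Equiv.Perm HalfSpace) :=
  {g | ∃ a b c : ℤ, g = translation ⟨0, (a : ℝ), (b : ℝ), (c : ℝ)⟩ rfl}

/-- The 24 Hurwitz units `±1, ±i, ±j, ±k, (±1 ± i ± j ± k) / 2`. -/
def hurwitzUnits : Set ℍ[ℝ] :=
  {1, -1, ⟨0, 1, 0, 0⟩, ⟨0, -1, 0, 0⟩, ⟨0, 0, 1, 0⟩, ⟨0, 0, -1, 0⟩, ⟨0, 0, 0, 1⟩, ⟨0, 0, 0, -1⟩} ∪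
    {u | |u.re| = 1 / 2 ∧ |u.imI| = 1 / 2 ∧ |u.imJ| = 1 / 2 ∧ |u.imK| = 1 / 2}

/-- The transformations `D_u` with `u` a Hurwitz unit. -/
def hurwitzUnitary : Set (Equiv.Perm HalfSpace) :=
  {g | ∃ (u : ℍ[ℝ]) (hu : u ≠ 0), u ∈ hurwitzUnits ∧ g = diagonal u hu}

/-- The Lipschitz quaternionic modular group `PSL(2, 𝔏)`: the group of transformations of the
half-space generated by the inversion and the translations by imaginary Lipschitz integers. -/
def lipschitzModularGroup : Subgroup (Equiv.Perm HalfSpace) :=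
  Subgroup.closure ({inversion} ∪ lipschitzTranslations)

/-- The Hurwitz quaternionic modular group `PSL(2, 𝔥)`: the group of transformations of the
half-space generated by the inversion, the translations by imaginary Lipschitz integers and the
`D_u` with `u` a Hurwitz unit. -/
def hurwitzModularGroup : Subgroup (Equiv.Perm HalfSpace) :=
  Subgroup.closure ({inversion} ∪ lipschitzTranslations ∪ hurwitzUnitary)

end QuaternionicModular

end

/-!
Write `q = t + ω` with `t > 0` and `ω ∈ ℝ³`. Let `P` be the set of `q` with `|q| ≥ 1` and
`0 ≤ ω_i ≤ 1/2`, a pyramid with its apex at `∞` over a cube in the unit sphere. The reflections in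
its seven walls (inversion in the unit sphere, `ω_i ↦ -ω_i` and `ω_i ↦ 1 - ω_i`) generate the extension of
the Lipschitz modular group by the orientation reversing map `q ↦ q̄`, and `P` is a strict
fundamental domain of the extended group. So the Lipschitz orbifold is the double of `P`. The
Hurwitz units add the cyclic permutations of the coordinates `ω_i`, so the Hurwitz orbifold is the
quotient of the double by a rotation of order three.

That `P` is a fundamental domain is proved by means of cusps. The elements of the groups are Möbius
transformations `q ↦ (a q + b) (c q + d)⁻¹` over the Lipschitz or Hurwitz integers, and they divide
the height `t` by `|c q + d|²`. This is the pairing of `q` with an integral isotropic vector of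
Minkowski space, which stands for the cusp that is mapped to `∞` (`exists_matrix_hasCusp`). Only
finitely many such vectors have a bounded pairing with the points of a bounded set
(`finite_cusps`). Hence every orbit contains a point of maximal height, which can be moved into `P`
(`exists_mem_region`). The pairing is at least `1` on `P` (`one_le_pair`), the cusps for which it
equals `1` at a given point are permuted transitively by the group generated by the reflections
that fix the point (`exists_hasCusp_fixing`), and the elements that fix `∞` are affine. This gives
the strictness of `P` (`eq_rot_of_mem_region`) and therefore the identifications between the two
copies of `P` (`orbitMk_flip_eq_iff`). It also gives the isotropy groups: they depend only on the
walls through the point and on whether the three `ω_i` agree (`stabilizer_flip_le`), and their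
orders are products of the number of closest cusps and the order of an affine group, halved for the
points in the walls (`fixCard_eq`).

The orbit space is Hausdorff and locally compact since the action is properly discontinuous, by the
same finiteness of cusps, so its one-point compactification is Hausdorff. Points whose height tends
to infinity tend to `∞` in it (`exists_ht_bound`). The pyramid is parametrized by a 4-cube with its
top face collapsed to `∞`: the last coordinate of the cube measures `|q|²`, and the others are
rescaled coordinates `ω_i` in the Lipschitz case, and `r, a, b` with `ω = r (1, a, b)` in the
Hurwitz case. The images of the open faces, one for each class of identified faces, are the cells
of a relative CW complex (`CubicalCover.cw`). The isotropy groups are constant on them, and the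
alternating sums over the 55 and 33 cells are finite computations.
-/

open scoped Matrix

noncomputable section

namespace QuaternionicModular

/-! ### Quaternionic matrices over the Lipschitz and Hurwitz orders -/

/-- The quaternion with the given coordinates. -/
def quat (a b c d : ℝ) : ℍ[ℝ] := ⟨a, b, c, d⟩

@[simp] lemma quat_re (a b c d : ℝ) : (quat a b c d).re = a := rfl
@[simp] lemma quat_imI (a b c d : ℝ) : (quat a b c d).imI = b := rfl
@[simp] lemma quat_imJ (a b c d : ℝ) : (quat a b c d).imJ = c := rfl
@[simp] lemma quat_imK (a b c d : ℝ) : (quat a b c d).imK = d := rfl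

lemma quaternion_ext {x y : ℍ[ℝ]} (h0 : x.re = y.re) (h1 : x.imI = y.imI) (h2 : x.imJ = y.imJ)
    (h3 : x.imK = y.imK) : x = y :=
  Quaternion.ext _ _ h0 h1 h2 h3

/-- The modular groups, indexed by a Boolean: the Hurwitz group for `true`, the Lipschitz group
for `false`. -/
def modularGroup (h : Bool) : Subgroup (Equiv.Perm HalfSpace) :=
  bif h then hurwitzModularGroup else lipschitzModularGroup

/-- The Hurwitz order for `h = true` and the Lipschitz order for `h = false`. With
`ρ = (1 + i + j + k) / 2`, its elements are `a ρ + b i + c j + d k` with integers `a, b, c, d`,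
where `a` is even in the Lipschitz case. -/
def order (h : Bool) : Subring ℍ[ℝ] where
  carrier := {x | ∃ a b c d : ℤ, (h = false → Even a) ∧
    x = quat (a / 2) (a / 2 + b) (a / 2 + c) (a / 2 + d)}
  mul_mem' := by
    rintro _ _ ⟨a, b, c, d, ha, rfl⟩ ⟨a', b', c', d', ha', rfl⟩
    refine ⟨-(a * a') - a * (b' + c' + d') - a' * (b + c + d) - 2 * (b * b' + c * c' + d * d'),
      a * a' + a * (b' + d') + a' * (b + c) + c * d' - d * c' + (b * b' + c * c' + d * d'),
      a * a' + a * (c' + b') + a' * (c + d) + d * b' - b * d' + (b * b' + c * c' + d * d'),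
      a * a' + a * (d' + c') + a' * (d + b) + b * c' - c * b' + (b * b' + c * c' + d * d'),
      fun hh => ?_, ?_⟩
    · obtain ⟨x, rfl⟩ := ha hh
      obtain ⟨y, rfl⟩ := ha' hh
      exact ⟨-(x * (y + y)) - x * (b' + c' + d') - y * (b + c + d) - (b * b' + c * c' + d * d'),
        by ring⟩
    · apply Quaternion.ext <;> simp <;> ring
  add_mem' := by
    rintro _ _ ⟨a, b, c, d, ha, rfl⟩ ⟨a', b', c', d', ha', rfl⟩
    refine ⟨a + a', b + b', c + c', d + d', fun hh => (ha hh).add (ha' hh), ?_⟩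
    apply Quaternion.ext <;> simp <;> ring
  neg_mem' := by
    rintro _ ⟨a, b, c, d, ha, rfl⟩
    refine ⟨-a, -b, -c, -d, fun hh => (ha hh).neg, ?_⟩
    apply Quaternion.ext <;> simp <;> ring
  zero_mem' := ⟨0, 0, 0, 0, by simp, by apply Quaternion.ext <;> simp⟩
  one_mem' := ⟨2, -1, -1, -1, by simp, by apply Quaternion.ext <;> simp⟩

lemma star_mem_order {h : Bool} {x : ℍ[ℝ]} (hx : x ∈ order h) : star x ∈ order h := by
  obtain ⟨a, b, c, d, ha, rfl⟩ := hx
  refine ⟨a, -a - b, -a - c, -a - d, ha, ?_⟩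
  apply Quaternion.ext <;> simp <;> ring

lemma order_integral_of_re_eq_zero {h : Bool} {x : ℍ[ℝ]} (hx : x ∈ order h) (h0 : x.re = 0) :
    ∃ b c d : ℤ, x = quat 0 b c d := by
  obtain ⟨a, b, c, d, ha, rfl⟩ := hx
  have : (a : ℝ) / 2 = 0 := by simpa using h0
  exact ⟨b, c, d, by simp [this]⟩

lemma exists_int_normSq {h : Bool} {x : ℍ[ℝ]} (hx : x ∈ order h) :
    ∃ n : ℤ, Quaternion.normSq x = n := by
  obtain ⟨a, b, c, d, ha, rfl⟩ := hx
  refine ⟨a ^ 2 + a * (b + c + d) + b ^ 2 + c ^ 2 + d ^ 2, ?_⟩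
  rw [Quaternion.normSq_def']
  simp only [quat_re, quat_imI, quat_imJ, quat_imK]
  push_cast
  ring

/-- The matrix `(0, 1; 1, 0)` of the Hermitian form `2 Re (q̄ p)`, whose value at `(q, 1)` is
`2 Re q`. -/
def formMatrix : Matrix (Fin 2) (Fin 2) ℍ[ℝ] := !![0, 1; 1, 0]

/-- The transformation `g` is `q ↦ (a q + b) (c q + d)⁻¹` for a matrix `(a, b; c, d)` over the
order that preserves the form `formMatrix`. -/
def IsMoebius (h : Bool) (g : Equiv.Perm HalfSpace) : Prop :=
  ∃ M : Matrix (Fin 2) (Fin 2) ℍ[ℝ], (∀ i j, M i j ∈ order h) ∧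
    Mᴴ * formMatrix * M = formMatrix ∧ M * formMatrix * Mᴴ = formMatrix ∧
    ∀ q : HalfSpace, (g q).1 * (M 1 0 * q.1 + M 1 1) = M 0 0 * q.1 + M 0 1

lemma IsMoebius.mul {h : Bool} {g g' : Equiv.Perm HalfSpace} (hg : IsMoebius h g)
    (hg' : IsMoebius h g') : IsMoebius h (g * g') := by
  obtain ⟨M, h1, h2, h3, h4⟩ := hg
  obtain ⟨N, k1, k2, k3, k4⟩ := hg'
  refine ⟨M * N, fun i j => ?_, ?_, ?_, fun q => ?_⟩
  · rw [Matrix.mul_apply]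
    exact Subring.sum_mem _ fun l _ => mul_mem (h1 _ _) (k1 _ _)
  · calc (M * N)ᴴ * formMatrix * (M * N) = Nᴴ * (Mᴴ * formMatrix * M) * N := by
          simp only [Matrix.conjTranspose_mul, mul_assoc]
      _ = formMatrix := by rw [h2, k2]
  · calc (M * N) * formMatrix * (M * N)ᴴ = M * (N * formMatrix * Nᴴ) * Mᴴ := by
          simp only [Matrix.conjTranspose_mul, mul_assoc]
      _ = formMatrix := by rw [k3, h3]
  · have e1 := h4 (g' q)
    have e2 := k4 q
    simp only [Matrix.mul_apply, Fin.sum_univ_two, Equiv.Perm.coe_mul, Function.comp_apply]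
    calc (g (g' q)).1 * ((M 1 0 * N 0 0 + M 1 1 * N 1 0) * q.1 + (M 1 0 * N 0 1 + M 1 1 * N 1 1))
        = (g (g' q)).1 * (M 1 0 * (N 0 0 * q.1 + N 0 1) + M 1 1 * (N 1 0 * q.1 + N 1 1)) := by
          noncomm_ring
      _ = ((g (g' q)).1 * (M 1 0 * (g' q).1 + M 1 1)) * (N 1 0 * q.1 + N 1 1) := by
          rw [← e2]; noncomm_ring
      _ = M 0 0 * ((g' q).1 * (N 1 0 * q.1 + N 1 1)) + M 0 1 * (N 1 0 * q.1 + N 1 1) := by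
          rw [e1]; noncomm_ring
      _ = _ := by rw [e2]; noncomm_ring

lemma IsMoebius.one (h : Bool) : IsMoebius h 1 :=
  ⟨1, fun i j => by
    rw [Matrix.one_apply]
    split_ifs
    exacts [one_mem _, zero_mem _], by simp, by simp, by simp⟩

lemma IsMoebius.inversion (h : Bool) : IsMoebius h inversion := by
  refine ⟨formMatrix, fun i j => ?_, ?_, ?_, fun q => ?_⟩
  · fin_cases i <;> fin_cases j <;> simp [formMatrix, zero_mem, one_mem]
  · ext i j : 1
    fin_cases i <;> fin_cases j <;> simp [formMatrix, Matrix.mul_apply, Fin.sum_univ_two]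
  · ext i j : 1
    fin_cases i <;> fin_cases j <;> simp [formMatrix, Matrix.mul_apply, Fin.sum_univ_two]
  · have : q.1 ≠ 0 := fun h0 => by have := q.2; simp [h0] at this
    simp [formMatrix, QuaternionicModular.inversion, this]

lemma imag_mem_order (h : Bool) (a b c : ℤ) : quat 0 a b c ∈ order h :=
  ⟨0, a, b, c, by simp, by simp⟩

lemma star_imag (a b c : ℝ) : star (quat 0 a b c) = -quat 0 a b c := by
  apply Quaternion.ext <;> simp

lemma IsMoebius.translation (h : Bool) (a b c : ℤ) :
    IsMoebius h (translation (quat 0 a b c) (quat_re _ _ _ _)) := by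
  refine ⟨!![1, quat 0 a b c; 0, 1], fun i j => ?_, ?_, ?_, fun q => ?_⟩
  · fin_cases i <;> fin_cases j <;> simp [zero_mem, one_mem, imag_mem_order]
  · ext i j : 1
    fin_cases i <;> fin_cases j <;>
      simp [formMatrix, Matrix.mul_apply, Fin.sum_univ_two, star_imag]
  · ext i j : 1
    fin_cases i <;> fin_cases j <;>
      simp [formMatrix, Matrix.mul_apply, Fin.sum_univ_two, star_imag]
  · simp [QuaternionicModular.translation]

lemma IsMoebius.diagonal {h : Bool} {u : ℍ[ℝ]} (hu : u ≠ 0) (hu' : u ∈ order h)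
    (h1 : Quaternion.normSq u = 1) : IsMoebius h (diagonal u hu) := by
  have e1 : star u * u = 1 := by rw [Quaternion.star_mul_self, h1]; simp
  have e2 : u * star u = 1 := by rw [Quaternion.self_mul_star, h1]; simp
  refine ⟨!![u, 0; 0, u], fun i j => ?_, ?_, ?_, fun q => ?_⟩
  · fin_cases i <;> fin_cases j <;> simp [zero_mem, hu']
  · ext i j : 1
    fin_cases i <;> fin_cases j <;>
      simp [formMatrix, Matrix.mul_apply, Fin.sum_univ_two, e1]
  · ext i j : 1
    fin_cases i <;> fin_cases j <;>
      simp [formMatrix, Matrix.mul_apply, Fin.sum_univ_two, e2]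
  · simp [QuaternionicModular.diagonal, hu, mul_assoc]

lemma abs_eq_half {x : ℝ} (h : |x| = 1 / 2) : ∃ e : ℤ, x = e + 1 / 2 := by
  rcases (abs_eq (by norm_num)).1 h with h | h
  exacts [⟨0, by rw [h]; norm_num⟩, ⟨-1, by rw [h]; norm_num⟩]

lemma hurwitzUnits_mem_order {u : ℍ[ℝ]} (hu : u ∈ hurwitzUnits) : u ∈ order true := by
  rcases hu with hu | ⟨h0, h1, h2, h3⟩
  · rcases hu with rfl | rfl | rfl | rfl | rfl | rfl | rfl | rfl
    · exact one_mem _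
    · exact neg_mem (one_mem _)
    · exact ⟨0, 1, 0, 0, by simp, by apply Quaternion.ext <;> simp⟩
    · exact ⟨0, -1, 0, 0, by simp, by apply Quaternion.ext <;> simp⟩
    · exact ⟨0, 0, 1, 0, by simp, by apply Quaternion.ext <;> simp⟩
    · exact ⟨0, 0, -1, 0, by simp, by apply Quaternion.ext <;> simp⟩
    · exact ⟨0, 0, 0, 1, by simp, by apply Quaternion.ext <;> simp⟩
    · exact ⟨0, 0, 0, -1, by simp, by apply Quaternion.ext <;> simp⟩
  · obtain ⟨a, ha⟩ := abs_eq_half h0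
    obtain ⟨b, hb⟩ := abs_eq_half h1
    obtain ⟨c, hc⟩ := abs_eq_half h2
    obtain ⟨d, hd⟩ := abs_eq_half h3
    refine ⟨2 * a + 1, b - a, c - a, d - a, by simp, ?_⟩
    apply Quaternion.ext <;> simp [ha, hb, hc, hd] <;> ring

lemma normSq_hurwitzUnits {u : ℍ[ℝ]} (hu : u ∈ hurwitzUnits) : Quaternion.normSq u = 1 := by
  rcases hu with hu | ⟨h0, h1, h2, h3⟩
  · simp only [Quaternion.normSq_def']
    rcases hu with rfl | rfl | rfl | rfl | rfl | rfl | rfl | rfl <;> simp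
  · rw [Quaternion.normSq_def', ← sq_abs u.re, ← sq_abs u.imI, ← sq_abs u.imJ, ← sq_abs u.imK,
      h0, h1, h2, h3]
    norm_num

lemma translation_inv (ω : ℍ[ℝ]) (hω : ω.re = 0) :
    (translation ω hω)⁻¹ = translation (-ω) (by simp [hω]) := by
  ext1 q
  exact Subtype.ext (sub_eq_add_neg _ _)

lemma diagonal_inv (u : ℍ[ℝ]) (hu : u ≠ 0) :
    (diagonal u hu)⁻¹ = diagonal u⁻¹ (inv_ne_zero hu) := by
  ext1 q
  exact Subtype.ext (by simp [diagonal, Equiv.Perm.inv_def, Equiv.symm])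

lemma inv_eq_star {u : ℍ[ℝ]} (h1 : Quaternion.normSq u = 1) : u⁻¹ = star u := by
  rw [Quaternion.inv_def, h1]; simp

/-- The elements of the modular group are Möbius transformations over the order. -/
lemma isMoebius_of_mem {h : Bool} {g : Equiv.Perm HalfSpace} (hg : g ∈ modularGroup h) :
    IsMoebius h g := by
  have key : ∀ S : Set (Equiv.Perm HalfSpace),
      (∀ g ∈ S, IsMoebius h g ∧ IsMoebius h g⁻¹) → ∀ g ∈ Subgroup.closure S, IsMoebius h g := by
    intro S hS g hg
    suffices IsMoebius h g ∧ IsMoebius h g⁻¹ from this.1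
    induction hg using Subgroup.closure_induction with
    | mem x hx => exact hS x hx
    | one => exact ⟨.one h, by rw [inv_one]; exact .one h⟩
    | mul x y _ _ hx hy => exact ⟨hx.1.mul hy.1, by rw [mul_inv_rev]; exact hy.2.mul hx.2⟩
    | inv x _ hx => exact ⟨hx.2, by rw [inv_inv]; exact hx.1⟩
  have hT : IsMoebius h inversion ∧ IsMoebius h inversion⁻¹ := ⟨.inversion h, .inversion h⟩
  have hL : ∀ g ∈ lipschitzTranslations, IsMoebius h g ∧ IsMoebius h g⁻¹ := by
    rintro _ ⟨a, b, c, rfl⟩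
    change IsMoebius h (translation (quat 0 a b c) (quat_re _ _ _ _)) ∧
      IsMoebius h (translation (quat 0 a b c) (quat_re _ _ _ _))⁻¹
    refine ⟨.translation h a b c, ?_⟩
    have := IsMoebius.translation h (-a) (-b) (-c)
    rw [translation_inv]
    convert this using 2
    apply Quaternion.ext <;> simp
  cases h with
  | false =>
    refine key _ ?_ g hg
    rintro g (rfl | hg)
    exacts [hT, hL g hg]
  | true =>
    refine key _ ?_ g hg
    rintro g ((rfl | hg) | ⟨u, hu, hu', rfl⟩)
    · exact hT
    · exact hL g hg
    · refine ⟨.diagonal hu (hurwitzUnits_mem_order hu') (normSq_hurwitzUnits hu'), ?_⟩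
      rw [diagonal_inv]
      refine .diagonal _ ?_ (by simp [normSq_hurwitzUnits hu'])
      rw [inv_eq_star (normSq_hurwitzUnits hu')]
      exact star_mem_order (hurwitzUnits_mem_order hu')

/-! ### Coordinates and the extended modular groups -/

/-- The height `Re q` of a point of the half-space. -/
def ht (q : HalfSpace) : ℝ := q.1.re

/-- The horizontal coordinates of a point of the half-space. -/
def co (q : HalfSpace) : Fin 3 → ℝ := ![q.1.imI, q.1.imJ, q.1.imK]

/-- The squared norm of a point of the half-space. -/
def nsq (q : HalfSpace) : ℝ := ht q ^ 2 + ∑ i, co q i ^ 2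

/-- The point with height `t` and horizontal coordinates `ω`. -/
def pt (t : ℝ) (h : 0 < t) (ω : Fin 3 → ℝ) : HalfSpace := ⟨quat t (ω 0) (ω 1) (ω 2), h⟩

@[simp] lemma ht_pt (t : ℝ) (h : 0 < t) (ω : Fin 3 → ℝ) : ht (pt t h ω) = t := rfl

@[simp] lemma co_pt (t : ℝ) (h : 0 < t) (ω : Fin 3 → ℝ) : co (pt t h ω) = ω := by
  ext i; fin_cases i <;> rfl

lemma ht_pos (q : HalfSpace) : 0 < ht q := q.2

lemma nsq_eq (q : HalfSpace) : nsq q = Quaternion.normSq q.1 := by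
  rw [Quaternion.normSq_def', nsq, Fin.sum_univ_three]
  simp only [ht, co, Matrix.cons_val]
  ring

lemma nsq_pos (q : HalfSpace) : 0 < nsq q := by
  have := ht_pos q
  unfold nsq
  positivity

lemma halfSpace_ext {p q : HalfSpace} (h : ht p = ht q) (h' : ∀ i, co p i = co q i) : p = q :=
  Subtype.ext (quaternion_ext h (h' 0) (h' 1) (h' 2))

/-- The reflection `q ↦ q̄`, which reverses the orientation and normalizes both modular groups. -/
def conjugation : Equiv.Perm HalfSpace where
  toFun q := ⟨star q.1, by rw [Quaternion.re_star]; exact q.2⟩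
  invFun q := ⟨star q.1, by rw [Quaternion.re_star]; exact q.2⟩
  left_inv q := by simp
  right_inv q := by simp

@[simp] lemma ht_conjugation (q : HalfSpace) : ht (conjugation q) = ht q :=
  Quaternion.re_star q.1

@[simp] lemma co_conjugation (q : HalfSpace) (i : Fin 3) : co (conjugation q) i = -co q i := by
  fin_cases i <;> simp [co, conjugation]

lemma conjugation_mul_self : conjugation * conjugation = 1 := by
  ext1 q; simp [conjugation]

lemma conjugation_conjugation (q : HalfSpace) : conjugation (conjugation q) = q :=
  congrArg (fun g : Equiv.Perm HalfSpace => g q) conjugation_mul_self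

lemma conjugation_inv : conjugation⁻¹ = conjugation := rfl

/-- The affine transformation with the diagonal linear part `σ` and the translation part `m`. -/
def aff (σ : Fin 3 → ℤˣ) (m : Fin 3 → ℤ) : Equiv.Perm HalfSpace where
  toFun q := pt (ht q) (ht_pos q) fun i => ((σ i : ℤ) : ℝ) * co q i + m i
  invFun q := pt (ht q) (ht_pos q) fun i => ((σ i : ℤ) : ℝ) * (co q i - m i)
  left_inv q := by
    refine halfSpace_ext (by simp) fun i => ?_
    rcases Int.units_eq_one_or (σ i) with h | h <;> simp [h]
  right_inv q := by
    refine halfSpace_ext (by simp) fun i => ?_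
    rcases Int.units_eq_one_or (σ i) with h | h <;> simp [h]

@[simp] lemma ht_aff (σ : Fin 3 → ℤˣ) (m : Fin 3 → ℤ) (q : HalfSpace) : ht (aff σ m q) = ht q :=
  rfl

@[simp] lemma co_aff (σ : Fin 3 → ℤˣ) (m : Fin 3 → ℤ) (q : HalfSpace) (i : Fin 3) :
    co (aff σ m q) i = ((σ i : ℤ) : ℝ) * co q i + m i := by
  simp [aff]

/-- The cyclic permutation of the horizontal coordinates by `k` places. -/
def rot (k : Fin 3) : Equiv.Perm HalfSpace where
  toFun q := pt (ht q) (ht_pos q) fun i => co q (i + k)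
  invFun q := pt (ht q) (ht_pos q) fun i => co q (i - k)
  left_inv q := halfSpace_ext (by simp) fun i => by simp
  right_inv q := halfSpace_ext (by simp) fun i => by simp

@[simp] lemma ht_rot (k : Fin 3) (q : HalfSpace) : ht (rot k q) = ht q := rfl

@[simp] lemma co_rot (k : Fin 3) (q : HalfSpace) (i : Fin 3) :
    co (rot k q) i = co q (i + k) := by
  simp [rot]

/-- The reflection `q ↦ q / |q|²` in the unit sphere. -/
def sphereReflection : Equiv.Perm HalfSpace := conjugation * inversion

@[simp] lemma ht_sphereReflection (q : HalfSpace) : ht (sphereReflection q) = ht q / nsq q := by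
  rw [nsq_eq]
  simp [sphereReflection, ht, conjugation, inversion, Quaternion.inv_def, div_eq_inv_mul]

@[simp] lemma co_sphereReflection (q : HalfSpace) (i : Fin 3) :
    co (sphereReflection q) i = co q i / nsq q := by
  rw [nsq_eq]
  fin_cases i <;>
    simp [sphereReflection, co, conjugation, inversion, Quaternion.inv_def, div_eq_inv_mul]

lemma mem_lipschitzTranslations {g : Equiv.Perm HalfSpace} :
    g ∈ lipschitzTranslations ↔ ∃ m : Fin 3 → ℤ, g = aff 1 m := by
  have key (a b c : ℤ) : translation (quat 0 a b c) (quat_re _ _ _ _) = aff 1 ![a, b, c] := by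
    ext1 q
    refine Subtype.ext (quaternion_ext ?_ ?_ ?_ ?_) <;> simp [aff, translation, pt, ht, co]
  constructor
  · rintro ⟨a, b, c, rfl⟩
    exact ⟨_, key a b c⟩
  · rintro ⟨m, rfl⟩
    refine ⟨m 0, m 1, m 2, ?_⟩
    refine Eq.trans ?_ (key _ _ _).symm
    congr 1
    ext i
    fin_cases i <;> rfl

lemma conj_mem_modularGroup {h : Bool} {g : Equiv.Perm HalfSpace} (hg : g ∈ modularGroup h) :
    conjugation * g * conjugation ∈ modularGroup h := by
  have key : ∀ S : Set (Equiv.Perm HalfSpace),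
      (∀ g ∈ S, conjugation * g * conjugation ∈ Subgroup.closure S) →
      ∀ g ∈ Subgroup.closure S, conjugation * g * conjugation ∈ Subgroup.closure S := by
    intro S hS g hg
    induction hg using Subgroup.closure_induction with
    | mem x hx => exact hS x hx
    | one => rw [mul_one, conjugation_mul_self]; exact one_mem _
    | mul x y _ _ hx hy =>
      convert mul_mem hx hy using 1
      rw [show conjugation * x * conjugation * (conjugation * y * conjugation) =
        conjugation * x * (conjugation * conjugation) * y * conjugation by group,
        conjugation_mul_self]
      group
    | inv x _ hx =>
      convert inv_mem hx using 1
      rw [mul_inv_rev, mul_inv_rev, conjugation_inv, mul_assoc]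
  have hT : conjugation * inversion * conjugation = inversion := by
    ext1 q
    exact Subtype.ext (by simp [conjugation, inversion])
  have hL : ∀ g ∈ lipschitzTranslations, conjugation * g * conjugation ∈ lipschitzTranslations := by
    intro g hg
    obtain ⟨m, rfl⟩ := mem_lipschitzTranslations.1 hg
    refine mem_lipschitzTranslations.2 ⟨-m, ?_⟩
    ext1 q
    refine halfSpace_ext (by simp) fun i => ?_
    simp [add_comm]
  cases h with
  | false =>
    refine key _ ?_ g hg
    rintro g (rfl | hg)
    · rw [hT]; exact Subgroup.subset_closure (Or.inl rfl)
    · exact Subgroup.subset_closure (Or.inr (hL g hg))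
  | true =>
    refine key _ ?_ g hg
    rintro g ((rfl | hg) | ⟨u, hu, hu', rfl⟩)
    · rw [hT]; exact Subgroup.subset_closure (Or.inl (Or.inl rfl))
    · exact Subgroup.subset_closure (Or.inl (Or.inr (hL g hg)))
    · refine Subgroup.subset_closure (Or.inr ⟨u, hu, hu', ?_⟩)
      ext1 q
      refine Subtype.ext ?_
      simp [conjugation, diagonal, inv_eq_star (normSq_hurwitzUnits hu'), mul_assoc]

/-- The extension of the modular group by the orientation reversing map `conjugation`. -/
def extendedGroup (h : Bool) : Subgroup (Equiv.Perm HalfSpace) where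
  carrier := {g | g ∈ modularGroup h ∨ g * conjugation ∈ modularGroup h}
  one_mem' := Or.inl (one_mem _)
  mul_mem' := by
    have e (a b : Equiv.Perm HalfSpace) : a * b =
        a * conjugation * (conjugation * b) := by
      rw [show a * conjugation * (conjugation * b) = a * (conjugation * conjugation) * b by group,
        conjugation_mul_self, mul_one]
    rintro a b (ha | ha) (hb | hb)
    · exact Or.inl (mul_mem ha hb)
    · exact Or.inr (by rw [mul_assoc]; exact mul_mem ha hb)
    · refine Or.inr ?_
      rw [mul_assoc, e]
      exact mul_mem ha (by rw [← mul_assoc]; exact conj_mem_modularGroup hb)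
    · refine Or.inl ?_
      rw [e]
      have := conj_mem_modularGroup hb
      rw [← mul_assoc, mul_assoc, conjugation_mul_self, mul_one] at this
      exact mul_mem ha this
  inv_mem' := by
    rintro a (ha | ha)
    · exact Or.inl (inv_mem ha)
    · have := conj_mem_modularGroup (inv_mem ha)
      rw [mul_inv_rev, conjugation_inv, ← mul_assoc, conjugation_mul_self, one_mul] at this
      exact Or.inr this

lemma modularGroup_le_extendedGroup (h : Bool) : modularGroup h ≤ extendedGroup h :=
  fun _ => Or.inl

lemma conjugation_mem_extendedGroup (h : Bool) : conjugation ∈ extendedGroup h :=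
  Or.inr (by rw [conjugation_mul_self]; exact one_mem _)

lemma modularGroup_false_le (h : Bool) : modularGroup false ≤ modularGroup h := by
  cases h
  · exact le_rfl
  · exact Subgroup.closure_mono Set.subset_union_left

lemma extendedGroup_false_le (h : Bool) : extendedGroup false ≤ extendedGroup h :=
  fun _ => Or.imp (modularGroup_false_le h ·) (modularGroup_false_le h ·)

lemma inversion_mem (h : Bool) : inversion ∈ modularGroup h :=
  modularGroup_false_le h (Subgroup.subset_closure (Or.inl rfl))

lemma sphereReflection_mem (h : Bool) : sphereReflection ∈ extendedGroup h :=
  mul_mem (conjugation_mem_extendedGroup h) (Or.inl (inversion_mem h))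

lemma aff_one_mem (m : Fin 3 → ℤ) : aff 1 m ∈ modularGroup false :=
  Subgroup.subset_closure (Or.inr (mem_lipschitzTranslations.2 ⟨m, rfl⟩))

/-- For `e² = -1`, the transformation `D_e` is the cube of `q ↦ (q + e)⁻¹`. -/
lemma inversion_mul_translation_pow_three {e : ℍ[ℝ]} (he : e * e = -1) (h0 : e.re = 0)
    (h : e ≠ 0) : (inversion * translation e h0) ^ 3 = diagonal e h := by
  ext1 q
  refine Subtype.ext ?_
  have hq : q.1 ≠ 0 := fun hq => by have := q.2; simp [hq] at this
  have hx : q.1 + e ≠ 0 := fun hq => by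
    have := q.2
    rw [eq_neg_of_add_eq_zero_left hq] at this
    simp [h0] at this
  have hinv : e⁻¹ = -e := inv_eq_of_mul_eq_one_right (by rw [mul_neg, he, neg_neg])
  have e1 : (q.1 + e)⁻¹ + e = e * q.1 * (q.1 + e)⁻¹ := by
    rw [eq_mul_inv_iff_mul_eq₀ hx, add_mul, inv_mul_cancel₀ hx, mul_add, he]
    abel
  have e2 : ((q.1 + e)⁻¹ + e)⁻¹ + e = e * q.1⁻¹ * e⁻¹ := by
    rw [e1, mul_inv_rev, inv_inv, mul_inv_rev, ← mul_assoc, add_mul, add_mul,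
      mul_inv_cancel₀ hq, one_mul, hinv]
    abel
  calc ((inversion * translation e h0) ^ 3 : Equiv.Perm HalfSpace) q
      = (((q.1 + e)⁻¹ + e)⁻¹ + e)⁻¹ := by simp [pow_succ, inversion, translation]
    _ = e * q.1 * e⁻¹ := by rw [e2]; simp [mul_assoc]

lemma aff_sign_mem {σ : Fin 3 → ℤˣ} (hσ : σ 0 * σ 1 * σ 2 = 1) :
    aff σ 0 ∈ modularGroup false := by
  have key (a b c : ℤ) (he : quat 0 a b c * quat 0 a b c = -1) (h : quat 0 a b c ≠ 0)
      (hd : aff σ 0 = diagonal (quat 0 a b c) h) : aff σ 0 ∈ modularGroup false := by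
    rw [hd, ← inversion_mul_translation_pow_three he (quat_re _ _ _ _) h]
    have ht : translation (quat 0 a b c) (quat_re _ _ _ _) ∈ modularGroup false :=
      Subgroup.subset_closure (Or.inr ⟨a, b, c, rfl⟩)
    exact pow_mem (mul_mem (inversion_mem _) ht) 3
  have hne (a b c : ℤ) (h : a ^ 2 + b ^ 2 + c ^ 2 = 1) : quat 0 a b c ≠ 0 := by
    intro h0
    have h1 : Quaternion.normSq (quat 0 a b c) = 0 := by rw [h0, map_zero]
    rw [Quaternion.normSq_def'] at h1
    simp only [quat_re, quat_imI, quat_imJ, quat_imK] at h1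
    have : a ^ 2 + b ^ 2 + c ^ 2 = 0 := by
      have : (a : ℝ) ^ 2 + b ^ 2 + c ^ 2 = 0 := by linarith
      exact_mod_cast this
    omega
  have hns (a b c : ℤ) (h : a ^ 2 + b ^ 2 + c ^ 2 = 1) :
      Quaternion.normSq (quat 0 a b c) = 1 := by
    rw [Quaternion.normSq_def']
    simp only [quat_re, quat_imI, quat_imJ, quat_imK]
    have : (a : ℝ) ^ 2 + b ^ 2 + c ^ 2 = 1 := by exact_mod_cast h
    linarith
  have hall (a b c : ℤ) (h : a ^ 2 + b ^ 2 + c ^ 2 = 1)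
      (hco : ∀ x y z : ℝ, quat 0 a b c * quat 0 x y z * star (quat 0 a b c) =
        quat 0 ((σ 0 : ℤ) * x) ((σ 1 : ℤ) * y) ((σ 2 : ℤ) * z)) :
      aff σ 0 ∈ modularGroup false := by
    refine key a b c ?_ (hne a b c h) ?_
    · have := Quaternion.self_mul_star (quat 0 a b c)
      rw [star_imag, hns a b c h, mul_neg] at this
      rw [← neg_eq_iff_eq_neg, this]
      simp
    · ext1 q
      have hq : q.1 = (ht q : ℍ[ℝ]) + quat 0 (co q 0) (co q 1) (co q 2) := by
        refine quaternion_ext ?_ ?_ ?_ ?_ <;> simp [ht, co]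
      have hd : (diagonal (quat 0 a b c) (hne a b c h) q).1 =
          (ht q : ℍ[ℝ]) + quat 0 a b c * quat 0 (co q 0) (co q 1) (co q 2) *
            star (quat 0 a b c) := by
        change quat 0 a b c * q.1 * (quat 0 a b c)⁻¹ = _
        rw [inv_eq_star (hns a b c h), hq, mul_add, add_mul, ← Quaternion.coe_commutes, mul_assoc,
          Quaternion.self_mul_star, hns a b c h]
        simp
      refine Subtype.ext ?_
      rw [hd, hco]
      refine quaternion_ext ?_ ?_ ?_ ?_ <;> simp [aff, pt]
  rcases Int.units_eq_one_or (σ 0) with h0 | h0 <;>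
  rcases Int.units_eq_one_or (σ 1) with h1 | h1 <;>
  rcases Int.units_eq_one_or (σ 2) with h2 | h2 <;>
  rw [h0, h1, h2] at hσ
  · have : σ = 1 := by ext i; fin_cases i <;> simp [h0, h1, h2]
    rw [this]
    exact aff_one_mem 0
  · exact absurd hσ (by decide)
  · exact absurd hσ (by decide)
  · refine hall 1 0 0 (by norm_num) fun x y z => ?_
    refine quaternion_ext ?_ ?_ ?_ ?_ <;> simp [h0, h1, h2]
  · exact absurd hσ (by decide)
  · refine hall 0 1 0 (by norm_num) fun x y z => ?_
    refine quaternion_ext ?_ ?_ ?_ ?_ <;> simp [h0, h1, h2]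
  · refine hall 0 0 1 (by norm_num) fun x y z => ?_
    refine quaternion_ext ?_ ?_ ?_ ?_ <;> simp [h0, h1, h2]
  · exact absurd hσ (by decide)

lemma aff_mem (σ : Fin 3 → ℤˣ) (m : Fin 3 → ℤ) (h : Bool) : aff σ m ∈ extendedGroup h := by
  refine extendedGroup_false_le h ?_
  have e1 : aff σ m = aff 1 m * aff σ 0 := by
    ext1 q
    exact halfSpace_ext (by simp) (by simp)
  rw [e1]
  refine mul_mem (Or.inl (aff_one_mem m)) ?_
  rcases Int.units_eq_one_or (σ 0 * σ 1 * σ 2) with h1 | h1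
  · exact Or.inl (aff_sign_mem h1)
  · refine Or.inr ?_
    have e2 : aff σ 0 * conjugation = aff (-σ) 0 := by
      ext1 q
      exact halfSpace_ext (by simp) (by simp)
    rw [e2]
    refine aff_sign_mem ?_
    simpa using congrArg Neg.neg h1

lemma rot_mem {h : Bool} {k : Fin 3} (hk : h = false → k = 0) : rot k ∈ modularGroup h := by
  have h0 : rot 0 = 1 := by
    ext1 q
    exact halfSpace_ext (by simp) (by simp)
  cases h with
  | false => rw [hk rfl, h0]; exact one_mem _
  | true =>
    have hadd (k l : Fin 3) : rot k * rot l = rot (k + l) := by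
      ext1 q
      refine halfSpace_ext (by simp) fun i => ?_
      simp [add_assoc]
    have h2 : rot 2 ∈ modularGroup true := by
      have hu : quat (1 / 2) (1 / 2) (1 / 2) (1 / 2) ∈ hurwitzUnits := by
        refine Or.inr ⟨?_, ?_, ?_, ?_⟩ <;> simp
      have h1 := normSq_hurwitzUnits hu
      have hne : quat (1 / 2) (1 / 2) (1 / 2) (1 / 2) ≠ 0 := by
        intro h0
        rw [h0] at h1
        simp at h1
      refine Subgroup.subset_closure (Or.inr ⟨_, hne, hu, ?_⟩)
      ext1 q
      refine Subtype.ext ?_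
      change _ = quat (1 / 2) (1 / 2) (1 / 2) (1 / 2) * q.1 *
        (quat (1 / 2) (1 / 2) (1 / 2) (1 / 2))⁻¹
      rw [inv_eq_star h1]
      refine quaternion_ext ?_ ?_ ?_ ?_ <;> simp [rot, pt, ht, co] <;> ring
    fin_cases k
    · change rot 0 ∈ _
      rw [h0]; exact one_mem _
    · change rot (2 + 2) ∈ _
      rw [← hadd]; exact mul_mem h2 h2
    · exact h2

/-! ### Cusps and heights -/

/-- An integral vector `(u, v, w)` of Minkowski space, with the form `u v - |w|²`. Isotropic vectors
in the closed positive cone stand for cusps: if `u > 0` the cusp is the point `w / u`, and otherwise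
it is `∞`. -/
@[ext] structure Cusp where
  /-- The first isotropic coordinate. -/
  u : ℤ
  /-- The second isotropic coordinate. -/
  v : ℤ
  /-- The Euclidean coordinates. -/
  w : Fin 3 → ℤ

/-- The vector is isotropic, and nonzero in the closed positive cone. -/
structure Cusp.IsIsotropic (n : Cusp) : Prop where
  u_nonneg : 0 ≤ n.u
  v_nonneg : 0 ≤ n.v
  pos : 0 < n.u + n.v
  mul_eq : n.u * n.v = ∑ i, n.w i ^ 2

/-- The pairing of a vector with the point `q`, in units of the pairing of `∞` with `q`. For the
cusp `n` of a matrix with the bottom row `(c, d)` it equals `|c q + d|²`. -/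
def Cusp.pair (n : Cusp) (q : HalfSpace) : ℝ := n.u * nsq q + n.v - 2 * ∑ i, n.w i * co q i

/-- The cusp `∞`. -/
def Cusp.infty : Cusp := ⟨0, 1, 0⟩

@[simp] lemma Cusp.pair_infty (q : HalfSpace) : Cusp.infty.pair q = 1 := by
  simp [Cusp.pair, Cusp.infty]

/-- The map `g` changes the height by the factor `1 / n.pair`, that is, `g` sends the cusp `n`
to `∞`. -/
def HasCusp (g : Equiv.Perm HalfSpace) (n : Cusp) : Prop :=
  ∀ q, ht q = ht (g q) * n.pair q

lemma Cusp.pair_injective {n n' : Cusp} (h : ∀ q, n.pair q = n'.pair q) : n = n' := by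
  have key (t : ℝ) (ht : 0 < t) (ω : Fin 3 → ℝ) : n.u * (t ^ 2 + ∑ i, ω i ^ 2) + n.v -
      2 * ∑ i, n.w i * ω i = n'.u * (t ^ 2 + ∑ i, ω i ^ 2) + n'.v - 2 * ∑ i, n'.w i * ω i := by
    simpa [Cusp.pair, nsq] using h (pt t ht ω)
  have h1 := key 1 one_pos 0
  have h2 := key 2 two_pos 0
  simp only [Fin.sum_univ_three, Pi.zero_apply] at h1 h2
  have hu : (n.u : ℝ) = n'.u := by linarith
  have hv : (n.v : ℝ) = n'.v := by linarith
  refine Cusp.ext (by exact_mod_cast hu) (by exact_mod_cast hv) (funext fun i => ?_)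
  have h3 := key 1 one_pos (Pi.single i 1)
  rw [hu, hv] at h3
  simp only [Pi.single_apply, mul_ite, mul_one, mul_zero, Finset.sum_ite_eq',
    Finset.mem_univ, if_true] at h3
  have : (n.w i : ℝ) = n'.w i := by linarith
  exact_mod_cast this

lemma HasCusp.unique {g : Equiv.Perm HalfSpace} {n n' : Cusp} (h : HasCusp g n)
    (h' : HasCusp g n') : n = n' :=
  Cusp.pair_injective fun q => mul_left_cancel₀ (ht_pos (g q)).ne' ((h q).symm.trans (h' q))

/-- The bottom row of the matrix of a Möbius transformation gives its cusp. -/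
lemma exists_matrix_hasCusp {h : Bool} {g : Equiv.Perm HalfSpace} (hg : IsMoebius h g) :
    ∃ a b c d : ℍ[ℝ], b ∈ order h ∧ d ∈ order h ∧ star a * d + star c * b = 1 ∧
      star b * d + star d * b = 0 ∧
      (∀ q : HalfSpace, (g q).1 * (c * q.1 + d) = a * q.1 + b) ∧
      ∃ n : Cusp, n.IsIsotropic ∧ HasCusp g n ∧ (n.u : ℝ) = Quaternion.normSq c ∧
        (n.v : ℝ) = Quaternion.normSq d := by
  obtain ⟨M, h1, h2, h3, h4⟩ := hg
  have e00 := congrFun (congrFun h2 0) 0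
  have e01 := congrFun (congrFun h2 0) 1
  have e11 := congrFun (congrFun h2 1) 1
  have f11 := congrFun (congrFun h3 1) 1
  simp only [Matrix.mul_apply, Fin.sum_univ_two, formMatrix, Matrix.conjTranspose_apply,
    Matrix.of_apply, Matrix.cons_val', Matrix.cons_val_zero, Matrix.cons_val_one,
    Matrix.cons_val_fin_one, mul_zero, mul_one, zero_add, add_zero] at e00 e01 e11 f11
  have hcd : star (M 1 1) * M 1 0 ∈ order h := mul_mem (star_mem_order (h1 1 1)) (h1 1 0)
  have hb := h1 0 1
  have hd := h1 1 1
  obtain ⟨u, hu⟩ := exists_int_normSq (h1 1 0)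
  obtain ⟨v, hv⟩ := exists_int_normSq (h1 1 1)
  generalize M 0 0 = a at *
  generalize M 0 1 = b at *
  generalize M 1 0 = c at *
  generalize M 1 1 = d at *
  have hre : (star d * c).re = 0 := by
    have := congrArg QuaternionAlgebra.re f11
    simp at this ⊢
    linarith
  obtain ⟨x, y, z, hxyz⟩ := order_integral_of_re_eq_zero hcd hre
  have hu0 := Quaternion.normSq_nonneg (a := c)
  have hv0 := Quaternion.normSq_nonneg (a := d)
  have hpair (q : HalfSpace) :
      Quaternion.normSq (c * q.1 + d) = Cusp.pair ⟨u, v, ![x, y, z]⟩ q := by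
    have e1 : Quaternion.normSq (c * q.1 + d) = Quaternion.normSq c * Quaternion.normSq q.1 +
        Quaternion.normSq d + 2 * (star d * c * q.1).re := by
      simp only [Quaternion.normSq_def', Quaternion.re_add, Quaternion.imI_add,
        Quaternion.imJ_add, Quaternion.imK_add, Quaternion.re_mul, Quaternion.imI_mul,
        Quaternion.imJ_mul, Quaternion.imK_mul, Quaternion.re_star, Quaternion.imI_star,
        Quaternion.imJ_star, Quaternion.imK_star]
      ring
    rw [e1, hxyz, hu, hv, ← nsq_eq]
    simp [Cusp.pair, co, Fin.sum_univ_three]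
    ring
  have hcusp : HasCusp g ⟨u, v, ![x, y, z]⟩ := by
    intro q
    have e2 : star (c * q.1 + d) * (a * q.1 + b) + star (a * q.1 + b) * (c * q.1 + d) =
        q.1 + star q.1 := by
      have s01 := congrArg star e01
      simp only [star_add, star_mul, star_star, star_one] at s01 ⊢
      calc _ = star q.1 * (star c * a + star a * c) * q.1 + star q.1 * (star a * d + star c * b) +
            (star d * a + star b * c) * q.1 + (star d * b + star b * d) := by noncomm_ring
        _ = _ := by
          rw [e00, e11, add_comm (star a * d), e01, add_comm (star d * a), s01]
          noncomm_ring
    have e3 : ht (g q) * Quaternion.normSq (c * q.1 + d) = ht q := by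
      have := congrArg QuaternionAlgebra.re e2
      rw [← h4 q] at this
      have e4 : ∀ p l : ℍ[ℝ], (star l * (p * l) + star (p * l) * l).re =
          2 * (p.re * Quaternion.normSq l) := by
        intro p l
        simp only [Quaternion.normSq_def', Quaternion.re_add, Quaternion.re_mul,
          Quaternion.imI_mul, Quaternion.imJ_mul, Quaternion.imK_mul, Quaternion.re_star,
          Quaternion.imI_star, Quaternion.imJ_star, Quaternion.imK_star]
        ring
      have e5 : (q.1 + star q.1).re = 2 * q.1.re := by simp; ring
      have e6 := (e4 _ _).symm.trans (this.trans e5)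
      exact mul_left_cancel₀ two_ne_zero e6
    rw [← e3, hpair]
  refine ⟨a, b, c, d, hb, hd, by rw [add_comm, e01], by rw [add_comm, e11], h4,
    ⟨u, v, ![x, y, z]⟩, ⟨?_, ?_, ?_, ?_⟩, hcusp, hu.symm, hv.symm⟩
  · rw [hu] at hu0; exact_mod_cast hu0
  · rw [hv] at hv0; exact_mod_cast hv0
  · by_contra hneg
    have h0 : c = 0 ∧ d = 0 := by
      have : u = 0 ∧ v = 0 := by
        rw [hu] at hu0; rw [hv] at hv0
        norm_cast at hu0 hv0
        simp only at hneg
        omega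
      rw [this.1] at hu; rw [this.2] at hv
      exact ⟨Quaternion.normSq_eq_zero.1 (by simpa using hu),
        Quaternion.normSq_eq_zero.1 (by simpa using hv)⟩
    rw [h0.1, h0.2] at e01
    simp at e01
  · have := congrArg Quaternion.normSq hxyz
    rw [map_mul, Quaternion.normSq_star, hu, hv, Quaternion.normSq_def'] at this
    simp only [quat_re, quat_imI, quat_imJ, quat_imK] at this
    simp only [Fin.sum_univ_three, Matrix.cons_val]
    have h' : (u : ℝ) * v = x ^ 2 + y ^ 2 + z ^ 2 := by linarith
    exact_mod_cast h'

/-- The numerators of the entries of the rotation matrix of `q ↦ p q p̄` for the integral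
quaternion `p / 2`, which acts with the denominator 4. -/
def rotationNumerators (p : Fin 4 → ℤ) : Fin 3 → Fin 3 → ℤ :=
  ![![p 0 ^ 2 + p 1 ^ 2 - p 2 ^ 2 - p 3 ^ 2, 2 * (p 1 * p 2 - p 0 * p 3),
      2 * (p 1 * p 3 + p 0 * p 2)],
    ![2 * (p 1 * p 2 + p 0 * p 3), p 0 ^ 2 - p 1 ^ 2 + p 2 ^ 2 - p 3 ^ 2,
      2 * (p 2 * p 3 - p 0 * p 1)],
    ![2 * (p 1 * p 3 - p 0 * p 2), 2 * (p 2 * p 3 + p 0 * p 1),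
      p 0 ^ 2 - p 1 ^ 2 - p 2 ^ 2 + p 3 ^ 2]]

/-- The numerators of an integral unit of norm 4 give 4 times a signed cyclic permutation matrix of
determinant 1, which is diagonal if `e` holds. -/
def IsSignedCyclic (p : Fin 4 → ℤ) : Prop :=
  ∃ (k : Fin 3) (s : Fin 3 → ℤˣ), (p 0 % 2 = 0 → k = 0) ∧ s 0 * s 1 * s 2 = 1 ∧
    ∀ i j, rotationNumerators p i j = if j = i + k then 4 * (s i : ℤ) else 0

instance : DecidablePred IsSignedCyclic := fun p => by
  unfold IsSignedCyclic
  infer_instance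

lemma isSignedCyclic_of_mem : ∀ a b c d : Fin 5,
    ((a : ℤ) - 2) ^ 2 + ((b : ℤ) - 2) ^ 2 + ((c : ℤ) - 2) ^ 2 + ((d : ℤ) - 2) ^ 2 = 4 →
    ((a : ℤ) - b) % 2 = 0 → ((a : ℤ) - c) % 2 = 0 → ((a : ℤ) - d) % 2 = 0 →
    IsSignedCyclic ![(a : ℤ) - 2, (b : ℤ) - 2, (c : ℤ) - 2, (d : ℤ) - 2] := by
  decide +kernel

/-- Conjugation by a Hurwitz unit permutes the coordinates cyclically up to signs, and conjugation
by a Lipschitz unit only changes signs; the number of sign changes is even. -/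
lemma exists_conj_unit {h : Bool} {x : ℍ[ℝ]} (hx : x ∈ order h)
    (h1 : Quaternion.normSq x = 1) : ∃ (k : Fin 3) (s : Fin 3 → ℤˣ), (h = false → k = 0) ∧
      s 0 * s 1 * s 2 = 1 ∧ ∀ (y : ℝ) (ω : Fin 3 → ℝ),
        x * quat y (ω 0) (ω 1) (ω 2) * star x = quat y ((s 0 : ℤ) * ω (0 + k))
          ((s 1 : ℤ) * ω (1 + k)) ((s 2 : ℤ) * ω (2 + k)) := by
  obtain ⟨a, b, c, d, ha, rfl⟩ := hx
  have h4 : a ^ 2 + (a + 2 * b) ^ 2 + (a + 2 * c) ^ 2 + (a + 2 * d) ^ 2 = 4 := by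
    rw [Quaternion.normSq_def'] at h1
    simp only [quat_re, quat_imI, quat_imJ, quat_imK] at h1
    have : (a : ℝ) ^ 2 + (a + 2 * b) ^ 2 + (a + 2 * c) ^ 2 + (a + 2 * d) ^ 2 = 4 := by linarith
    exact_mod_cast this
  have hlift (p : ℤ) (hp : p ^ 2 ≤ 4) : ∃ f : Fin 5, p = (f : ℤ) - 2 := by
    have h1 : -2 ≤ p := by nlinarith
    have h2 : p ≤ 2 := by nlinarith
    exact ⟨⟨(p + 2).toNat, by omega⟩, by simp; omega⟩
  have s0 := sq_nonneg a
  have s1 := sq_nonneg (a + 2 * b)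
  have s2 := sq_nonneg (a + 2 * c)
  have s3 := sq_nonneg (a + 2 * d)
  obtain ⟨f0, e0⟩ := hlift a (by linarith)
  obtain ⟨f1, e1⟩ := hlift (a + 2 * b) (by linarith)
  obtain ⟨f2, e2⟩ := hlift (a + 2 * c) (by linarith)
  obtain ⟨f3, e3⟩ := hlift (a + 2 * d) (by linarith)
  have hdec := isSignedCyclic_of_mem f0 f1 f2 f3 (by rw [← e0, ← e1, ← e2, ← e3]; exact h4)
    (by omega) (by omega) (by omega)
  rw [← e0, ← e1, ← e2, ← e3] at hdec
  obtain ⟨k, s, hk, hs, hR⟩ := hdec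
  refine ⟨k, s, fun hh => hk ?_, hs, fun y ω => ?_⟩
  · exact Int.even_iff.1 (ha hh)
  · have hRR (i j : Fin 3) :
        ((rotationNumerators ![a, a + 2 * b, a + 2 * c, a + 2 * d] i j : ℤ) : ℝ) =
        if j = i + k then 4 * ((s i : ℤ) : ℝ) else 0 := by
      rw [hR]
      split_ifs <;> simp
    have hrow (i : Fin 3) : (s i : ℤ) * ω (i + k) = ∑ j,
        ((rotationNumerators ![a, a + 2 * b, a + 2 * c, a + 2 * d] i j : ℤ) : ℝ) / 4 * ω j := by
      simp only [hRR, ite_div, ite_mul, zero_div, zero_mul, Finset.sum_ite_eq', Finset.mem_univ,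
        if_true]
      ring
    have h4' : (a : ℝ) ^ 2 + (a + 2 * b) ^ 2 + (a + 2 * c) ^ 2 + (a + 2 * d) ^ 2 = 4 := by
      exact_mod_cast h4
    rw [hrow, hrow, hrow]
    simp only [Fin.sum_univ_three, rotationNumerators, Matrix.cons_val', Matrix.cons_val]
    push_cast
    refine quaternion_ext ?_ ?_ ?_ ?_ <;>
      simp only [Quaternion.re_mul, Quaternion.imI_mul, Quaternion.imJ_mul,
        Quaternion.imK_mul, Quaternion.re_star, Quaternion.imI_star, Quaternion.imJ_star,
        Quaternion.imK_star, quat_re, quat_imI, quat_imJ, quat_imK]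
    · linear_combination y / 4 * h4'
    all_goals ring

lemma eq_quat (q : HalfSpace) : q.1 = quat (ht q) (co q 0) (co q 1) (co q 2) := rfl

/-- An element of the modular group that fixes `∞` is an affine map, with a signed cyclic
permutation of determinant 1 as its linear part. -/
lemma affine_of_mem_modularGroup {h : Bool} {g : Equiv.Perm HalfSpace} (hg : g ∈ modularGroup h)
    (hinf : HasCusp g Cusp.infty) : ∃ (k : Fin 3) (s : Fin 3 → ℤˣ) (m : Fin 3 → ℤ),
      (h = false → k = 0) ∧ s 0 * s 1 * s 2 = 1 ∧ g = aff s m * rot k := by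
  obtain ⟨a, b, c, d, hb, hd, e1, e2, e3, n, -, hn, hu, hv⟩ :=
    exists_matrix_hasCusp (isMoebius_of_mem hg)
  obtain rfl := hn.unique hinf
  have hc : c = 0 := Quaternion.normSq_eq_zero.1 (by rw [← hu]; simp [Cusp.infty])
  have hd1 : Quaternion.normSq d = 1 := by rw [← hv]; simp [Cusp.infty]
  have hdd : star d * d = 1 := by rw [Quaternion.star_mul_self, hd1]; simp
  have hdd' : d * star d = 1 := by rw [Quaternion.self_mul_star, hd1]; simp
  subst hc
  have ha : a = d := by
    have : star a * d * star d = star d := by simpa using congrArg (· * star d) e1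
    rw [mul_assoc, hdd', mul_one] at this
    exact star_injective this
  subst ha
  obtain ⟨k, s, hk, hs, hconj⟩ := exists_conj_unit hd hd1
  have hre : (b * star a).re = 0 := by
    have := congrArg QuaternionAlgebra.re e2
    simp at this ⊢
    linarith
  obtain ⟨x, y, z, hxyz⟩ := order_integral_of_re_eq_zero (mul_mem hb (star_mem_order hd)) hre
  refine ⟨k, s, ![x, y, z], hk, hs, ?_⟩
  ext1 q
  have hgq : (g q).1 = a * q.1 * star a + b * star a := by
    have := congrArg (· * star a) (e3 q)
    simpa [mul_assoc, hdd', add_mul] using this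
  rw [hxyz, eq_quat q, hconj (ht q) (co q)] at hgq
  refine Subtype.ext ?_
  rw [hgq, eq_quat, Equiv.Perm.mul_apply]
  refine quaternion_ext ?_ ?_ ?_ ?_ <;> simp

/-- The orientation reversing map `q ↦ q̄` is not in the modular group. -/
lemma conjugation_notMem (h : Bool) : conjugation ∉ modularGroup h := by
  intro hmem
  obtain ⟨k, s, m, -, hs, hg⟩ := affine_of_mem_modularGroup hmem (fun q => by simp)
  have key (ω : Fin 3 → ℝ) (i : Fin 3) : -ω i = ((s i : ℤ) : ℝ) * ω (i + k) + m i := by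
    have := congrArg (fun g : Equiv.Perm HalfSpace => co (g (pt 1 one_pos ω)) i) hg
    simpa using this
  have hm (i : Fin 3) : (m i : ℝ) = 0 := by simpa using (key 0 i).symm
  have hk : k = 0 := by
    by_contra hk
    have := key (Pi.single 0 1) 0
    have h0 : (0 : Fin 3) + k ≠ 0 := by simpa using hk
    rw [hm, Pi.single_eq_same, Pi.single_eq_of_ne h0] at this
    simp at this
  subst hk
  have hs' (i : Fin 3) : s i = -1 := by
    have := key 1 i
    rw [hm] at this
    simp only [Pi.one_apply, mul_one, add_zero] at this
    refine Units.ext ?_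
    push_cast
    exact_mod_cast this.symm
  rw [hs', hs', hs'] at hs
  exact absurd hs (by decide)

/-! ### The fundamental region -/

/-- The region `{q : |q| ≥ 1, 0 ≤ ω_i ≤ 1/2}` of the points with horizontal coordinates `ω`: the
pyramid with apex `∞` over a cube in the unit sphere. -/
def region : Set HalfSpace := {q | 1 ≤ nsq q ∧ ∀ i, 0 ≤ co q i ∧ co q i ≤ 1 / 2}

/-- The reflection `ω_i ↦ 1 - ω_i`. -/
def wallReflection (i : Fin 3) : Equiv.Perm HalfSpace :=
  aff (Function.update 1 i (-1)) (Pi.single i 1)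

lemma wallReflection_mem (i : Fin 3) (h : Bool) : wallReflection i ∈ extendedGroup h :=
  aff_mem _ _ h

lemma wallReflection_apply {i : Fin 3} {q : HalfSpace} (hq : co q i = 1 / 2) :
    wallReflection i q = q := by
  refine halfSpace_ext (by simp [wallReflection]) fun j => ?_
  rcases eq_or_ne j i with rfl | hj
  · simp [wallReflection, hq]; norm_num
  · simp [wallReflection, hj]

lemma sphereReflection_apply {q : HalfSpace} (hq : nsq q = 1) : sphereReflection q = q :=
  halfSpace_ext (by simp [hq]) (by simp [hq])

lemma conjugation_eq_aff : conjugation = aff (-1) 0 := by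
  ext1 q
  exact halfSpace_ext (by simp) (by simp)

lemma Cusp.isIsotropic_infty : Cusp.infty.IsIsotropic :=
  ⟨by simp [Cusp.infty], by simp [Cusp.infty], by simp [Cusp.infty], by simp [Cusp.infty]⟩

lemma hasCusp_one : HasCusp 1 Cusp.infty := fun q => by simp

lemma HasCusp.mul_aff {g : Equiv.Perm HalfSpace} {n : Cusp} (hg : HasCusp g n)
    (s : Fin 3 → ℤˣ) (m : Fin 3 → ℤ) : HasCusp (g * aff s m)
      ⟨n.u, n.v + n.u * ∑ i, m i ^ 2 - 2 * ∑ i, n.w i * m i,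
        fun i => (s i : ℤ) * (n.w i - n.u * m i)⟩ := by
  intro q
  have hs (i : Fin 3) : ((s i : ℤ) : ℝ) ^ 2 = 1 := by
    rcases Int.units_eq_one_or (s i) with h | h <;> simp [h]
  rw [← ht_aff s m q, hg, Equiv.Perm.mul_apply]
  congr 1
  simp only [Cusp.pair, nsq, ht_aff, co_aff, Fin.sum_univ_three]
  push_cast
  linear_combination (n.u : ℝ) * co q 0 ^ 2 * hs 0 + (n.u : ℝ) * co q 1 ^ 2 * hs 1 +
    (n.u : ℝ) * co q 2 ^ 2 * hs 2

lemma HasCusp.mul_sphereReflection {g : Equiv.Perm HalfSpace} {n : Cusp} (hg : HasCusp g n) :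
    HasCusp (g * sphereReflection) ⟨n.v, n.u, n.w⟩ := by
  intro q
  have h0 := (nsq_pos q).ne'
  have h1 := hg (sphereReflection q)
  rw [ht_sphereReflection, div_eq_iff h0] at h1
  rw [h1, Equiv.Perm.mul_apply, mul_assoc]
  congr 1
  have h2 : nsq (sphereReflection q) * nsq q = 1 := by
    have : nsq (sphereReflection q) = nsq q / nsq q ^ 2 := by
      rw [nsq]
      simp only [ht_sphereReflection, co_sphereReflection, div_pow, ← Finset.sum_div, ← add_div]
      rfl
    rw [this]
    field_simp
  simp only [Cusp.pair, co_sphereReflection, Fin.sum_univ_three]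
  calc _ = n.u * (nsq (sphereReflection q) * nsq q) + n.v * nsq q -
        2 * (n.w 0 * co q 0 + n.w 1 * co q 1 + n.w 2 * co q 2) * (nsq q / nsq q) := by ring
    _ = _ := by rw [h2, div_self h0]; ring

lemma exists_hasCusp {h : Bool} {x : Equiv.Perm HalfSpace} (hx : x ∈ extendedGroup h) :
    ∃ n : Cusp, n.IsIsotropic ∧ HasCusp x n := by
  rcases hx with hx | hx
  · obtain ⟨-, -, -, -, -, -, -, -, -, n, h1, h2, -⟩ :=
      exists_matrix_hasCusp (isMoebius_of_mem hx)
    exact ⟨n, h1, h2⟩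
  · obtain ⟨-, -, -, -, -, -, -, -, -, n, h1, h2, -⟩ :=
      exists_matrix_hasCusp (isMoebius_of_mem hx)
    have h3 := h2.mul_aff (-1) 0
    rw [← conjugation_eq_aff, mul_assoc, conjugation_mul_self, mul_one] at h3
    refine ⟨_, ⟨?_, ?_, ?_, ?_⟩, h3⟩
    · exact h1.u_nonneg
    · simpa using h1.v_nonneg
    · simpa using h1.pos
    · simpa using h1.mul_eq

/-- The elements of the extended group that fix `∞` are affine. -/
lemma affine_of_mem {h : Bool} {x : Equiv.Perm HalfSpace} (hx : x ∈ extendedGroup h)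
    (hinf : HasCusp x Cusp.infty) : ∃ (k : Fin 3) (s : Fin 3 → ℤˣ) (m : Fin 3 → ℤ),
      (h = false → k = 0) ∧ x = aff s m * rot k := by
  rcases hx with hx | hx
  · obtain ⟨k, s, m, hk, -, he⟩ := affine_of_mem_modularGroup hx hinf
    exact ⟨k, s, m, hk, he⟩
  · have h3 : HasCusp (x * conjugation) Cusp.infty := fun q => by
      simpa using hinf (conjugation q)
    obtain ⟨k, s, m, hk, -, he⟩ := affine_of_mem_modularGroup hx h3
    refine ⟨k, -s, m, hk, ?_⟩
    have : x = aff s m * rot k * conjugation := by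
      rw [← he, mul_assoc, conjugation_mul_self, mul_one]
    rw [this]
    ext1 q
    exact halfSpace_ext (by simp) (by simp)

lemma Cusp.IsIsotropic.mul_pair {n : Cusp} (hn : n.IsIsotropic) (q : HalfSpace) :
    n.u * n.pair q = (n.u * ht q) ^ 2 + ∑ i, (n.u * co q i - n.w i) ^ 2 := by
  have h : (n.u : ℝ) * n.v = ∑ i, (n.w i : ℝ) ^ 2 := by exact_mod_cast hn.mul_eq
  simp only [Cusp.pair, nsq, Fin.sum_univ_three] at h ⊢
  linear_combination h

lemma Cusp.IsIsotropic.eq_zero {n : Cusp} (hn : n.IsIsotropic) (hu : n.u = 0) : n.w = 0 := by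
  have h := hn.mul_eq
  rw [hu, zero_mul, Fin.sum_univ_three] at h
  ext i
  have : n.w i ^ 2 = 0 := by
    have := sq_nonneg (n.w 0); have := sq_nonneg (n.w 1); have := sq_nonneg (n.w 2)
    fin_cases i <;> simp only [Fin.zero_eta, Fin.mk_one, Fin.reduceFinMk] <;> linarith
  simpa using this

lemma Cusp.IsIsotropic.u_mul_sq_le {n : Cusp} (hn : n.IsIsotropic) (q : HalfSpace) :
    n.u * ht q ^ 2 ≤ n.pair q := by
  rcases hn.u_nonneg.eq_or_lt with h0 | h0
  · have hv : (0 : ℝ) ≤ n.v := by exact_mod_cast hn.v_nonneg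
    simp [Cusp.pair, hn.eq_zero h0.symm, ← h0, hv]
  · have h1 : (0 : ℝ) < n.u := by exact_mod_cast h0
    refine le_of_mul_le_mul_left ?_ h1
    rw [hn.mul_pair]
    have : 0 ≤ ∑ i, (n.u * co q i - n.w i) ^ 2 := Finset.sum_nonneg fun i _ => sq_nonneg _
    linarith

lemma Cusp.IsIsotropic.v_le {n : Cusp} (hn : n.IsIsotropic) (q : HalfSpace) :
    n.v ≤ 2 * n.pair q + 4 * n.u * nsq q := by
  have hv : (0 : ℝ) ≤ n.v := by exact_mod_cast hn.v_nonneg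
  rcases hn.u_nonneg.eq_or_lt with h0 | h0
  · simp [Cusp.pair, hn.eq_zero h0.symm, ← h0]
    linarith
  · have h1 : (0 : ℝ) < n.u := by exact_mod_cast h0
    refine le_of_mul_le_mul_left ?_ h1
    have h : (n.u : ℝ) * n.v = ∑ i, (n.w i : ℝ) ^ 2 := by exact_mod_cast hn.mul_eq
    have e : n.u * (2 * n.pair q + 4 * n.u * nsq q) - n.u * n.v =
        ∑ i, (n.w i - 2 * n.u * co q i) ^ 2 + 2 * ∑ i, (n.u * co q i) ^ 2 +
          6 * (n.u * ht q) ^ 2 := by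
      simp only [Cusp.pair, nsq, Fin.sum_univ_three] at h ⊢
      linear_combination h
    have : 0 ≤ ∑ i, (n.w i - 2 * n.u * co q i) ^ 2 := Finset.sum_nonneg fun i _ => sq_nonneg _
    have : 0 ≤ ∑ i, (n.u * co q i) ^ 2 := Finset.sum_nonneg fun i _ => sq_nonneg _
    nlinarith [sq_nonneg (n.u * ht q)]

/-- Local finiteness: only finitely many cusps are close to some point of a bounded region. -/
lemma finite_cusps (C τ ρ : ℝ) (hτ : 0 < τ) :
    {n : Cusp | n.IsIsotropic ∧ ∃ q, τ ≤ ht q ∧ nsq q ≤ ρ ∧ n.pair q ≤ C}.Finite := by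
  set A : ℤ := ⌈C / τ ^ 2⌉
  set B : ℤ := ⌈2 * C + 4 * A * ρ⌉
  set D : Fin 3 → ℤ := fun _ => A * B
  refine ((((Set.finite_Icc 0 A).prod (Set.finite_Icc 0 B)).prod (Set.finite_Icc (-D) D)).image
    (fun p : (ℤ × ℤ) × (Fin 3 → ℤ) => (⟨p.1.1, p.1.2, p.2⟩ : Cusp))).subset ?_
  rintro n ⟨hn, q, h1, h2, h3⟩
  have hu : n.u ≤ A := by
    have h4 := hn.u_mul_sq_le q
    have h5 : (0 : ℝ) ≤ n.u := by exact_mod_cast hn.u_nonneg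
    have h6 : (n.u : ℝ) * τ ^ 2 ≤ C := by
      have : τ ^ 2 ≤ ht q ^ 2 := by gcongr
      nlinarith
    have h7 : (n.u : ℝ) ≤ A := ((le_div_iff₀ (by positivity)).2 h6).trans (Int.le_ceil _)
    exact_mod_cast h7
  have hv : n.v ≤ B := by
    have h4 := hn.v_le q
    have h5 : (0 : ℝ) ≤ n.u := by exact_mod_cast hn.u_nonneg
    have h6 : (n.u : ℝ) ≤ A := by exact_mod_cast hu
    have h7 : (n.u : ℝ) * nsq q ≤ A * ρ := by
      have := (nsq_pos q).le
      calc (n.u : ℝ) * nsq q ≤ A * nsq q := by gcongr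
        _ ≤ A * ρ := mul_le_mul_of_nonneg_left h2 (h5.trans h6)
    have h8 : (n.v : ℝ) ≤ B := le_trans (by nlinarith) (Int.le_ceil _)
    exact_mod_cast h8
  have hw (i : Fin 3) : |n.w i| ≤ A * B := by
    have h4 : n.w i ^ 2 ≤ A * B := by
      calc n.w i ^ 2 ≤ ∑ i, n.w i ^ 2 :=
            Finset.single_le_sum (f := fun i => n.w i ^ 2) (fun i _ => sq_nonneg _)
              (Finset.mem_univ i)
        _ = n.u * n.v := hn.mul_eq.symm
        _ ≤ A * B := mul_le_mul hu hv hn.v_nonneg (hn.u_nonneg.trans hu)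
    have h5 : |n.w i| ≤ n.w i ^ 2 := by
      rw [← sq_abs]
      nlinarith [abs_nonneg (n.w i), (abs_nonneg (n.w i)).eq_or_lt]
    exact h5.trans h4
  exact ⟨((n.u, n.v), n.w), ⟨⟨⟨hn.u_nonneg, hu⟩, ⟨hn.v_nonneg, hv⟩⟩,
    ⟨fun i => (abs_le.1 (hw i)).1, fun i => (abs_le.1 (hw i)).2⟩⟩, rfl⟩

/-- Every point is equivalent to a point of the fundamental region: a point of maximal height in its
orbit, moved over the cube `[0, 1/2]³` by an affine map, lies outside the unit ball. -/
theorem exists_mem_region (x : HalfSpace) : ∃ g ∈ extendedGroup false, g x ∈ region := by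
  have hfin : {n : Cusp | n.IsIsotropic ∧ (∃ g ∈ extendedGroup false, HasCusp g n) ∧
      n.pair x ≤ 1}.Finite :=
    (finite_cusps 1 (ht x) (nsq x) (ht_pos x)).subset
      fun n hn => ⟨hn.1, x, le_rfl, le_rfl, hn.2.2⟩
  obtain ⟨n, ⟨-, ⟨g, hg, hgn⟩, -⟩, hmin⟩ := Set.exists_min_image _ (fun n : Cusp => n.pair x) hfin
    ⟨Cusp.infty, Cusp.isIsotropic_infty, ⟨1, one_mem _, hasCusp_one⟩, by simp⟩
  have hmax (g' : Equiv.Perm HalfSpace) (hg' : g' ∈ extendedGroup false) :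
      ht (g' x) ≤ ht (g x) := by
    have key (n' : Cusp) (hn' : n'.IsIsotropic) (h' : HasCusp g' n') : n.pair x ≤ n'.pair x := by
      by_cases h1 : n'.pair x ≤ 1
      · exact hmin n' ⟨hn', ⟨g', hg', h'⟩, h1⟩
      · refine le_trans ?_ (not_le.1 h1).le
        have := hmin Cusp.infty ⟨Cusp.isIsotropic_infty, ⟨1, one_mem _, hasCusp_one⟩, by simp⟩
        simpa using this
    obtain ⟨n', hn', h'⟩ := exists_hasCusp hg'
    have h1 := key n' hn' h'
    have h2 := (hgn x).symm.trans (h' x)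
    have h3 := ht_pos (g' x)
    have h4 : 0 < n.pair x := by
      have := hgn x
      have h5 := ht_pos x
      rw [this] at h5
      exact (mul_pos_iff_of_pos_left (ht_pos _)).1 h5
    refine le_of_mul_le_mul_right ?_ h4
    rw [h2]
    exact mul_le_mul_of_nonneg_left h1 h3.le
  have hex (y : ℝ) : ∃ (s : ℤˣ) (m : ℤ), 0 ≤ (s : ℤ) * y + m ∧ (s : ℤ) * y + m ≤ 1 / 2 := by
    have h1 := abs_sub_round y
    rcases le_total 0 (y - round y) with h2 | h2
    · rw [abs_of_nonneg h2] at h1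
      exact ⟨1, -round y, by push_cast; linarith, by push_cast; linarith⟩
    · rw [abs_of_nonpos h2] at h1
      exact ⟨-1, round y, by push_cast; linarith, by push_cast; linarith⟩
  choose s m hsm using fun i => hex (co (g x) i)
  refine ⟨aff s m * g, mul_mem (aff_mem _ _ _) hg, ?_, fun i => by simpa using hsm i⟩
  by_contra hlt
  rw [not_le] at hlt
  have h1 := hmax (sphereReflection * (aff s m * g))
    (mul_mem (sphereReflection_mem _) (mul_mem (aff_mem _ _ _) hg))
  rw [Equiv.Perm.mul_apply, ht_sphereReflection] at h1
  have h2 : ht ((aff s m * g) x) = ht (g x) := by simp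
  rw [h2, div_le_iff₀ (nsq_pos _)] at h1
  nlinarith [ht_pos (g x)]

/-- The integral inequality that makes the fundamental region strict. -/
lemma Cusp.IsIsotropic.one_add_sum_abs_le {n : Cusp} (hn : n.IsIsotropic) :
    1 + ∑ i, |n.w i| ≤ n.u + n.v := by
  have h1 := hn.mul_eq
  have h2 := hn.pos
  simp only [Fin.sum_univ_three] at h1 ⊢
  rw [← sq_abs (n.w 0), ← sq_abs (n.w 1), ← sq_abs (n.w 2)] at h1
  have a0 := abs_nonneg (n.w 0)
  have a1 := abs_nonneg (n.w 1)
  have a2 := abs_nonneg (n.w 2)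
  generalize |n.w 0| = x at *
  generalize |n.w 1| = y at *
  generalize |n.w 2| = z at *
  by_contra hlt
  have h3 : n.u + n.v ≤ x + y + z := by omega
  have h4 : (n.u + n.v) ^ 2 ≤ (x + y + z) ^ 2 := by gcongr
  nlinarith [sq_nonneg (n.u - n.v), sq_nonneg (x - y), sq_nonneg (y - z), sq_nonneg (x - z)]

lemma two_mul_le_abs {q : HalfSpace} (hq : q ∈ region) (a : ℤ) (i : Fin 3) :
    0 ≤ ((|a| : ℤ) : ℝ) - 2 * (a * co q i) := by
  have h1 := hq.2 i
  have h2 : (a : ℝ) ≤ ((|a| : ℤ) : ℝ) := by exact_mod_cast le_abs_self a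
  have h3 : (0 : ℝ) ≤ ((|a| : ℤ) : ℝ) := by exact_mod_cast abs_nonneg a
  nlinarith

lemma pair_sub_one (n : Cusp) (q : HalfSpace) : n.pair q - 1 = n.u * (nsq q - 1) +
    ((n.u + n.v - (1 + ∑ i, |n.w i|) : ℤ) : ℝ) +
      ∑ i, (((|n.w i| : ℤ) : ℝ) - 2 * (n.w i * co q i)) := by
  simp only [Cusp.pair, Fin.sum_univ_three]
  push_cast
  ring

/-- The points of the fundamental region have maximal height in their orbits. -/
lemma one_le_pair {n : Cusp} (hn : n.IsIsotropic) {q : HalfSpace} (hq : q ∈ region) :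
    1 ≤ n.pair q := by
  have h1 : (0 : ℝ) ≤ n.u := by exact_mod_cast hn.u_nonneg
  have h2 : (0 : ℝ) ≤ ((n.u + n.v - (1 + ∑ i, |n.w i|) : ℤ) : ℝ) := by
    exact_mod_cast sub_nonneg.2 hn.one_add_sum_abs_le
  have h3 : 0 ≤ ∑ i, (((|n.w i| : ℤ) : ℝ) - 2 * (n.w i * co q i)) :=
    Finset.sum_nonneg fun i _ => two_mul_le_abs hq _ i
  have h4 := mul_nonneg h1 (sub_nonneg.2 hq.1)
  linarith [pair_sub_one n q]

/-- The cusps that are as close as `∞` to a point of the fundamental region. -/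
lemma pair_eq_one_iff {n : Cusp} (hn : n.IsIsotropic) {q : HalfSpace} (hq : q ∈ region) :
    n.pair q = 1 ↔ (n.u ≠ 0 → nsq q = 1) ∧ n.u + n.v = 1 + ∑ i, n.w i ∧
      ∀ i, 0 ≤ n.w i ∧ (n.w i ≠ 0 → co q i = 1 / 2) := by
  have h1 : (0 : ℝ) ≤ n.u := by exact_mod_cast hn.u_nonneg
  have h2 : (0 : ℝ) ≤ ((n.u + n.v - (1 + ∑ i, |n.w i|) : ℤ) : ℝ) := by
    exact_mod_cast sub_nonneg.2 hn.one_add_sum_abs_le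
  have h3 (i : Fin 3) := two_mul_le_abs hq (n.w i) i
  have h3' : 0 ≤ ∑ i, (((|n.w i| : ℤ) : ℝ) - 2 * (n.w i * co q i)) :=
    Finset.sum_nonneg fun i _ => h3 i
  have h4 := mul_nonneg h1 (sub_nonneg.2 hq.1)
  have h5 := pair_sub_one n q
  constructor
  · intro h
    have e1 : n.u * (nsq q - 1) = 0 := by linarith
    have e2 : ((n.u + n.v - (1 + ∑ i, |n.w i|) : ℤ) : ℝ) = 0 := by linarith
    have e3 : ∑ i, (((|n.w i| : ℤ) : ℝ) - 2 * (n.w i * co q i)) = 0 := by linarith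
    have e4 (i : Fin 3) := (Finset.sum_eq_zero_iff_of_nonneg fun i _ => h3 i).1 e3 i
      (Finset.mem_univ i)
    have e5 (i : Fin 3) : 0 ≤ n.w i := by
      by_contra hneg
      rw [not_le] at hneg
      have e6 := e4 i
      rw [abs_of_neg hneg] at e6
      have e7 : (n.w i : ℝ) < 0 := by exact_mod_cast hneg
      have := (hq.2 i).1
      push_cast at e6
      nlinarith
    refine ⟨fun hu => ?_, ?_, fun i => ⟨e5 i, fun hw => ?_⟩⟩
    · have : (n.u : ℝ) ≠ 0 := by exact_mod_cast hu
      have := (mul_eq_zero.1 e1).resolve_left this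
      linarith
    · have : n.u + n.v - (1 + ∑ i, |n.w i|) = 0 := by exact_mod_cast e2
      simp only [abs_of_nonneg (e5 _)] at this
      omega
    · have e6 := e4 i
      rw [abs_of_nonneg (e5 i)] at e6
      have : (n.w i : ℝ) ≠ 0 := by exact_mod_cast hw
      have e7 : (n.w i : ℝ) * (1 - 2 * co q i) = 0 := by linarith
      have := (mul_eq_zero.1 e7).resolve_left this
      linarith
  · rintro ⟨e1, e2, e3⟩
    have e4 : n.u * (nsq q - 1) = 0 := by
      by_cases hu : n.u = 0
      · simp [hu]
      · simp [e1 hu]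
    have e5 : n.u + n.v - (1 + ∑ i, |n.w i|) = 0 := by
      simp only [abs_of_nonneg (e3 _).1]
      omega
    rw [e4, e5, Finset.sum_eq_zero] at h5
    · push_cast at h5
      linarith
    · intro i _
      rw [abs_of_nonneg (e3 i).1]
      by_cases hw : n.w i = 0
      · simp [hw]
      · rw [(e3 i).2 hw]; ring

/-- The point `q'` lies in every wall of the fundamental region that contains `q`. -/
def Specializes (q q' : HalfSpace) : Prop :=
  (nsq q = 1 → nsq q' = 1) ∧ ∀ i, (co q i = 0 → co q' i = 0) ∧ (co q i = 1 / 2 → co q' i = 1 / 2)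

/-- The affine case of the strictness of the fundamental region. -/
lemma aff_rot_eq_of_mem_region {k : Fin 3} {s : Fin 3 → ℤˣ} {m : Fin 3 → ℤ} {q q' : HalfSpace}
    (hq : q ∈ region) (hxq : (aff s m * rot k) q ∈ region) (hq' : Specializes q q') :
    (aff s m * rot k) q' = rot k q' := by
  refine halfSpace_ext (by simp) fun i => ?_
  have h1 := hq.2 (i + k)
  have h2 := hxq.2 i
  simp only [Equiv.Perm.mul_apply, co_aff, co_rot] at h2 ⊢
  rcases Int.units_eq_one_or (s i) with hs | hs
  · rw [hs] at h2 ⊢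
    simp only [Units.val_one, Int.cast_one, one_mul] at h2 ⊢
    have h3 : -1 < m i := by
      have : (-1 : ℝ) < m i := by linarith
      exact_mod_cast this
    have h4 : m i < 1 := by
      have : (m i : ℝ) < 1 := by linarith
      exact_mod_cast this
    have : m i = 0 := by omega
    simp [this]
  · rw [hs] at h2 ⊢
    simp only [Units.val_neg, Units.val_one, Int.cast_neg, Int.cast_one, neg_mul, one_mul] at h2 ⊢
    have h3 : 0 ≤ m i := by
      have : (0 : ℝ) ≤ m i := by linarith
      exact_mod_cast this
    have h4 : m i ≤ 1 := by
      have : (m i : ℝ) ≤ 1 := by linarith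
      exact_mod_cast this
    obtain h5 | h5 : m i = 0 ∨ m i = 1 := by omega
    · rw [h5] at h2 ⊢
      have : co q' (i + k) = 0 := (hq'.2 (i + k)).1 (by push_cast at h2; linarith)
      simp [this]
    · rw [h5] at h2 ⊢
      have : co q' (i + k) = 1 / 2 := (hq'.2 (i + k)).2 (by push_cast at h2; linarith)
      rw [this]
      norm_num

lemma Cusp.IsIsotropic.eq_infty {n : Cusp} (hn : n.IsIsotropic) (hu : n.u = 0) {q : HalfSpace}
    (hq : n.pair q = 1) : n = Cusp.infty := by
  have hw := hn.eq_zero hu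
  refine Cusp.ext hu ?_ hw
  simp only [Cusp.pair, hu, hw] at hq
  have : (n.v : ℝ) = 1 := by simpa using hq
  exact_mod_cast this

/-- The group generated by the reflections in the walls through a point `q` of the fundamental
region acts transitively on the cusps that are closest to `q`. A reflection in the sphere, or in a
wall `ω_i = 1/2`, brings a cusp closer to `∞` as long as it is not `∞`. -/
theorem exists_hasCusp_fixing {n : Cusp} (hn : n.IsIsotropic) {q : HalfSpace} (hq : q ∈ region)
    (hpair : n.pair q = 1) :
    ∃ e ∈ extendedGroup false, HasCusp e n ∧ ∀ q', Specializes q q' → e q' = q' := by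
  induction hN : (3 * n.u + 2 * n.v).toNat using Nat.strong_induction_on generalizing n with
  | _ N ih =>
  obtain ⟨e1, e2, e3⟩ := (pair_eq_one_iff hn hq).1 hpair
  have hu := hn.u_nonneg
  have hv := hn.v_nonneg
  by_cases hu0 : n.u = 0
  · rw [hn.eq_infty hu0 hpair]
    exact ⟨1, one_mem _, hasCusp_one, fun _ _ => rfl⟩
  by_cases hvu : n.v < n.u
  · have hn' : (⟨n.v, n.u, n.w⟩ : Cusp).IsIsotropic :=
      ⟨hv, hu, by rw [add_comm]; exact hn.pos, by rw [mul_comm]; exact hn.mul_eq⟩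
    obtain ⟨e, he, hen, heq⟩ := ih _ (by simp only; omega) hn'
      ((pair_eq_one_iff hn' hq).2 ⟨fun _ => e1 hu0, by rw [add_comm]; exact e2, e3⟩) rfl
    refine ⟨e * sphereReflection, mul_mem he (sphereReflection_mem _), hen.mul_sphereReflection,
      fun q' hq' => ?_⟩
    rw [Equiv.Perm.mul_apply, sphereReflection_apply (hq'.1 (e1 hu0)), heq q' hq']
  have h1 := hn.mul_eq
  have hpos : 0 < n.u := by omega
  by_cases hwu : ∃ i, n.u < 2 * n.w i
  · obtain ⟨i, hi⟩ := hwu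
    have hi2 := (e3 i).2 (by omega)
    set n' : Cusp := ⟨n.u, n.v + n.u - 2 * n.w i, Function.update n.w i (n.u - n.w i)⟩ with hn'_def
    have hmul : n'.u * n'.v = ∑ j, n'.w j ^ 2 := by
      simp only [hn'_def, Fin.sum_univ_three] at h1 ⊢
      fin_cases i <;> simp <;> linear_combination h1
    have hv' : 0 ≤ n'.v := by
      have : 0 ≤ n'.u * n'.v := hmul ▸ Finset.sum_nonneg fun j _ => sq_nonneg _
      exact nonneg_of_mul_nonneg_right this hpos
    have hpair' : n'.pair q = 1 := by
      rw [← hpair]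
      simp only [hn'_def, Cusp.pair, Fin.sum_univ_three]
      fin_cases i <;> simp at hi2 ⊢ <;> rw [hi2] <;> ring
    have hn' : n'.IsIsotropic := ⟨hu, hv', add_pos_of_pos_of_nonneg hpos hv', hmul⟩
    obtain ⟨e, he, hen, heq⟩ := ih _ (by simp only [hn'_def] at hv' ⊢; omega) hn' hpair' rfl
    refine ⟨e * wallReflection i, mul_mem he (wallReflection_mem i _), ?_, fun q' hq' => ?_⟩
    · have h2 := hen.mul_aff (Function.update 1 i (-1)) (Pi.single i 1)
      rw [wallReflection]
      convert h2 using 1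
      refine Cusp.ext rfl ?_ (funext fun j => ?_)
      · simp [hn'_def, Pi.single_apply, ite_pow]
        ring
      · rcases eq_or_ne j i with rfl | hj
        · simp [hn'_def]
        · simp [hn'_def, hj]
    · rw [Equiv.Perm.mul_apply, wallReflection_apply ((hq'.2 i).2 hi2), heq q' hq']
  -- A cusp that no reflection brings closer to `∞` would satisfy `4 u v ≤ 3 u²` with `u ≤ v`.
  exfalso
  push Not at hwu hvu
  rw [Fin.sum_univ_three] at h1
  have h2 (i : Fin 3) : 4 * n.w i ^ 2 ≤ n.u ^ 2 := by
    have := hwu i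
    have := (e3 i).1
    nlinarith
  nlinarith [h2 0, h2 1, h2 2]

lemma pair_eq_one_of_mem_region {h : Bool} {x : Equiv.Perm HalfSpace} (hx : x ∈ extendedGroup h)
    {q : HalfSpace} (hq : q ∈ region) (hxq : x q ∈ region) {n : Cusp} (hn : n.IsIsotropic)
    (hxn : HasCusp x n) : n.pair q = 1 := by
  refine le_antisymm ?_ (one_le_pair hn hq)
  obtain ⟨n', hn', hxn'⟩ := exists_hasCusp (inv_mem hx)
  have h1 := hxn' (x q)
  rw [← Equiv.Perm.mul_apply, inv_mul_cancel, Equiv.Perm.one_apply] at h1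
  have h2 := one_le_pair hn' hxq
  have h3 := hxn q
  have h4 := ht_pos (x q)
  have h5 := ht_pos q
  refine le_of_mul_le_mul_left ?_ h4
  rw [← h3, mul_one, h1]
  nlinarith

lemma HasCusp.pair_pos {x : Equiv.Perm HalfSpace} {n : Cusp} (hx : HasCusp x n) (q : HalfSpace) :
    0 < n.pair q := by
  have h := ht_pos q
  rw [hx q] at h
  exact (mul_pos_iff_of_pos_left (ht_pos _)).1 h

lemma HasCusp.mul_inv {x e : Equiv.Perm HalfSpace} {n : Cusp} (hx : HasCusp x n)
    (he : HasCusp e n) : HasCusp (x * e⁻¹) Cusp.infty := fun q => by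
  rw [Cusp.pair_infty, mul_one]
  have h1 := he (e⁻¹ q)
  rw [← Equiv.Perm.mul_apply, mul_inv_cancel, Equiv.Perm.one_apply] at h1
  exact mul_right_cancel₀ (hx.pair_pos _).ne' (h1.symm.trans (hx (e⁻¹ q)))

/-- **Strictness of the fundamental region.** An element of the extended group that maps a point `q`
of the region to a point of the region acts at `q`, and at all points in the same walls, as a
cyclic permutation of the coordinates. -/
theorem eq_rot_of_mem_region {h : Bool} {x : Equiv.Perm HalfSpace} (hx : x ∈ extendedGroup h)
    {q : HalfSpace} (hq : q ∈ region) (hxq : x q ∈ region) :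
    ∃ k : Fin 3, (h = false → k = 0) ∧ ∀ q', Specializes q q' → x q' = rot k q' := by
  obtain ⟨n, hn, hxn⟩ := exists_hasCusp hx
  obtain ⟨e, he, hen, heq⟩ :=
    exists_hasCusp_fixing hn hq (pair_eq_one_of_mem_region hx hq hxq hn hxn)
  obtain ⟨k, s, m, hk, hxe⟩ := affine_of_mem (mul_mem hx (inv_mem (extendedGroup_false_le h he)))
    (hxn.mul_inv hen)
  have hinv (q' : HalfSpace) (hq' : Specializes q q') : (aff s m * rot k) q' = x q' := by
    rw [← hxe, Equiv.Perm.mul_apply, Equiv.Perm.inv_eq_iff_eq.2 (heq q' hq').symm]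
  refine ⟨k, hk, fun q' hq' => ?_⟩
  rw [← hinv q' hq']
  refine aff_rot_eq_of_mem_region hq ?_ hq'
  rwa [hinv q ⟨id, fun i => ⟨id, id⟩⟩]

/-! ### Orbits of points of the fundamental region -/

lemma orbitMk_eq_iff {h : Bool} {x y : HalfSpace} :
    orbitMk (modularGroup h) x = orbitMk (modularGroup h) y ↔ ∃ g ∈ modularGroup h, g y = x := by
  unfold orbitMk
  rw [Quotient.eq, MulAction.orbitRel_apply]
  constructor
  · rintro ⟨g, hg⟩
    exact ⟨g.1, g.2, hg⟩
  · rintro ⟨g, hg, rfl⟩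
    exact ⟨⟨g, hg⟩, rfl⟩

/-- The map `conjugation` for `true`, and the identity for `false`. It selects one of the two copies
of the fundamental region. -/
def flip (ε : Bool) : Equiv.Perm HalfSpace := bif ε then conjugation else 1

lemma flip_mem (ε h : Bool) : flip ε ∈ extendedGroup h := by
  cases ε
  · exact one_mem _
  · exact conjugation_mem_extendedGroup h

lemma flip_flip (ε : Bool) (q : HalfSpace) : flip ε (flip ε q) = q := by
  cases ε
  · rfl
  · exact conjugation_conjugation q

lemma flip_rot (ε : Bool) (k : Fin 3) (q : HalfSpace) : flip ε (rot k q) = rot k (flip ε q) := by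
  cases ε
  · rfl
  · exact halfSpace_ext (by simp [flip]) (by simp [flip])

/-- The point lies in a wall of the fundamental region. -/
def OnWall (q : HalfSpace) : Prop := nsq q = 1 ∨ ∃ i, co q i = 0 ∨ co q i = 1 / 2

lemma specializes_of_not_onWall {q : HalfSpace} (hq : ¬OnWall q) (q' : HalfSpace) :
    Specializes q q' :=
  ⟨fun h => absurd (Or.inl h) hq, fun i => ⟨fun h => absurd (Or.inr ⟨i, Or.inl h⟩) hq,
    fun h => absurd (Or.inr ⟨i, Or.inr h⟩) hq⟩⟩

lemma specializes_refl (q : HalfSpace) : Specializes q q := ⟨id, fun _ => ⟨id, id⟩⟩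

lemma aff_mem_modularGroup {s : Fin 3 → ℤˣ} (hs : s 0 * s 1 * s 2 = 1) (m : Fin 3 → ℤ)
    (h : Bool) : aff s m ∈ modularGroup h := by
  refine modularGroup_false_le h ?_
  have e1 : aff s m = aff 1 m * aff s 0 := by
    ext1 q
    exact halfSpace_ext (by simp) (by simp)
  rw [e1]
  exact mul_mem (aff_one_mem m) (aff_sign_mem hs)

/-- A point in a wall is fixed by a reflection, which reverses the orientation. -/
lemma exists_reflection {q : HalfSpace} (hq : OnWall q) (h : Bool) :
    ∃ r, r q = q ∧ conjugation * r ∈ modularGroup h := by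
  have hwall (i : Fin 3) (m : Fin 3 → ℤ) :
      conjugation * aff (Function.update 1 i (-1)) m ∈ modularGroup h := by
    have : conjugation * aff (Function.update 1 i (-1)) m =
        aff (-Function.update (1 : Fin 3 → ℤˣ) i (-1)) (-m) := by
      ext1 q
      refine halfSpace_ext (by simp) fun j => ?_
      simp only [Equiv.Perm.mul_apply, co_conjugation, co_aff, Pi.neg_apply, Units.val_neg,
        Int.cast_neg]
      ring
    rw [this]
    have hsign : ∀ i : Fin 3, (-Function.update (1 : Fin 3 → ℤˣ) i (-1)) 0 *
        (-Function.update (1 : Fin 3 → ℤˣ) i (-1)) 1 *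
        (-Function.update (1 : Fin 3 → ℤˣ) i (-1)) 2 = 1 := by decide
    exact aff_mem_modularGroup (hsign i) _ h
  rcases hq with hq | ⟨i, hq | hq⟩
  · refine ⟨sphereReflection, sphereReflection_apply hq, ?_⟩
    rw [sphereReflection, ← mul_assoc, conjugation_mul_self, one_mul]
    exact inversion_mem h
  · refine ⟨aff (Function.update 1 i (-1)) 0, halfSpace_ext (by simp) fun j => ?_, hwall i 0⟩
    rcases eq_or_ne j i with rfl | hj
    · simp [hq]
    · simp [hj]
  · exact ⟨wallReflection i, wallReflection_apply hq, hwall i _⟩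

lemma orbitMk_flip_of_onWall {q : HalfSpace} (hq : OnWall q) (h ε : Bool) :
    orbitMk (modularGroup h) (flip ε q) = orbitMk (modularGroup h) q := by
  cases ε
  · rfl
  · obtain ⟨r, hr, hmem⟩ := exists_reflection hq h
    exact orbitMk_eq_iff.2 ⟨_, hmem, by rw [Equiv.Perm.mul_apply, hr]; rfl⟩

/-- The identifications between points of the two copies of the fundamental region. -/
theorem orbitMk_flip_eq_iff {h ε ε' : Bool} {q q' : HalfSpace} (hq : q ∈ region)
    (hq' : q' ∈ region) :
    orbitMk (modularGroup h) (flip ε q) = orbitMk (modularGroup h) (flip ε' q') ↔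
      (∃ k : Fin 3, (h = false → k = 0) ∧ q = rot k q') ∧ (ε = ε' ∨ OnWall q') := by
  constructor
  · intro heq
    obtain ⟨g, hg, hgq⟩ := orbitMk_eq_iff.1 heq
    have hx : flip ε * g * flip ε' ∈ extendedGroup h :=
      mul_mem (mul_mem (flip_mem _ _) (Or.inl hg)) (flip_mem _ _)
    have hxq : (flip ε * g * flip ε') q' = q := by
      rw [Equiv.Perm.mul_apply, Equiv.Perm.mul_apply, hgq, flip_flip]
    obtain ⟨k, hk, hrot⟩ := eq_rot_of_mem_region hx hq' (by rw [hxq]; exact hq)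
    refine ⟨⟨k, hk, by rw [← hrot q' (specializes_refl q'), hxq]⟩, ?_⟩
    by_contra hcon
    rw [not_or] at hcon
    have hx_mem : flip ε * g * flip ε' ∈ modularGroup h := by
      have : flip ε * g * flip ε' = rot k := by
        ext1 p
        exact hrot p (specializes_of_not_onWall hcon.2 p)
      rw [this]
      exact rot_mem hk
    refine conjugation_notMem h ?_
    cases ε <;> cases ε'
    · exact absurd rfl hcon.1
    · exact (Subgroup.mul_mem_cancel_left _ hg).1 hx_mem
    · exact (Subgroup.mul_mem_cancel_right _ hg).1 hx_mem
    · exact absurd rfl hcon.1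
  · rintro ⟨⟨k, hk, rfl⟩, hε⟩
    have hrot (ε : Bool) : orbitMk (modularGroup h) (flip ε (rot k q')) =
        orbitMk (modularGroup h) (flip ε q') :=
      orbitMk_eq_iff.2 ⟨rot k, rot_mem hk, (flip_rot ε k q').symm⟩
    rw [hrot]
    rcases hε with rfl | hw
    · rfl
    · rw [orbitMk_flip_of_onWall hw, orbitMk_flip_of_onWall hw]

/-- Every orbit meets one of the two copies of the fundamental region. -/
lemma exists_orbitMk_flip (h : Bool) (x : HalfSpace) : ∃ (ε : Bool), ∃ q ∈ region,
    orbitMk (modularGroup h) (flip ε q) = orbitMk (modularGroup h) x := by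
  obtain ⟨g, hg, hgx⟩ := exists_mem_region x
  rcases hg with hg | hg
  · exact ⟨false, g x, hgx, orbitMk_eq_iff.2 ⟨g, modularGroup_false_le h hg, rfl⟩⟩
  · refine ⟨true, g x, hgx, orbitMk_eq_iff.2
      ⟨conjugation * g, modularGroup_false_le h ?_, rfl⟩⟩
    have := conj_mem_modularGroup hg
    rwa [mul_assoc, mul_assoc, conjugation_mul_self, mul_one] at this

/-! ### Orders of isotropy groups -/

/-- The three horizontal coordinates agree: the point is fixed by the cyclic permutations. -/
def IsDiag (q : HalfSpace) : Prop := ∀ i, co q i = co q 0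

lemma isDiag_of_rot_eq {k : Fin 3} (hk : k ≠ 0) {q : HalfSpace} (h : rot k q = q) : IsDiag q := by
  have h1 (i : Fin 3) : co q (i + k) = co q i := by
    rw [← co_rot, h]
  have h2 := h1 0
  have h3 := h1 k
  rw [zero_add] at h2
  intro i
  have h4 : ∀ i k : Fin 3, k ≠ 0 → i = 0 ∨ i = k ∨ i = k + k := by decide
  rcases h4 i k hk with rfl | rfl | rfl
  exacts [rfl, h2, h3.trans h2]

lemma rot_eq_of_isDiag {q : HalfSpace} (h : IsDiag q) (k : Fin 3) : rot k q = q :=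
  halfSpace_ext rfl fun i => by rw [co_rot, h, ← h i]

/-- The isotropy group of the point in one of the copies of the fundamental region depends only on
the walls through the point and, for the Hurwitz group, on whether the point is diagonal. -/
lemma stabilizer_flip_le {h ε : Bool} {q q' : HalfSpace} (hq : q ∈ region)
    (hs : Specializes q q') (hd : h = true → IsDiag q → IsDiag q') :
    MulAction.stabilizer (modularGroup h) (flip ε q) ≤
      MulAction.stabilizer (modularGroup h) (flip ε q') := by
  intro g hg
  have hg' : g.1 (flip ε q) = flip ε q := hg
  have hx : flip ε * g.1 * flip ε ∈ extendedGroup h :=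
    mul_mem (mul_mem (flip_mem _ _) (Or.inl g.2)) (flip_mem _ _)
  have hxq : (flip ε * g.1 * flip ε) q = q := by
    rw [Equiv.Perm.mul_apply, Equiv.Perm.mul_apply, hg', flip_flip]
  obtain ⟨k, hk, hrot⟩ := eq_rot_of_mem_region hx hq (by rw [hxq]; exact hq)
  have h1 : rot k q = q := by rw [← hrot q (specializes_refl q), hxq]
  have h2 : rot k q' = q' := by
    by_cases hk0 : k = 0
    · rw [hk0]
      exact halfSpace_ext rfl (by simp)
    · refine rot_eq_of_isDiag (hd ?_ (isDiag_of_rot_eq hk0 h1)) k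
      by_contra hh
      exact hk0 (hk (by simpa using hh))
  have h3 := hrot q' hs
  rw [h2, Equiv.Perm.mul_apply, Equiv.Perm.mul_apply] at h3
  have h4 := congrArg (flip ε) h3
  rw [flip_flip] at h4
  exact h4

/-- The number of transformations in `G` that fix the point `q`. -/
def fixCard (G : Subgroup (Equiv.Perm HalfSpace)) (q : HalfSpace) : ℕ :=
  Nat.card {g : Equiv.Perm HalfSpace // g ∈ G ∧ g q = q}

lemma card_stabilizer (h ε : Bool) (q : HalfSpace) :
    Nat.card (MulAction.stabilizer (modularGroup h) (flip ε q)) = fixCard (modularGroup h) q := by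
  have h1 : Nat.card (MulAction.stabilizer (modularGroup h) (flip ε q)) =
      fixCard (modularGroup h) (flip ε q) :=
    Nat.card_congr (Equiv.subtypeSubtypeEquivSubtypeInter (fun g => g ∈ modularGroup h)
      fun g => g (flip ε q) = flip ε q)
  rw [h1]
  cases ε
  · rfl
  · have key (g : Equiv.Perm HalfSpace) (q : HalfSpace)
        (hg : g ∈ modularGroup h ∧ g (conjugation q) = conjugation q) :
        conjugation * g * conjugation ∈ modularGroup h ∧
          (conjugation * g * conjugation) q = q := by
      refine ⟨conj_mem_modularGroup hg.1, ?_⟩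
      rw [Equiv.Perm.mul_apply, Equiv.Perm.mul_apply, hg.2, conjugation_conjugation]
    have inv (g : Equiv.Perm HalfSpace) :
        conjugation * (conjugation * g * conjugation) * conjugation = g := by
      ext1 p
      simp only [Equiv.Perm.mul_apply, conjugation_conjugation]
    exact Nat.card_congr
      { toFun := fun g => ⟨_, key g.1 q g.2⟩
        invFun := fun g => ⟨conjugation * g.1 * conjugation, key g.1 (conjugation q)
          ⟨g.2.1, by rw [conjugation_conjugation]; exact g.2.2⟩⟩
        left_inv := fun g => Subtype.ext (inv g.1)
        right_inv := fun g => Subtype.ext (inv g.1) }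

/-- At a point in a wall, the orientation preserving isotropy group has index two in the full
isotropy group. -/
lemma fixCard_of_onWall {h : Bool} {q : HalfSpace} (hq : OnWall q) :
    fixCard (extendedGroup h) q = 2 * fixCard (modularGroup h) q := by
  obtain ⟨r, hr, hmem⟩ := exists_reflection hq h
  have hmem' : r * conjugation ∈ modularGroup h := by
    have := conj_mem_modularGroup hmem
    rwa [← mul_assoc, conjugation_mul_self, one_mul] at this
  have hr_ext : r ∈ extendedGroup h := Or.inr hmem'
  have hr_not : r ∉ modularGroup h := fun hr_mem =>
    conjugation_notMem h ((Subgroup.mul_mem_cancel_right _ hr_mem).1 hmem)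
  have hrinv : r⁻¹ q = q := Equiv.Perm.inv_eq_iff_eq.2 hr.symm
  let f : {g : Equiv.Perm HalfSpace // g ∈ modularGroup h ∧ g q = q} ⊕
      {g : Equiv.Perm HalfSpace // g ∈ modularGroup h ∧ g q = q} →
      {g : Equiv.Perm HalfSpace // g ∈ extendedGroup h ∧ g q = q} :=
    Sum.elim (fun g => ⟨g.1, Or.inl g.2.1, g.2.2⟩)
      (fun g => ⟨g.1 * r, mul_mem (Or.inl g.2.1) hr_ext, by
        rw [Equiv.Perm.mul_apply, hr, g.2.2]⟩)
  have hf : Function.Bijective f := by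
    constructor
    · have key (a b : {g : Equiv.Perm HalfSpace // g ∈ modularGroup h ∧ g q = q}) :
          a.1 ≠ b.1 * r := fun hab =>
        hr_not ((Subgroup.mul_mem_cancel_left _ b.2.1).1 (hab ▸ a.2.1))
      rintro (a | a) (b | b) hab
      all_goals have hv := congrArg (fun x => x.1) hab
      · rw [Subtype.ext (show a.1 = b.1 from hv)]
      · exact absurd hv (key a b)
      · exact absurd hv.symm (key b a)
      · rw [Subtype.ext (mul_right_cancel (show a.1 * r = b.1 * r from hv))]
    · rintro ⟨x, hx | hx, hxq⟩
      · exact ⟨Sum.inl ⟨x, hx, hxq⟩, rfl⟩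
      · refine ⟨Sum.inr ⟨x * r⁻¹, ?_, by rw [Equiv.Perm.mul_apply, hrinv, hxq]⟩,
          Subtype.ext (inv_mul_cancel_right x r)⟩
        have : x * r⁻¹ = x * conjugation * (r * conjugation)⁻¹ := by
          rw [mul_inv_rev, conjugation_inv, mul_assoc, ← mul_assoc conjugation,
            conjugation_mul_self, one_mul]
        rw [this]
        exact mul_mem hx (inv_mem hmem')
  have hcard := Nat.card_congr (Equiv.ofBijective f hf)
  by_cases hfin : Finite {g : Equiv.Perm HalfSpace // g ∈ modularGroup h ∧ g q = q}
  · rw [Nat.card_sum] at hcard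
    rw [fixCard, ← hcard, fixCard]
    ring
  · rw [not_finite_iff_infinite] at hfin
    rw [Nat.card_eq_zero_of_infinite] at hcard
    rw [fixCard, ← hcard, fixCard, Nat.card_eq_zero_of_infinite]

lemma fixCard_of_not_onWall {h : Bool} {q : HalfSpace} (hq : q ∈ region) (hw : ¬OnWall q) :
    fixCard (extendedGroup h) q = fixCard (modularGroup h) q := by
  refine Nat.card_congr (Equiv.subtypeEquivRight fun x => ?_)
  refine and_congr_left fun hxq => ⟨fun hx => ?_, Or.inl⟩
  obtain ⟨k, hk, hrot⟩ := eq_rot_of_mem_region hx hq (by rw [hxq]; exact hq)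
  have : x = rot k := by
    ext1 p
    exact hrot p (specializes_of_not_onWall hw p)
  rw [this]
  exact rot_mem hk

/-- The translation part of the affine map with the signs `s` that fixes `q`, if there is one. -/
def wallShift (s : Fin 3 → ℤˣ) (q : HalfSpace) (i : Fin 3) : ℤ :=
  open Classical in if s i = -1 ∧ co q i = 1 / 2 then 1 else 0

/-- The permutation and the signs of an affine map are determined by the map. -/
lemma aff_mul_rot_injective {k k' : Fin 3} {s s' : Fin 3 → ℤˣ} {m m' : Fin 3 → ℤ}
    (h : aff s m * rot k = aff s' m' * rot k') : k = k' ∧ s = s' := by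
  have key (ω : Fin 3 → ℝ) (i : Fin 3) : ((s i : ℤ) : ℝ) * ω (i + k) + m i =
      ((s' i : ℤ) : ℝ) * ω (i + k') + m' i := by
    have := congrArg (fun g : Equiv.Perm HalfSpace => co (g (pt 1 one_pos ω)) i) h
    simpa using this
  have hm (i : Fin 3) : (m i : ℝ) = m' i := by simpa using key 0 i
  have hk : k = k' := by
    by_contra hne
    have h1 := key (Pi.single k 1) 0
    rw [hm, zero_add, zero_add, Pi.single_eq_same, Pi.single_eq_of_ne (Ne.symm hne)] at h1
    simp at h1
  refine ⟨hk, funext fun i => Units.ext ?_⟩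
  have h1 := key 1 i
  rw [hm] at h1
  simp only [Pi.one_apply, mul_one, add_left_inj] at h1
  exact_mod_cast h1

/-- The full isotropy group of a point `q` of the fundamental region is in bijection with the
triples of a cusp closest to `q`, an admissible cyclic permutation that fixes `q`, and signs for
the coordinates that equal `0` or `1/2`. -/
lemma fixCard_extendedGroup {h : Bool} {q : HalfSpace} (hq : q ∈ region) :
    fixCard (extendedGroup h) q =
      Nat.card {n : Cusp // n.IsIsotropic ∧ n.pair q = 1} *
        (Nat.card {k : Fin 3 // (h = false → k = 0) ∧ rot k q = q} *
        Nat.card {s : Fin 3 → ℤˣ // ∀ i, s i ≠ 1 → co q i = 0 ∨ co q i = 1 / 2}) := by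
  choose e he hen heq using fun n : {n : Cusp // n.IsIsotropic ∧ n.pair q = 1} =>
    exists_hasCusp_fixing n.2.1 hq n.2.2
  rw [← Nat.card_prod, ← Nat.card_prod, eq_comm]
  have hs (s : Fin 3 → ℤˣ) (hs : ∀ i, s i ≠ 1 → co q i = 0 ∨ co q i = 1 / 2) :
      aff s (wallShift s q) q = q := by
    refine halfSpace_ext rfl fun i => ?_
    rw [co_aff, wallShift]
    rcases Int.units_eq_one_or (s i) with h1 | h1
    · simp [h1]
    · rcases hs i (by rw [h1]; decide) with h2 | h2
      · simp [h2]
      · simp [h1, h2]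
        norm_num
  let f : {n : Cusp // n.IsIsotropic ∧ n.pair q = 1} ×
      {k : Fin 3 // (h = false → k = 0) ∧ rot k q = q} ×
      {s : Fin 3 → ℤˣ // ∀ i, s i ≠ 1 → co q i = 0 ∨ co q i = 1 / 2} →
      {g : Equiv.Perm HalfSpace // g ∈ extendedGroup h ∧ g q = q} := fun p =>
    ⟨aff p.2.2.1 (wallShift p.2.2.1 q) * rot p.2.1.1 * e p.1,
      mul_mem (mul_mem (aff_mem _ _ _) (Or.inl (rot_mem p.2.1.2.1)))
        (extendedGroup_false_le h (he p.1)), by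
      rw [Equiv.Perm.mul_apply, Equiv.Perm.mul_apply, heq _ q (specializes_refl q),
        p.2.1.2.2, hs _ p.2.2.2]⟩
  refine Nat.card_congr (Equiv.ofBijective f ⟨?_, ?_⟩)
  · rintro ⟨n, k, s⟩ ⟨n', k', s'⟩ hff
    have hff' : aff s.1 (wallShift s.1 q) * rot k.1 * e n =
        aff s'.1 (wallShift s'.1 q) * rot k'.1 * e n' := congrArg Subtype.val hff
    have hcusp (n) (k : Fin 3) (s : Fin 3 → ℤˣ) (m : Fin 3 → ℤ) :
        HasCusp (aff s m * rot k * e n) n.1 := fun p => by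
      simpa using hen n p
    have hn : n = n' := Subtype.ext ((hcusp n _ _ _).unique (hff' ▸ hcusp n' _ _ _))
    subst hn
    obtain ⟨h1, h2⟩ := aff_mul_rot_injective (mul_right_cancel hff')
    rw [Subtype.ext h1, Subtype.ext h2]
  · rintro ⟨x, hx, hxq⟩
    obtain ⟨n, hn, hxn⟩ := exists_hasCusp hx
    have hxr : x q ∈ region := by rw [hxq]; exact hq
    set N : {n : Cusp // n.IsIsotropic ∧ n.pair q = 1} :=
      ⟨n, hn, pair_eq_one_of_mem_region hx hq hxr hn hxn⟩
    obtain ⟨k, s, m, hk, hxe⟩ := affine_of_mem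
      (mul_mem hx (inv_mem (extendedGroup_false_le h (he N)))) (hxn.mul_inv (hen N))
    have hfix : (aff s m * rot k) q = q := by
      rw [← hxe, Equiv.Perm.mul_apply,
        Equiv.Perm.inv_eq_iff_eq.2 (heq N q (specializes_refl q)).symm, hxq]
    have hrot : rot k q = q := by
      rw [← aff_rot_eq_of_mem_region hq (by rw [hfix]; exact hq) (specializes_refl q), hfix]
    have haff (i : Fin 3) : ((s i : ℤ) : ℝ) * co q i + m i = co q i := by
      rw [Equiv.Perm.mul_apply, hrot] at hfix
      rw [← co_aff, hfix]
    have hsi (i : Fin 3) (hi : s i = -1) :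
        (co q i = 0 ∧ m i = 0) ∨ (co q i = 1 / 2 ∧ m i = 1) := by
      have h1 := haff i
      have h2 := hq.2 i
      rw [hi] at h1
      push_cast at h1
      have h3 : (0 : ℝ) ≤ m i := by linarith
      have h4 : (m i : ℝ) ≤ 1 := by linarith
      have h3' : 0 ≤ m i := by exact_mod_cast h3
      have h4' : m i ≤ 1 := by exact_mod_cast h4
      obtain h5 | h5 : m i = 0 ∨ m i = 1 := by omega
      · rw [h5] at h1
        push_cast at h1
        exact Or.inl ⟨by linarith, h5⟩
      · rw [h5] at h1
        push_cast at h1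
        exact Or.inr ⟨by linarith, h5⟩
    have hm : m = wallShift s q := by
      ext i
      rw [wallShift]
      rcases Int.units_eq_one_or (s i) with h1 | h1
      · have h2 := haff i
        rw [h1] at h2
        simp at h2
        simp [h1, h2]
      · rcases hsi i h1 with ⟨h2, h3⟩ | ⟨h2, h3⟩
        · simp [h2, h3]
        · simp [h1, h2, h3]
    refine ⟨(N, ⟨k, hk, hrot⟩, ⟨s, fun i hi => ?_⟩), Subtype.ext ?_⟩
    · rcases hsi i ((Int.units_eq_one_or (s i)).resolve_left hi) with h1 | h1
      exacts [Or.inl h1.1, Or.inr h1.1]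
    · change aff s (wallShift s q) * rot k * e N = x
      rw [← hm, ← hxe, inv_mul_cancel_right]

/-- The coordinates of the cusps other than `∞` that are closest to a point of the unit sphere: `u`
and `w`, where `w` is supported on the set `T` of the coordinates that equal `1/2`, and
`v = 1 + w₀ + w₁ + w₂ - u`. -/
def IsCloseCusp (T : Fin 3 → Bool) (p : Fin 8 × (Fin 3 → Fin 4)) : Prop :=
  (p.1 : ℕ) ≤ 1 + (p.2 0 + p.2 1 + p.2 2 : ℕ) ∧
    (p.1 : ℕ) * (1 + (p.2 0 + p.2 1 + p.2 2 : ℕ) - p.1) =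
      (p.2 0 : ℕ) ^ 2 + (p.2 1 : ℕ) ^ 2 + (p.2 2 : ℕ) ^ 2 ∧ ∀ i, T i = false → p.2 i = 0

instance (T : Fin 3 → Bool) : DecidablePred (IsCloseCusp T) := fun p => by
  unfold IsCloseCusp
  infer_instance

/-- The number of the cusps that are closest to a point of the unit sphere, in terms of the number
of coordinates that equal `1/2`. -/
def closeCount (T : Fin 3 → Bool) : ℕ :=
  ![2, 3, 6, 24] (Fin.ofNat 4 (Finset.univ.filter fun i => T i = true).card)

lemma card_isCloseCusp : ∀ T : Fin 3 → Bool,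
    Fintype.card {p : Fin 8 × (Fin 3 → Fin 4) // IsCloseCusp T p} = closeCount T := by
  decide +kernel

/-- A bound for the cusps closest to a point of the unit sphere, which makes their enumeration
finite. -/
lemma Cusp.IsIsotropic.u_lt_eight {n : Cusp} (hn : n.IsIsotropic)
    (h1 : n.u + n.v = 1 + ∑ i, n.w i) (h2 : ∀ i, 0 ≤ n.w i) : n.u < 8 ∧ ∀ i, n.w i < 4 := by
  have h3 := hn.mul_eq
  have hu := hn.u_nonneg
  have hv := hn.v_nonneg
  rw [Fin.sum_univ_three] at h1 h3
  have h4 := sq_nonneg (n.w 0 - n.w 1)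
  have h5 := sq_nonneg (n.w 1 - n.w 2)
  have h6 := sq_nonneg (n.w 0 - n.w 2)
  have h7 := sq_nonneg (n.u - n.v)
  have h8 : 4 * (n.w 0 ^ 2 + n.w 1 ^ 2 + n.w 2 ^ 2) ≤ (1 + (n.w 0 + n.w 1 + n.w 2)) ^ 2 := by
    rw [← h1, ← h3]; nlinarith
  have hS : n.w 0 + n.w 1 + n.w 2 < 7 := by
    by_contra hcon
    nlinarith
  have hsq : n.w 0 ^ 2 + n.w 1 ^ 2 + n.w 2 ^ 2 < 16 := by
    have := h2 0; have := h2 1; have := h2 2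
    nlinarith
  refine ⟨by omega, fun i => ?_⟩
  have := sq_nonneg (n.w 0)
  have := sq_nonneg (n.w 1)
  have := sq_nonneg (n.w 2)
  have h9 : n.w i ^ 2 < 16 := by
    fin_cases i <;> simp only [Fin.zero_eta, Fin.mk_one, Fin.reduceFinMk] <;> linarith
  nlinarith

lemma card_cusps_of_nsq_eq_one {q : HalfSpace} (hq : q ∈ region) (h1 : nsq q = 1)
    {T : Fin 3 → Bool} (hT : ∀ i, T i = true ↔ co q i = 1 / 2) :
    Nat.card {n : Cusp // n.IsIsotropic ∧ n.pair q = 1} = closeCount T := by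
  rw [← card_isCloseCusp, ← Nat.card_eq_fintype_card, eq_comm]
  let f (p : Fin 8 × (Fin 3 → Fin 4)) : Cusp :=
    ⟨(p.1 : ℕ), 1 + ∑ i, ((p.2 i : ℕ) : ℤ) - (p.1 : ℕ), fun i => (p.2 i : ℕ)⟩
  have hf (p) (hp : IsCloseCusp T p) : (f p).IsIsotropic ∧ (f p).pair q = 1 := by
    obtain ⟨e1, e2, e3⟩ := hp
    have hiso : (f p).IsIsotropic := by
      refine ⟨by simp [f], ?_, ?_, ?_⟩ <;> simp only [f, Fin.sum_univ_three]
      · omega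
      · omega
      · zify [e1] at e2
        exact e2
    refine ⟨hiso, (pair_eq_one_iff hiso hq).2 ⟨fun _ => h1, by simp [f], fun i => ⟨by simp [f],
      fun hi => (hT i).1 ?_⟩⟩⟩
    by_contra hcon
    have := e3 i (by simpa using hcon)
    simp [f, this] at hi
  refine Nat.card_congr (Equiv.ofBijective (fun p => ⟨f p.1, hf p.1 p.2⟩) ⟨?_, ?_⟩)
  · rintro ⟨⟨u, w⟩, hp⟩ ⟨⟨u', w'⟩, hp'⟩ hff
    have hff' : f (u, w) = f (u', w') := congrArg (fun x => x.1) hff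
    have hu : ((u : ℕ) : ℤ) = (u' : ℕ) := congrArg Cusp.u hff'
    have hw (i) : ((w i : ℕ) : ℤ) = (w' i : ℕ) := congrFun (congrArg Cusp.w hff') i
    refine Subtype.ext (Prod.ext (Fin.ext (by exact_mod_cast hu)) (funext fun i =>
      Fin.ext (by exact_mod_cast hw i)))
  · rintro ⟨n, hn, hpair⟩
    obtain ⟨-, e2, e3⟩ := (pair_eq_one_iff hn hq).1 hpair
    obtain ⟨b1, b2⟩ := hn.u_lt_eight e2 fun i => (e3 i).1
    have hu := hn.u_nonneg
    have hv := hn.v_nonneg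
    have hlt (i : Fin 3) : (n.w i).toNat < 4 := by have := b2 i; omega
    have hfn : f (⟨n.u.toNat, by omega⟩, fun i => ⟨(n.w i).toNat, hlt i⟩) = n := by
      refine Cusp.ext ?_ ?_ (funext fun i => ?_)
      · simp [f, hu]
      · simp only [f, Int.toNat_of_nonneg hu, Int.toNat_of_nonneg (e3 _).1]
        omega
      · simp [f, (e3 i).1]
    refine ⟨⟨(⟨n.u.toNat, by omega⟩, fun i => ⟨(n.w i).toNat, hlt i⟩), ?_, ?_, ?_⟩,
      Subtype.ext hfn⟩
    · zify
      rw [Int.toNat_of_nonneg hu, Int.toNat_of_nonneg (e3 _).1, Int.toNat_of_nonneg (e3 _).1,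
        Int.toNat_of_nonneg (e3 _).1]
      rw [Fin.sum_univ_three] at e2
      omega
    · have hmul := hn.mul_eq
      have hle : n.u.toNat ≤ 1 + ((n.w 0).toNat + (n.w 1).toNat + (n.w 2).toNat) := by
        zify
        rw [Int.toNat_of_nonneg hu, Int.toNat_of_nonneg (e3 _).1, Int.toNat_of_nonneg (e3 _).1,
          Int.toNat_of_nonneg (e3 _).1]
        rw [Fin.sum_univ_three] at e2
        omega
      simp only
      zify [hle]
      rw [Int.toNat_of_nonneg hu, Int.toNat_of_nonneg (e3 _).1, Int.toNat_of_nonneg (e3 _).1,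
        Int.toNat_of_nonneg (e3 _).1]
      rw [Fin.sum_univ_three] at e2 hmul
      rw [← hmul, ← add_assoc, ← add_assoc]
      congr 1
      linarith
    · intro i hi
      have : n.w i = 0 := by
        by_contra hcon
        have := (hT i).2 ((e3 i).2 hcon)
        rw [this] at hi
        exact absurd hi (by decide)
      simp [this]

lemma card_cusps_of_nsq_ne_one {q : HalfSpace} (hq : q ∈ region) (h1 : nsq q ≠ 1) :
    Nat.card {n : Cusp // n.IsIsotropic ∧ n.pair q = 1} = 1 := by
  rw [Nat.card_eq_one_iff_unique]
  refine ⟨⟨fun a b => ?_⟩, ⟨Cusp.infty, Cusp.isIsotropic_infty, by simp⟩⟩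
  have key (n : {n : Cusp // n.IsIsotropic ∧ n.pair q = 1}) : n.1 = Cusp.infty := by
    have hu : n.1.u = 0 := by
      by_contra hu
      exact h1 (((pair_eq_one_iff n.2.1 hq).1 n.2.2).1 hu)
    exact n.2.1.eq_infty hu n.2.2
  exact Subtype.ext ((key a).trans (key b).symm)

/-- The position of a point of the fundamental region with respect to its walls: `τ i` tells
whether the coordinate `ω_i` is `0` (`τ i = -1`), `1/2` (`τ i = 1`) or neither, `b` whether the
point is on the unit sphere, and `d`, which matters only if `h` holds, whether it is diagonal. -/
structure HasType (h : Bool) (τ : Fin 3 → SignType) (b d : Bool) (q : HalfSpace) : Prop where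
  mem : q ∈ region
  zero_iff : ∀ i, co q i = 0 ↔ τ i = -1
  half_iff : ∀ i, co q i = 1 / 2 ↔ τ i = 1
  sphere_iff : nsq q = 1 ↔ b = true
  diag_iff : h = true → (IsDiag q ↔ d = true)

/-- The order of the isotropy group at a point of the given type: the product of the number of
closest cusps and the order of the affine part of the full isotropy group, divided by two for
points in the walls, where half of the full isotropy group reverses the orientation. -/
def isotropyOrder (h : Bool) (τ : Fin 3 → SignType) (b d : Bool) : ℕ :=
  (bif b then closeCount (fun i => τ i = 1) else 1) *
    ((bif h && d then 3 else 1) * 2 ^ (Finset.univ.filter fun i => τ i ≠ 0).card) /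
      (if b = true ∨ ∃ i, τ i ≠ 0 then 2 else 1)

lemma card_rot (h d : Bool) {q : HalfSpace} (hd : h = true → (IsDiag q ↔ d = true)) :
    Nat.card {k : Fin 3 // (h = false → k = 0) ∧ rot k q = q} = bif h && d then 3 else 1 := by
  have h0 : rot 0 q = q := halfSpace_ext rfl (by simp)
  by_cases hh : h = true ∧ IsDiag q
  · rw [hh.1, (hd hh.1).1 hh.2]
    have : ∀ k : Fin 3, ((true = false → k = 0) ∧ rot k q = q) ↔ True := fun k => by
      simp [rot_eq_of_isDiag hh.2]
    simp only [this]
    simp [Nat.card_eq_fintype_card]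
  · have h1 : (h && d) = false := by
      by_contra hcon
      simp only [Bool.not_eq_false, Bool.and_eq_true] at hcon
      exact hh ⟨hcon.1, (hd hcon.1).2 hcon.2⟩
    rw [h1, cond_false, Nat.card_eq_one_iff_unique]
    refine ⟨⟨fun a b => ?_⟩, ⟨0, fun _ => rfl, h0⟩⟩
    have key (k : {k : Fin 3 // (h = false → k = 0) ∧ rot k q = q}) : k.1 = 0 := by
      by_contra hk
      refine hh ⟨?_, isDiag_of_rot_eq hk k.2.2⟩
      by_contra hcon
      exact hk (k.2.1 (by simpa using hcon))
    exact Subtype.ext ((key a).trans (key b).symm)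

lemma card_signs : ∀ τ : Fin 3 → SignType,
    Fintype.card {s : Fin 3 → ℤˣ // ∀ i, s i ≠ 1 → τ i = -1 ∨ τ i = 1} =
      2 ^ (Finset.univ.filter fun i => τ i ≠ 0).card := by
  decide +kernel

/-- The order of the isotropy group in the modular group depends only on the type of the point. -/
theorem fixCard_eq {h : Bool} {τ : Fin 3 → SignType} {b d : Bool} {q : HalfSpace}
    (hq : HasType h τ b d q) : fixCard (modularGroup h) q = isotropyOrder h τ b d := by
  have hE := fixCard_extendedGroup (h := h) hq.mem
  have h1 : Nat.card {n : Cusp // n.IsIsotropic ∧ n.pair q = 1} =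
      bif b then closeCount (fun i => τ i = 1) else 1 := by
    cases hb : b
    · exact card_cusps_of_nsq_ne_one hq.mem (by rw [ne_eq, hq.sphere_iff, hb]; decide)
    · exact card_cusps_of_nsq_eq_one hq.mem (hq.sphere_iff.2 hb)
        fun i => by simp only [decide_eq_true_eq, hq.half_iff]
  have h3 : Nat.card {s : Fin 3 → ℤˣ // ∀ i, s i ≠ 1 → co q i = 0 ∨ co q i = 1 / 2} =
      2 ^ (Finset.univ.filter fun i => τ i ≠ 0).card := by
    simp only [hq.zero_iff, hq.half_iff]
    rw [Nat.card_eq_fintype_card, card_signs]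
  rw [h1, card_rot h d hq.diag_iff, h3] at hE
  have hw : OnWall q ↔ b = true ∨ ∃ i, τ i ≠ 0 := by
    simp only [OnWall, hq.sphere_iff, hq.zero_iff, hq.half_iff]
    have : ∀ a : SignType, (a = -1 ∨ a = 1) ↔ a ≠ 0 := by decide
    simp only [this]
  rw [isotropyOrder, ← hE]
  split_ifs with hif
  · rw [fixCard_of_onWall (hw.2 hif), Nat.mul_div_cancel_left _ two_pos]
  · rw [fixCard_of_not_onWall hq.mem (fun hc => hif (hw.1 hc)), Nat.div_one]

/-! ### Topology of the orbit space -/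

@[fun_prop] lemma continuous_ht : Continuous ht :=
  Quaternion.continuous_re.comp continuous_subtype_val

@[fun_prop] lemma continuous_co (i : Fin 3) : Continuous fun q => co q i := by
  fin_cases i
  · exact Quaternion.continuous_imI.comp continuous_subtype_val
  · exact Quaternion.continuous_imJ.comp continuous_subtype_val
  · exact Quaternion.continuous_imK.comp continuous_subtype_val

@[fun_prop] lemma continuous_nsq : Continuous nsq := by
  unfold nsq
  fun_prop

@[fun_prop] lemma continuous_pair (n : Cusp) : Continuous n.pair := by
  unfold Cusp.pair
  fun_prop

/-- A map to the half-space is continuous if its coordinates are. -/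
lemma continuousOn_halfSpace {X : Type*} [TopologicalSpace X] {f : X → HalfSpace} {s : Set X}
    (h0 : ContinuousOn (fun x => ht (f x)) s) (h1 : ∀ i, ContinuousOn (fun x => co (f x) i) s) :
    ContinuousOn f s := by
  have h2 := h1 0
  have h3 := h1 1
  have h4 := h1 2
  have h5 : ContinuousOn (fun x => ht (f x) • (1 : ℍ[ℝ]) + co (f x) 0 • quat 0 1 0 0 +
      co (f x) 1 • quat 0 0 1 0 + co (f x) 2 • quat 0 0 0 1) s := by fun_prop
  refine Topology.IsInducing.subtypeVal.continuousOn_iff.2 (h5.congr fun x _ => ?_)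
  refine quaternion_ext ?_ ?_ ?_ ?_ <;> simp [ht, co]

lemma continuous_halfSpace {X : Type*} [TopologicalSpace X] {f : X → HalfSpace}
    (h0 : Continuous fun x => ht (f x)) (h1 : ∀ i, Continuous fun x => co (f x) i) :
    Continuous f := by
  rw [← continuousOn_univ]
  exact continuousOn_halfSpace h0.continuousOn fun i => (h1 i).continuousOn

/-- Elements of the extended groups such that the heights of the images of a point determine the
point. -/
def probe : Option (Option (Fin 3)) → Equiv.Perm HalfSpace
  | none => 1
  | some none => sphereReflection
  | some (some i) => sphereReflection * aff 1 (Pi.single i 1)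

lemma probe_mem (h : Bool) (j : Option (Option (Fin 3))) : probe j ∈ extendedGroup h := by
  match j with
  | none => exact one_mem _
  | some none => exact sphereReflection_mem h
  | some (some i) => exact mul_mem (sphereReflection_mem h) (aff_mem _ _ h)

lemma nsq_eq_probe (p : HalfSpace) : nsq p = ht (probe none p) / ht (probe (some none) p) := by
  have := (ht_pos p).ne'
  have := (nsq_pos p).ne'
  simp only [probe, Equiv.Perm.one_apply, ht_sphereReflection]
  field_simp

lemma co_eq_probe (p : HalfSpace) (i : Fin 3) :
    co p i = (ht (probe none p) / ht (probe (some (some i)) p) -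
      ht (probe none p) / ht (probe (some none) p) - 1) / 2 := by
  have h0 := (ht_pos p).ne'
  have h1 := (nsq_pos (aff 1 (Pi.single i 1) p)).ne'
  have e : ht (probe none p) / ht (probe (some (some i)) p) = nsq (aff 1 (Pi.single i 1) p) := by
    simp only [probe, Equiv.Perm.one_apply, Equiv.Perm.mul_apply, ht_sphereReflection, ht_aff]
    field_simp
  rw [e, ← nsq_eq_probe]
  simp only [nsq, ht_aff, co_aff, Fin.sum_univ_three, Pi.one_apply, Units.val_one, Int.cast_one,
    one_mul]
  fin_cases i <;> simp <;> ring

lemma eq_of_ht_probe_eq {p p' : HalfSpace} (h : ∀ j, ht (probe j p) = ht (probe j p')) : p = p' :=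
  halfSpace_ext (h none) fun i => by rw [co_eq_probe, co_eq_probe, h, h, h]

lemma continuous_of_mem {h : Bool} {x : Equiv.Perm HalfSpace} (hx : x ∈ extendedGroup h) :
    Continuous x := by
  have key (j) : Continuous fun p => ht (probe j (x p)) := by
    obtain ⟨n, -, hn⟩ := exists_hasCusp (mul_mem (probe_mem h j) hx)
    have e : (fun p => ht (probe j (x p))) = fun p => ht p / n.pair p := by
      ext1 p
      rw [eq_div_iff (hn.pair_pos p).ne', hn p]
      rfl
    rw [e]
    exact continuous_ht.div (continuous_pair n) fun p => (hn.pair_pos p).ne'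
  refine continuous_halfSpace (key none) fun i => ?_
  simp only [co_eq_probe]
  have := key none
  have := key (some none)
  have := key (some (some i))
  fun_prop (disch := exact fun p => (ht_pos _).ne')

instance (h : Bool) : ContinuousConstSMul (modularGroup h) HalfSpace :=
  ⟨fun γ => continuous_of_mem (modularGroup_le_extendedGroup h γ.2)⟩

/-- The modular groups act properly discontinuously: if `γ` maps a point of a compact set to a point
of another one, then only finitely many cusps are possible for `probe j * γ`, and these cusps
determine `γ`. -/
instance (h : Bool) : ProperlyDiscontinuousSMul (modularGroup h) HalfSpace where
  finite_disjoint_inter_image {K L} hK hL := by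
    have hcusp (γ : modularGroup h) (j) :
        ∃ n : Cusp, n.IsIsotropic ∧ HasCusp (probe j * γ.1) n :=
      exists_hasCusp (mul_mem (probe_mem h j) (modularGroup_le_extendedGroup h γ.2))
    choose N hN1 hN2 using hcusp
    rcases K.eq_empty_or_nonempty with rfl | hKne
    · simp
    rcases L.eq_empty_or_nonempty with rfl | hLne
    · simp
    obtain ⟨p0, -, hp0⟩ := hK.exists_isMinOn hKne continuous_ht.continuousOn
    obtain ⟨p1, -, hp1⟩ := hK.exists_isMaxOn hKne continuous_nsq.continuousOn
    obtain ⟨p2, -, hp2⟩ := hK.exists_isMaxOn hKne continuous_ht.continuousOn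
    have hl (j) : ∃ l, 0 < l ∧ ∀ q ∈ L, l ≤ ht (probe j q) := by
      obtain ⟨l0, -, hl0⟩ := hL.exists_isMinOn hLne
        (continuous_ht.comp (continuous_of_mem (probe_mem h j))).continuousOn
      exact ⟨_, ht_pos (probe j l0), fun q hq => hl0 hq⟩
    choose l hl0 hl1 using hl
    refine Set.Finite.of_injOn (f := N) (t := Set.pi Set.univ fun j =>
      {n : Cusp | n.IsIsotropic ∧ ∃ q, ht p0 ≤ ht q ∧ nsq q ≤ nsq p1 ∧ n.pair q ≤ ht p2 / l j})
      ?_ ?_ (Set.Finite.pi fun j => finite_cusps _ _ _ (ht_pos p0))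
    · rintro γ ⟨_, ⟨p, hp, rfl⟩, hpL⟩ j -
      refine ⟨hN1 γ j, p, hp0 hp, hp1 hp, ?_⟩
      have h1 : ht p = ht (probe j (γ.1 p)) * (N γ j).pair p := hN2 γ j p
      have h2 : l j ≤ ht (probe j (γ.1 p)) := hl1 j _ hpL
      have h3 : ht p ≤ ht p2 := hp2 hp
      rw [le_div_iff₀ (hl0 j)]
      nlinarith [(hN2 γ j).pair_pos p]
    · rintro γ - γ' - hγ
      refine Subtype.ext (Equiv.ext fun p => eq_of_ht_probe_eq fun j => ?_)
      have h1 : ht p = ht (probe j (γ.1 p)) * (N γ j).pair p := hN2 γ j p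
      have h2 : ht p = ht (probe j (γ'.1 p)) * (N γ' j).pair p := hN2 γ' j p
      rw [← hγ, h1] at h2
      exact mul_right_cancel₀ ((hN2 γ j).pair_pos p).ne' h2

instance : LocallyCompactSpace HalfSpace :=
  haveI := FiniteDimensional.proper ℝ ℍ[ℝ]
  (isOpen_lt continuous_const Quaternion.continuous_re).locallyCompactSpace

instance (h : Bool) : LocallyCompactSpace (OrbitSpace (modularGroup h) HalfSpace) :=
  MulAction.isOpenQuotientMap_quotientMk.locallyCompactSpace

instance (h : Bool) : T2Space (OrbitSpace (modularGroup h) HalfSpace) :=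
  t2Space_of_properlyDiscontinuousSMul_of_t2Space

instance finite_stabilizer (h : Bool) (q : HalfSpace) :
    Finite (MulAction.stabilizer (modularGroup h) q) :=
  ProperlyDiscontinuousSMul.finite_stabilizer q

lemma continuous_orbitMk (h : Bool) :
    Continuous (orbitMk (modularGroup h) : HalfSpace → _) :=
  continuous_quotient_mk'

/-- The height is bounded along an orbit. -/
lemma ht_apply_mul_le {h : Bool} {x : Equiv.Perm HalfSpace} (hx : x ∈ extendedGroup h)
    (p : HalfSpace) : ht (x p) * min 1 (ht p ^ 2) ≤ ht p := by
  obtain ⟨n, hn, hxn⟩ := exists_hasCusp hx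
  conv_rhs => rw [hxn p]
  refine mul_le_mul_of_nonneg_left ?_ (ht_pos _).le
  rcases hn.u_nonneg.eq_or_lt with h0 | h0
  · refine (min_le_left _ _).trans ?_
    have hpos := hn.pos
    rw [← h0, zero_add] at hpos
    have : (1 : ℝ) ≤ n.v := by exact_mod_cast hpos
    simpa [Cusp.pair, hn.eq_zero h0.symm, ← h0] using this
  · refine (min_le_right _ _).trans ((le_mul_of_one_le_left (sq_nonneg _) ?_).trans
      (hn.u_mul_sq_le p))
    exact_mod_cast h0

/-- Points of large height leave every compact subset of the orbit space. -/
lemma exists_ht_bound {h : Bool} {C : Set (OrbitSpace (modularGroup h) HalfSpace)}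
    (hC : IsCompact C) : ∃ B, ∀ q, B < ht q → orbitMk (modularGroup h) q ∉ C := by
  let U (n : ℕ) : Set HalfSpace := {q | 1 / ((n : ℝ) + 1) < ht q ∧ ht q < (n : ℝ) + 1}
  have hU (n : ℕ) : IsOpen (U n) :=
    (isOpen_lt continuous_const continuous_ht).inter (isOpen_lt continuous_ht continuous_const)
  have hmono : Monotone U := by
    intro m n hmn q hq
    have h1 : (m : ℝ) + 1 ≤ n + 1 := by exact_mod_cast Nat.succ_le_succ hmn
    exact ⟨(one_div_le_one_div_of_le (by positivity) h1).trans_lt hq.1, hq.2.trans_le h1⟩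
  obtain ⟨n, hn⟩ := hC.elim_directed_cover (fun n => orbitMk (modularGroup h) '' U n)
    (fun n => MulAction.isOpenQuotientMap_quotientMk.isOpenMap _ (hU n))
    (by
      intro y _
      obtain ⟨q, rfl⟩ := Quotient.exists_rep y
      obtain ⟨n, hn⟩ := exists_nat_gt (max (ht q) (1 / ht q))
      refine Set.mem_iUnion.2 ⟨n, q, ⟨?_, ?_⟩, rfl⟩
      · rw [one_div_lt (by positivity) (ht_pos q)]
        exact ((le_max_right _ _).trans_lt hn).trans (lt_add_one _)
      · exact ((le_max_left _ _).trans_lt hn).trans (lt_add_one _))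
    (Monotone.directed_le fun m n hmn => Set.image_mono (hmono hmn))
  refine ⟨((n : ℝ) + 1) / min 1 ((1 / ((n : ℝ) + 1)) ^ 2), fun q hq hqC => ?_⟩
  obtain ⟨p, ⟨hp1, hp2⟩, hpq⟩ := hn hqC
  obtain ⟨g, hg, rfl⟩ := orbitMk_eq_iff.1 hpq.symm
  have h1 := ht_apply_mul_le (modularGroup_le_extendedGroup h hg) p
  have h2 : 0 < min 1 ((1 / ((n : ℝ) + 1)) ^ 2) := by positivity
  rw [div_lt_iff₀ h2] at hq
  have h3 : min 1 ((1 / ((n : ℝ) + 1)) ^ 2) ≤ min 1 (ht p ^ 2) := by gcongr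
  nlinarith [ht_pos (g p)]

/-! ### CW structures from maps of cubes -/

section Cube

variable {ι : Type}

/-- The face of the cube `[-1, 1]^ι` that has the point `y` in its interior: for every coordinate,
the sign of the endpoint at which it lies, or `0` for the coordinates that vary along the face. -/
def faceOf (y : ι → ℝ) (i : ι) : SignType := if y i = 1 then 1 else if y i = -1 then -1 else 0

lemma faceOf_eq_one {y : ι → ℝ} {i : ι} : faceOf y i = 1 ↔ y i = 1 := by
  unfold faceOf
  split_ifs <;> simp_all

lemma faceOf_eq_neg_one {y : ι → ℝ} {i : ι} : faceOf y i = -1 ↔ y i = -1 := by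
  unfold faceOf
  split_ifs <;> (simp_all; try norm_num)

lemma faceOf_eq_zero {y : ι → ℝ} {i : ι} : faceOf y i = 0 ↔ y i ≠ 1 ∧ y i ≠ -1 := by
  unfold faceOf
  split_ifs <;> simp_all

variable [Fintype ι]

/-- The dimension of a face of the cube. -/
def faceDim (f : ι → SignType) : ℕ := Fintype.card {i // f i = 0}

/-- The parametrization of a face of dimension `n` by the cube `[-1, 1]^n`. -/
def faceMap {f : ι → SignType} {n : ℕ} (hf : faceDim f = n) (x : Fin n → ℝ) (i : ι) : ℝ :=
  if h : f i = 0 then x (Fintype.equivFinOfCardEq hf ⟨i, h⟩) else (f i : ℝ)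

lemma mem_cube_iff {y : ι → ℝ} : y ∈ Metric.closedBall (0 : ι → ℝ) 1 ↔ ∀ i, -1 ≤ y i ∧ y i ≤ 1 := by
  rw [mem_closedBall_zero_iff, pi_norm_le_iff_of_nonneg zero_le_one]
  simp only [Real.norm_eq_abs, abs_le]

lemma mem_openCube_iff {y : ι → ℝ} : y ∈ Metric.ball (0 : ι → ℝ) 1 ↔ ∀ i, -1 < y i ∧ y i < 1 := by
  rw [mem_ball_zero_iff, pi_norm_lt_iff zero_lt_one]
  simp only [Real.norm_eq_abs, abs_lt]

lemma continuous_faceMap {f : ι → SignType} {n : ℕ} (hf : faceDim f = n) :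
    Continuous (faceMap hf) := by
  refine continuous_pi fun i => ?_
  unfold faceMap
  by_cases h : f i = 0
  · simp only [h, dite_true]
    fun_prop
  · simp only [h, dite_false]
    fun_prop

lemma faceMap_mem {f : ι → SignType} {n : ℕ} (hf : faceDim f = n) {x : Fin n → ℝ}
    (hx : x ∈ Metric.closedBall (0 : Fin n → ℝ) 1) :
    faceMap hf x ∈ Metric.closedBall (0 : ι → ℝ) 1 := by
  rw [mem_cube_iff] at hx ⊢
  intro i
  unfold faceMap
  split_ifs with h
  · exact hx _
  · rcases hs : f i with _ | _ | _ <;> simp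

lemma faceMap_injective {f : ι → SignType} {n : ℕ} (hf : faceDim f = n) :
    Function.Injective (faceMap hf) := by
  intro x x' hxx'
  ext j
  have h := congrFun hxx' ((Fintype.equivFinOfCardEq hf).symm j)
  have h0 := ((Fintype.equivFinOfCardEq hf).symm j).2
  simpa [faceMap, h0] using h

lemma faceOf_faceMap {f : ι → SignType} {n : ℕ} (hf : faceDim f = n) {x : Fin n → ℝ}
    (hx : x ∈ Metric.ball (0 : Fin n → ℝ) 1) : faceOf (faceMap hf x) = f := by
  rw [mem_openCube_iff] at hx
  ext1 i
  rcases hs : f i with _ | _ | _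
  · refine faceOf_eq_zero.2 ?_
    have h : f i = 0 := hs
    have := hx (Fintype.equivFinOfCardEq hf ⟨i, h⟩)
    simp only [faceMap, h, dite_true]
    exact ⟨this.2.ne, this.1.ne'⟩
  · refine faceOf_eq_neg_one.2 ?_
    simp [faceMap, hs]
  · refine faceOf_eq_one.2 ?_
    simp [faceMap, hs]

lemma exists_faceMap_eq {y : ι → ℝ} (hy : y ∈ Metric.closedBall (0 : ι → ℝ) 1) {n : ℕ}
    (hn : faceDim (faceOf y) = n) :
    ∃ x ∈ Metric.ball (0 : Fin n → ℝ) 1, faceMap hn x = y := by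
  rw [mem_cube_iff] at hy
  refine ⟨fun j => y ((Fintype.equivFinOfCardEq hn).symm j), mem_openCube_iff.2 fun j => ?_, ?_⟩
  · have h0 := faceOf_eq_zero.1 ((Fintype.equivFinOfCardEq hn).symm j).2
    exact ⟨lt_of_le_of_ne (hy _).1 h0.2.symm, lt_of_le_of_ne (hy _).2 h0.1⟩
  · ext i
    unfold faceMap
    split_ifs with h
    · simp
    · rcases hs : faceOf y i with _ | _ | _
      · exact absurd hs h
      · rw [faceOf_eq_neg_one.1 hs]; simp
      · rw [faceOf_eq_one.1 hs]; simp

lemma faceDim_faceOf_lt {f : ι → SignType} {n : ℕ} (hf : faceDim f = n) {x : Fin n → ℝ}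
    (hx : x ∉ Metric.ball (0 : Fin n → ℝ) 1) (hx' : x ∈ Metric.closedBall (0 : Fin n → ℝ) 1) :
    faceDim (faceOf (faceMap hf x)) < n := by
  have hsub (i : ι) (hi : faceOf (faceMap hf x) i = 0) : f i = 0 := by
    by_contra h
    have h0 := faceOf_eq_zero.1 hi
    simp only [faceMap, h, dite_false] at h0
    rcases hs : f i with _ | _ | _
    · exact h hs
    · simp [hs] at h0
    · simp [hs] at h0
  obtain ⟨j, hj⟩ : ∃ j, ¬(-1 < x j ∧ x j < 1) := by
    rw [mem_openCube_iff] at hx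
    push Not at hx ⊢
    exact hx
  refine lt_of_lt_of_eq (Fintype.card_lt_of_injective_of_notMem
    (fun i : {i // faceOf (faceMap hf x) i = 0} => (⟨i.1, hsub i.1 i.2⟩ : {i // f i = 0}))
    (fun a b hab => Subtype.ext (congrArg (fun c => c.1) hab))
    (b := (Fintype.equivFinOfCardEq hf).symm j) ?_) hf
  rintro ⟨i, hi⟩
  have h0 := faceOf_eq_zero.1 i.2
  have hij : i.1 = ((Fintype.equivFinOfCardEq hf).symm j).1 := congrArg (fun c => c.1) hi
  have hval : faceMap hf x i.1 = x j := by
    have h1 := ((Fintype.equivFinOfCardEq hf).symm j).2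
    rw [hij]
    simp [faceMap, h1]
  rw [hval] at h0
  have h2 := mem_cube_iff.1 hx' j
  exact hj ⟨lt_of_le_of_ne h2.1 h0.2.symm, lt_of_le_of_ne h2.2 h0.1⟩

/-- A continuous map of a compact set `s` to a Hausdorff space, which is injective on a part of `s`
whose image is disjoint from the image of the rest, has a continuous inverse on this part: images of
closed sets are closed. -/
lemma continuousOn_symm_of_isCompact {X Y : Type*} [TopologicalSpace X] [TopologicalSpace Y]
    [T2Space Y] (e : PartialEquiv X Y) {s : Set X} (hs : IsCompact s) (hes : e.source ⊆ s)
    (hc : ContinuousOn e s) (hd : ∀ x ∈ s, e x ∈ e.target → x ∈ e.source) :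
    ContinuousOn e.symm e.target := by
  rw [continuousOn_iff_isClosed]
  intro t ht
  refine ⟨e '' (s ∩ t), ((hs.inter_right ht).image_of_continuousOn
    (hc.mono Set.inter_subset_left)).isClosed, ?_⟩
  ext y
  constructor
  · rintro ⟨hy1, hy2⟩
    exact ⟨⟨e.symm y, ⟨hes (e.map_target hy2), hy1⟩, e.right_inv hy2⟩, hy2⟩
  · rintro ⟨⟨x, ⟨hx1, hx2⟩, rfl⟩, hy2⟩
    refine ⟨?_, hy2⟩
    rw [Set.mem_preimage, e.left_inv (hd x hx1 hy2)]
    exact hx2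

/-- Two maps of the cube `[-1, 1]^ι` to `Y` and a set of faces of the two cubes, such that the
interiors of these faces are mapped bijectively onto the complement of the point `p`, and every
point of another face is mapped to `p` or to the image of an interior point of a face in the set of
no larger dimension. -/
structure CubicalCover (ι : Type) [Fintype ι] (Y : Type) [TopologicalSpace Y]
    (p : Y) where
  /-- The faces that give the cells. -/
  faces : Finset (Bool × (ι → SignType))
  /-- The maps of the two cubes. -/
  map : Bool → (ι → ℝ) → Y
  continuousOn : ∀ ε, ContinuousOn (map ε) (Metric.closedBall 0 1)
  /-- Every point of the cubes is mapped to `p` or represented in a face of the set. -/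
  exists_face : ∀ ε, ∀ y ∈ Metric.closedBall (0 : ι → ℝ) 1, map ε y = p ∨
    ∃ ε', ∃ y' ∈ Metric.closedBall (0 : ι → ℝ) 1, (ε', faceOf y') ∈ faces ∧ map ε' y' = map ε y ∧
      faceDim (faceOf y') ≤ faceDim (faceOf y)
  ne_base : ∀ ε, ∀ y ∈ Metric.closedBall (0 : ι → ℝ) 1, (ε, faceOf y) ∈ faces → map ε y ≠ p
  /-- The representation by interior points of faces of the set is unique. -/
  injective : ∀ ε, ∀ y ∈ Metric.closedBall (0 : ι → ℝ) 1, ∀ ε',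
    ∀ y' ∈ Metric.closedBall (0 : ι → ℝ) 1, (ε, faceOf y) ∈ faces → (ε', faceOf y') ∈ faces →
      map ε y = map ε' y' → ε = ε' ∧ y = y'
  exists_map_eq : ∀ z, z ≠ p → ∃ ε, ∃ y ∈ Metric.closedBall (0 : ι → ℝ) 1, map ε y = z

namespace CubicalCover

variable {Y : Type} [TopologicalSpace Y] {p : Y} (A : CubicalCover ι Y p)

/-- The cells of dimension `n`. -/
abbrev Cell (n : ℕ) : Type := {c : Bool × (ι → SignType) // c ∈ A.faces ∧ faceDim c.2 = n}

/-- The characteristic map of a cell. -/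
def charMap {n : ℕ} (c : A.Cell n) (x : Fin n → ℝ) : Y := A.map c.1.1 (faceMap c.2.2 x)

variable {A}

lemma face_mem {n : ℕ} (c : A.Cell n) {x : Fin n → ℝ} (hx : x ∈ Metric.ball (0 : Fin n → ℝ) 1) :
    (c.1.1, faceOf (faceMap c.2.2 x)) ∈ A.faces := by
  rw [faceOf_faceMap _ hx]
  exact c.2.1

lemma faceMap_mem_cube {n : ℕ} (c : A.Cell n) {x : Fin n → ℝ}
    (hx : x ∈ Metric.ball (0 : Fin n → ℝ) 1) :
    faceMap c.2.2 x ∈ Metric.closedBall (0 : ι → ℝ) 1 :=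
  faceMap_mem _ (Metric.ball_subset_closedBall hx)

lemma eq_of_charMap_eq {m n : ℕ} (c : A.Cell m) (c' : A.Cell n) {x : Fin m → ℝ} {x' : Fin n → ℝ}
    (hx : x ∈ Metric.ball (0 : Fin m → ℝ) 1) (hx' : x' ∈ Metric.ball (0 : Fin n → ℝ) 1)
    (h : A.charMap c x = A.charMap c' x') : c.1 = c'.1 ∧ faceMap c.2.2 x = faceMap c'.2.2 x' := by
  obtain ⟨h1, h2⟩ := A.injective _ _ (faceMap_mem_cube c hx) _ _ (faceMap_mem_cube c' hx')
    (face_mem c hx) (face_mem c' hx') h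
  refine ⟨Prod.ext h1 ?_, h2⟩
  rw [← faceOf_faceMap c.2.2 hx, h2, faceOf_faceMap c'.2.2 hx']

lemma injOn_charMap {n : ℕ} (c : A.Cell n) : Set.InjOn (A.charMap c) (Metric.ball 0 1) :=
  fun _ hx _ hx' h => faceMap_injective _ (eq_of_charMap_eq c c hx hx' h).2

lemma continuousOn_charMap {n : ℕ} (c : A.Cell n) :
    ContinuousOn (A.charMap c) (Metric.closedBall 0 1) :=
  (A.continuousOn _).comp (continuous_faceMap _).continuousOn fun _ hx => faceMap_mem _ hx

/-- A boundary point of a cell is mapped to the base point or into a cell of lower dimension. -/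
lemma exists_charMap_eq_of_notMem {n : ℕ} (c : A.Cell n) {x : Fin n → ℝ}
    (hx : x ∉ Metric.ball (0 : Fin n → ℝ) 1) (hx' : x ∈ Metric.closedBall (0 : Fin n → ℝ) 1) :
    A.charMap c x = p ∨ ∃ m < n, ∃ c' : A.Cell m, ∃ x' ∈ Metric.ball (0 : Fin m → ℝ) 1,
      A.charMap c' x' = A.charMap c x := by
  refine (A.exists_face c.1.1 _ (faceMap_mem c.2.2 hx')).imp id ?_
  rintro ⟨ε', y', hy', hf, he, hd⟩
  obtain ⟨x', hx'1, hx'2⟩ := exists_faceMap_eq hy' rfl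
  refine ⟨_, hd.trans_lt (faceDim_faceOf_lt c.2.2 hx hx'), ⟨(ε', faceOf y'), hf, rfl⟩, x', hx'1, ?_⟩
  exact (congrArg (A.map ε') hx'2).trans he

lemma charMap_ne {n : ℕ} (c : A.Cell n) {x : Fin n → ℝ} (hx : x ∈ Metric.ball (0 : Fin n → ℝ) 1) :
    A.charMap c x ≠ p :=
  A.ne_base _ _ (faceMap_mem_cube c hx) (face_mem c hx)

lemma mem_ball_of_charMap_mem {n : ℕ} (c : A.Cell n) {x : Fin n → ℝ}
    (hx : x ∈ Metric.closedBall (0 : Fin n → ℝ) 1)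
    (h : A.charMap c x ∈ A.charMap c '' Metric.ball 0 1) :
    x ∈ Metric.ball (0 : Fin n → ℝ) 1 := by
  by_contra hx'
  obtain ⟨x1, hx1, he⟩ := h
  rcases exists_charMap_eq_of_notMem c hx' hx with h0 | ⟨m, hm, c', x', hx', he'⟩
  · exact charMap_ne c hx1 (he.trans h0)
  · have h1 := (eq_of_charMap_eq c' c hx' hx1 (he'.trans he.symm)).1
    exact hm.ne (c'.2.2.symm.trans ((congrArg (fun c => faceDim c.2) h1).trans c.2.2))

variable (A)

/-- The characteristic map of a cell, as a bijection of the open ball onto the open cell. -/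
def cellMap (n : ℕ) (c : A.Cell n) : PartialEquiv (Fin n → ℝ) Y :=
  (injOn_charMap c).toPartialEquiv

/-- The relative CW complex with the faces of a cubical cover as cells. -/
abbrev cw [T2Space Y] : RelCWComplex (Set.univ : Set Y) {p} :=
  RelCWComplex.mkFinite Set.univ {p} A.Cell A.cellMap
    (Filter.eventually_atTop.2 ⟨Fintype.card ι + 1, fun n hn => ⟨fun c => by
      have h1 : faceDim c.1.2 ≤ Fintype.card ι := Fintype.card_subtype_le _
      have h2 := c.2.2
      omega⟩⟩)
    (fun _ => inferInstance)
    (fun _ _ => rfl)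
    (fun _ c => continuousOn_charMap c)
    (fun _ c => continuousOn_symm_of_isCompact _ (isCompact_closedBall 0 1)
      Metric.ball_subset_closedBall (continuousOn_charMap c) fun _ => mem_ball_of_charMap_mem c)
    (by
      rintro ⟨m, c⟩ - ⟨n, c'⟩ - hne
      refine Set.disjoint_left.2 ?_
      rintro _ ⟨x, hx, rfl⟩ ⟨x', hx', he⟩
      obtain ⟨c, hc, rfl⟩ := c
      obtain ⟨c', hc', rfl⟩ := c'
      obtain rfl := (eq_of_charMap_eq _ _ hx' hx he).1
      exact hne rfl)
    (by
      rintro n c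
      refine Set.disjoint_left.2 ?_
      rintro _ ⟨x, hx, rfl⟩ hp
      exact charMap_ne c hx hp)
    (by
      intro n c x hx
      rcases exists_charMap_eq_of_notMem c (Metric.sphere_disjoint_ball.notMem_of_mem_left hx)
        (Metric.sphere_subset_closedBall hx) with h0 | ⟨m, hm, c', x', hx', he'⟩
      · exact Or.inl h0
      · exact Or.inr (Set.mem_iUnion₂.2 ⟨m, hm, Set.mem_iUnion.2 ⟨c', x',
          Metric.ball_subset_closedBall hx', he'⟩⟩))
    isClosed_singleton
    (by
      refine Set.eq_univ_of_forall fun z => ?_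
      by_cases hz : z = p
      · exact Or.inl hz
      obtain ⟨ε, y, hy, rfl⟩ := A.exists_map_eq z hz
      rcases A.exists_face ε y hy with h0 | ⟨ε', y', hy', hf, he, -⟩
      · exact absurd h0 hz
      obtain ⟨x', hx'1, hx'2⟩ := exists_faceMap_eq hy' rfl
      exact Or.inr (Set.mem_iUnion₂.2 ⟨_, ⟨(ε', faceOf y'), hf, rfl⟩, x',
        Metric.ball_subset_closedBall hx'1, (congrArg (A.map ε') hx'2).trans he⟩))

end CubicalCover

/-- The orbifold Euler characteristic computed from a cubical cover of the one-point
compactification of the orbit space. -/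
theorem hasOrbifoldEulerChar_of_cubicalCover {Γ X : Type} [Group Γ] [MulAction Γ X]
    [TopologicalSpace X] [T2Space (OnePoint (OrbitSpace Γ X))]
    (A : CubicalCover ι (OnePoint (OrbitSpace Γ X)) ∞)
    (G : Bool × (ι → SignType) → Subgroup Γ) (hG : ∀ c, Finite (G c))
    (hiso : ∀ ε, ∀ y ∈ Metric.closedBall (0 : ι → ℝ) 1, (ε, faceOf y) ∈ A.faces →
      ∀ x : X, (orbitMk Γ x : OnePoint (OrbitSpace Γ X)) = A.map ε y →
        Nonempty (MulAction.stabilizer Γ x ≃* G (ε, faceOf y))) :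
    HasOrbifoldEulerChar Γ X
      (∑ c ∈ A.faces, (-1 : ℚ) ^ faceDim c.2 / (Nat.card (G c) : ℚ)) := by
  let _ := A.cw
  refine ⟨⟨RelCWComplex.finite_mkFinite .., fun n c => G c.1, fun n c => hG _, ?_⟩, ?_⟩
  · rintro n c x ⟨x', hx', he⟩
    have h1 := hiso c.1.1 _ (CubicalCover.faceMap_mem_cube c hx') (CubicalCover.face_mem c hx') x
      he.symm
    rwa [faceOf_faceMap _ hx'] at h1
  · rw [← Finset.sum_coe_sort, ← finsum_eq_sum_of_fintype]
    refine finsum_eq_of_bijective (fun c : Σ n, A.Cell n => (⟨c.2.1, c.2.2.1⟩ : A.faces))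
      ⟨?_, fun c => ⟨⟨_, c.1, c.2, rfl⟩, rfl⟩⟩ ?_
    · rintro ⟨m, c, hc, rfl⟩ ⟨n, c', hc', rfl⟩ h
      obtain rfl : c = c' := congrArg (fun c => c.1) h
      rfl
    · rintro ⟨m, c, hc, rfl⟩
      rfl

end Cube

/-! ### Cubical covers from coordinates on the fundamental region -/

/-- The function `|q|² - 1 = (1 + s) / (1 - s)` of the last coordinate `s` of a point of the cube:
it grows from `0` to `∞` on `[-1, 1)`. -/
def excess (s : ℝ) : ℝ := (1 + s) / (1 - s)

/-- The point `q` over `ω` with `|q|² = 1 + excess s`. For `ω` in the cube `[0, 1/2]³` the maximum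
in the definition has no effect. -/
def pyramidPoint (ω : Fin 3 → ℝ) (s : ℝ) : HalfSpace :=
  pt √(max (1 / 4) (1 - ∑ i, ω i ^ 2 + excess s))
    (Real.sqrt_pos.2 (lt_max_of_lt_left (by norm_num))) ω

lemma excess_nonneg {s : ℝ} (h1 : -1 ≤ s) (h2 : s < 1) : 0 ≤ excess s :=
  div_nonneg (by linarith) (by linarith)

lemma sum_sq_le {ω : Fin 3 → ℝ} (hω : ∀ i, 0 ≤ ω i ∧ ω i ≤ 1 / 2) : ∑ i, ω i ^ 2 ≤ 3 / 4 := by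
  have h (i) : ω i ^ 2 ≤ 1 / 4 := by nlinarith [hω i]
  rw [Fin.sum_univ_three]
  linarith [h 0, h 1, h 2]

lemma ht_pyramidPoint_sq {ω : Fin 3 → ℝ} (hω : ∀ i, 0 ≤ ω i ∧ ω i ≤ 1 / 2) {s : ℝ} (h1 : -1 ≤ s)
    (h2 : s < 1) : ht (pyramidPoint ω s) ^ 2 = 1 - ∑ i, ω i ^ 2 + excess s := by
  have h3 := sum_sq_le hω
  have h4 := excess_nonneg h1 h2
  rw [pyramidPoint, ht_pt, Real.sq_sqrt (le_max_of_le_left (by norm_num)), max_eq_right]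
  linarith

@[simp] lemma co_pyramidPoint (ω : Fin 3 → ℝ) (s : ℝ) : co (pyramidPoint ω s) = ω := co_pt _ _ _

lemma nsq_pyramidPoint {ω : Fin 3 → ℝ} (hω : ∀ i, 0 ≤ ω i ∧ ω i ≤ 1 / 2) {s : ℝ} (h1 : -1 ≤ s)
    (h2 : s < 1) : nsq (pyramidPoint ω s) = 1 + excess s := by
  rw [nsq, ht_pyramidPoint_sq hω h1 h2, co_pyramidPoint]
  ring

lemma excess_eq_zero_iff {s : ℝ} (h2 : s < 1) : excess s = 0 ↔ s = -1 := by
  have h3 : 1 - s ≠ 0 := by linarith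
  rw [excess, div_eq_zero_iff, or_iff_left h3]
  constructor <;> intro h <;> linarith

lemma excess_injOn : Set.InjOn excess (Set.Iio 1) := by
  intro s hs s' hs' h
  rw [Set.mem_Iio] at hs hs'
  rw [excess, excess, div_eq_div_iff (by linarith) (by linarith)] at h
  linarith

lemma exists_excess_eq {x : ℝ} (hx : 0 ≤ x) : ∃ s, -1 ≤ s ∧ s < 1 ∧ excess s = x := by
  have h0 : 0 < x + 1 := by linarith
  refine ⟨(x - 1) / (x + 1), ?_, ?_, ?_⟩
  · rw [le_div_iff₀ h0]; linarith
  · rw [div_lt_iff₀ h0]; linarith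
  · rw [excess]
    have : 1 - (x - 1) / (x + 1) ≠ 0 := by
      have : 1 - (x - 1) / (x + 1) = 2 / (x + 1) := by field_simp; ring
      rw [this]
      positivity
    field_simp
    ring

/-- Coordinates `y : Fin 4 → ℝ`, in the cube, for the fundamental region modulo the cyclic
permutations of the horizontal coordinates if `h` holds. The last coordinate measures `|q|²`, and
`co` are the horizontal coordinates as functions of `y`. -/
structure RegionCoordinates (h : Bool) where
  /-- The horizontal coordinates as functions of the coordinates in the cube. -/
  co : (Fin 4 → ℝ) → Fin 3 → ℝ
  /-- The faces of the cube whose interiors represent the points of the region uniquely. -/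
  faces : Finset (Fin 4 → SignType)
  /-- The walls in which a face lies. -/
  walls : (Fin 4 → SignType) → Fin 3 → SignType
  /-- Whether a face lies in the diagonal; this matters only if `h` holds. -/
  diag : (Fin 4 → SignType) → Bool
  continuous : Continuous co
  mem_Icc : ∀ y ∈ Metric.closedBall (0 : Fin 4 → ℝ) 1, ∀ i, 0 ≤ co y i ∧ co y i ≤ 1 / 2
  zero_iff : ∀ y ∈ Metric.closedBall (0 : Fin 4 → ℝ) 1, ∀ i, co y i = 0 ↔ walls (faceOf y) i = -1
  half_iff : ∀ y ∈ Metric.closedBall (0 : Fin 4 → ℝ) 1, ∀ i, co y i = 1 / 2 ↔ walls (faceOf y) i = 1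
  diag_iff : h = true → ∀ y ∈ Metric.closedBall (0 : Fin 4 → ℝ) 1,
    (∀ i, co y i = co y 0) ↔ diag (faceOf y) = true
  faces_ne : ∀ f ∈ faces, f 3 ≠ 1
  /-- Every point of the cube is equivalent to an interior point of one of the faces. -/
  normalize : ∀ y ∈ Metric.closedBall (0 : Fin 4 → ℝ) 1, y 3 ≠ 1 →
    ∃ y' ∈ Metric.closedBall (0 : Fin 4 → ℝ) 1, y' 3 = y 3 ∧ faceOf y' ∈ faces ∧
      faceDim (faceOf y') ≤ faceDim (faceOf y) ∧
        ∃ k : Fin 3, (h = false → k = 0) ∧ ∀ i, co y i = co y' (i + k)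
  /-- Equivalent interior points of these faces agree. -/
  injective : ∀ y ∈ Metric.closedBall (0 : Fin 4 → ℝ) 1,
    ∀ y' ∈ Metric.closedBall (0 : Fin 4 → ℝ) 1, faceOf y ∈ faces → faceOf y' ∈ faces →
      y 3 = y' 3 → ∀ k : Fin 3, (h = false → k = 0) → (∀ i, co y i = co y' (i + k)) → y = y'
  /-- The coordinates cover the fundamental region up to equivalence. -/
  surjective : ∀ ω : Fin 3 → ℝ, (∀ i, 0 ≤ ω i ∧ ω i ≤ 1 / 2) → ∀ s : ℝ, -1 ≤ s → s < 1 →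
    ∃ y ∈ Metric.closedBall (0 : Fin 4 → ℝ) 1, y 3 = s ∧
      ∃ k : Fin 3, (h = false → k = 0) ∧ ∀ i, ω i = co y (i + k)

namespace RegionCoordinates

variable {h : Bool} (R : RegionCoordinates h)

/-- The point of the fundamental region with the given coordinates. -/
def point (y : Fin 4 → ℝ) : HalfSpace := pyramidPoint (R.co y) (y 3)

/-- Whether a face lies in some wall of the fundamental region. -/
def InWall (f : Fin 4 → SignType) : Prop := f 3 = -1 ∨ ∃ i, R.walls f i ≠ 0

instance : DecidablePred R.InWall := fun f => by unfold InWall; infer_instance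

/-- The maps of two copies of the cube to the compactified orbit space, given by the two copies of
the fundamental region; the top face is mapped to `∞`. -/
def toOrbit (ε : Bool) (y : Fin 4 → ℝ) : OnePoint (OrbitSpace (modularGroup h) HalfSpace) :=
  if y 3 = 1 then ∞ else (orbitMk (modularGroup h) (flip ε (R.point y)) : OrbitSpace _ _)

variable {R} {y : Fin 4 → ℝ}

lemma last_mem (hy : y ∈ Metric.closedBall (0 : Fin 4 → ℝ) 1) (h3 : y 3 ≠ 1) :
    -1 ≤ y 3 ∧ y 3 < 1 :=
  ⟨(mem_cube_iff.1 hy 3).1, lt_of_le_of_ne (mem_cube_iff.1 hy 3).2 h3⟩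

lemma last_ne {f : Fin 4 → SignType} (hf : f ∈ R.faces) (hfy : faceOf y = f) : y 3 ≠ 1 := by
  intro h3
  exact R.faces_ne f hf (hfy ▸ faceOf_eq_one.2 h3)

/-- The type of a point, and hence the order of its isotropy group, is constant in the interior of
every face. -/
lemma hasType_point (hy : y ∈ Metric.closedBall (0 : Fin 4 → ℝ) 1) (h3 : y 3 ≠ 1) :
    HasType h (R.walls (faceOf y)) (decide (faceOf y 3 = -1)) (R.diag (faceOf y)) (R.point y) := by
  obtain ⟨h1, h2⟩ := last_mem hy h3
  have hnsq := nsq_pyramidPoint (R.mem_Icc y hy) h1 h2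
  refine ⟨⟨?_, fun i => ?_⟩, fun i => ?_, fun i => ?_, ?_, ?_⟩
  · rw [point, hnsq]
    linarith [excess_nonneg h1 h2]
  · simpa [point] using R.mem_Icc y hy i
  · simpa [point] using R.zero_iff y hy i
  · simpa [point] using R.half_iff y hy i
  · rw [point, hnsq, add_eq_left, excess_eq_zero_iff h2, decide_eq_true_eq, faceOf_eq_neg_one]
  · exact fun hh => by simpa [point, IsDiag] using R.diag_iff hh y hy

lemma onWall_point_iff (hy : y ∈ Metric.closedBall (0 : Fin 4 → ℝ) 1) (h3 : y 3 ≠ 1) :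
    OnWall (R.point y) ↔ R.InWall (faceOf y) := by
  have hq := hasType_point (R := R) hy h3
  simp only [OnWall, InWall, hq.sphere_iff, hq.zero_iff, hq.half_iff, decide_eq_true_eq]
  have : ∀ a : SignType, (a = -1 ∨ a = 1) ↔ a ≠ 0 := by decide
  simp only [this]

lemma point_eq_rot_iff {y' : Fin 4 → ℝ} (hy : y ∈ Metric.closedBall (0 : Fin 4 → ℝ) 1)
    (h3 : y 3 ≠ 1) (hy' : y' ∈ Metric.closedBall (0 : Fin 4 → ℝ) 1) (h3' : y' 3 ≠ 1)
    (k : Fin 3) : R.point y = rot k (R.point y') ↔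
      y 3 = y' 3 ∧ ∀ i, R.co y i = R.co y' (i + k) := by
  obtain ⟨h1, h2⟩ := last_mem hy h3
  obtain ⟨h1', h2'⟩ := last_mem hy' h3'
  have hnsq := nsq_pyramidPoint (R.mem_Icc y hy) h1 h2
  have hnsq' := nsq_pyramidPoint (R.mem_Icc y' hy') h1' h2'
  have hsum (hco : ∀ i, R.co y i = R.co y' (i + k)) :
      ∑ i, R.co y i ^ 2 = ∑ i, R.co y' i ^ 2 := by
    simp only [hco]
    exact Equiv.sum_comp (Equiv.addRight k) (fun i => R.co y' i ^ 2)
  have hht := ht_pyramidPoint_sq (R.mem_Icc y hy) h1 h2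
  have hht' := ht_pyramidPoint_sq (R.mem_Icc y' hy') h1' h2'
  constructor
  · intro he
    have hco (i) : R.co y i = R.co y' (i + k) := by
      have := congrArg (fun q => QuaternionicModular.co q i) he
      simpa [point] using this
    refine ⟨excess_injOn h2 h2' ?_, hco⟩
    have h4 : ht (pyramidPoint (R.co y) (y 3)) = ht (pyramidPoint (R.co y') (y' 3)) := by
      simpa [point] using congrArg ht he
    rw [h4, hht', hsum hco] at hht
    linarith
  · rintro ⟨he, hco⟩
    refine halfSpace_ext ?_ fun i => ?_
    · simp only [point, ht_rot]
      refine (sq_eq_sq₀ (ht_pos _).le (ht_pos _).le).1 ?_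
      rw [hht, hht', hsum hco, he]
    · simpa [point] using hco i

lemma toOrbit_of_ne {ε : Bool} (h3 : y 3 ≠ 1) :
    R.toOrbit ε y = (orbitMk (modularGroup h) (flip ε (R.point y)) : OrbitSpace _ _) :=
  if_neg h3

lemma toOrbit_eq_iff {ε ε' : Bool} {y' : Fin 4 → ℝ} (hy : y ∈ Metric.closedBall (0 : Fin 4 → ℝ) 1)
    (h3 : y 3 ≠ 1) (hy' : y' ∈ Metric.closedBall (0 : Fin 4 → ℝ) 1) (h3' : y' 3 ≠ 1) :
    R.toOrbit ε y = R.toOrbit ε' y' ↔ (y 3 = y' 3 ∧ ∃ k : Fin 3, (h = false → k = 0) ∧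
      ∀ i, R.co y i = R.co y' (i + k)) ∧ (ε = ε' ∨ R.InWall (faceOf y')) := by
  rw [toOrbit_of_ne h3, toOrbit_of_ne h3', OnePoint.coe_eq_coe,
    orbitMk_flip_eq_iff (hasType_point hy h3).mem (hasType_point hy' h3').mem,
    onWall_point_iff hy' h3']
  simp only [point_eq_rot_iff hy h3 hy' h3']
  refine and_congr_left fun _ => ⟨?_, ?_⟩
  · rintro ⟨k, hk, he, hco⟩
    exact ⟨he, k, hk, hco⟩
  · rintro ⟨he, k, hk, hco⟩
    exact ⟨k, hk, he, hco⟩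

/-- The height tends to infinity at the top face. -/
lemma le_ht_point_sq (hy : y ∈ Metric.closedBall (0 : Fin 4 → ℝ) 1) (h3 : y 3 ≠ 1)
    (h0 : 0 ≤ y 3) : 1 / (1 - y 3) ≤ ht (R.point y) ^ 2 := by
  obtain ⟨h1, h2⟩ := last_mem hy h3
  rw [point, ht_pyramidPoint_sq (R.mem_Icc y hy) h1 h2]
  have h4 := sum_sq_le (R.mem_Icc y hy)
  have h5 : 1 / (1 - y 3) ≤ excess (y 3) := by
    unfold excess
    have : 0 ≤ 1 - y 3 := by linarith
    gcongr
    linarith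
  linarith

lemma continuousAt_point (h3 : y 3 ≠ 1) : ContinuousAt R.point y := by
  have hopen : IsOpen {y : Fin 4 → ℝ | y 3 ≠ 1} := isOpen_ne.preimage (continuous_apply 3)
  have hco (i : Fin 3) : ContinuousOn (fun y => R.co y i) {y : Fin 4 → ℝ | y 3 ≠ 1} :=
    ((continuous_apply i).comp R.continuous).continuousOn
  have hex : ContinuousOn (fun y : Fin 4 → ℝ => excess (y 3)) {y : Fin 4 → ℝ | y 3 ≠ 1} := by
    unfold excess
    refine ContinuousOn.div (by fun_prop) (by fun_prop) fun y hy => sub_ne_zero.2 (Ne.symm hy)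
  refine (continuousOn_halfSpace ?_ fun i => ?_).continuousAt (hopen.mem_nhds h3)
  · simp only [point, pyramidPoint, ht_pt, Fin.sum_univ_three]
    have h0 := hco 0
    have h1 := hco 1
    have h2 := hco 2
    refine ContinuousOn.sqrt (ContinuousOn.sup continuousOn_const ?_)
    fun_prop
  · simpa [point] using hco i

/-- Continuity at the top face holds since points of large height leave every compact subset of the
orbit space. -/
lemma continuousOn_toOrbit (ε : Bool) :
    ContinuousOn (R.toOrbit ε) (Metric.closedBall 0 1) := by
  intro y hy
  by_cases h3 : y 3 = 1
  · rw [ContinuousWithinAt, toOrbit, if_pos h3]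
    refine OnePoint.hasBasis_nhds_infty.tendsto_right_iff.2 ?_
    rintro C ⟨-, hC⟩
    obtain ⟨B, hB⟩ := exists_ht_bound hC
    have hopen : ∀ᶠ y' : Fin 4 → ℝ in 𝓝[Metric.closedBall 0 1] y, 1 - 1 / (B ^ 2 + 1) < y' 3 := by
      refine nhdsWithin_le_nhds ((continuous_apply 3).continuousAt.eventually_const_lt ?_)
      simp only [h3]
      have : 0 < 1 / (B ^ 2 + 1) := by positivity
      linarith
    filter_upwards [hopen, self_mem_nhdsWithin] with y' h1 hy'
    by_cases h3' : y' 3 = 1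
    · exact Or.inr (if_pos h3')
    rw [toOrbit_of_ne h3']
    refine Or.inl ⟨_, hB _ ?_, rfl⟩
    obtain ⟨-, h2⟩ := last_mem hy' h3'
    have h4 : 1 / (B ^ 2 + 1) ≤ 1 := by
      rw [div_le_one (by positivity)]
      nlinarith [sq_nonneg B]
    have h5 : B ^ 2 + 1 < 1 / (1 - y' 3) := by
      rw [lt_one_div (by positivity) (by linarith)]
      linarith
    have h6 := le_ht_point_sq (R := R) hy' h3' (by linarith)
    have h7 : ht (flip ε (R.point y')) = ht (R.point y') := by cases ε <;> simp [flip]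
    rw [h7]
    exact lt_of_pow_lt_pow_left₀ 2 (ht_pos _).le (by linarith)
  · refine ContinuousAt.continuousWithinAt ?_
    have hne : ∀ᶠ y' : Fin 4 → ℝ in 𝓝 y, y' 3 ≠ 1 :=
      (continuous_apply 3).continuousAt.eventually_ne h3
    have hc := ((OnePoint.continuous_coe.comp ((continuous_orbitMk h).comp
      (continuous_of_mem (flip_mem ε h)))).continuousAt).comp (continuousAt_point (R := R) h3)
    exact hc.congr (hne.mono fun y' h3' => (toOrbit_of_ne h3').symm)

variable (R)

/-- The faces of the two cubes that give the cells: the faces in the walls are taken from one of the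
cubes only. -/
def cellFaces : Finset (Bool × (Fin 4 → SignType)) :=
  (Finset.univ ×ˢ R.faces).filter fun c => c.1 = true → ¬R.InWall c.2

variable {R}

lemma mem_cellFaces {c : Bool × (Fin 4 → SignType)} :
    c ∈ R.cellFaces ↔ c.2 ∈ R.faces ∧ (c.1 = true → ¬R.InWall c.2) := by
  simp [cellFaces]

variable (R)

/-- The cubical cover of the compactified orbit space given by the coordinates. -/
def cubicalCover : CubicalCover (Fin 4) (OnePoint (OrbitSpace (modularGroup h) HalfSpace)) ∞ where
  faces := R.cellFaces
  map := R.toOrbit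
  continuousOn := continuousOn_toOrbit
  exists_face ε y hy := by
    by_cases h3 : y 3 = 1
    · exact Or.inl (if_pos h3)
    obtain ⟨y', hy', he, hf, hd, hk⟩ := R.normalize y hy h3
    have h3' : y' 3 ≠ 1 := by rwa [he]
    obtain ⟨k, hk, hco⟩ := hk
    -- The inverse permutation leads back from `y'` to `y`.
    have hback : ∃ k : Fin 3, (h = false → k = 0) ∧ ∀ i, R.co y' i = R.co y (i + k) :=
      ⟨-k, fun hh => by rw [hk hh, neg_zero], fun i => by simp [hco]⟩
    refine Or.inr ?_
    by_cases hw : R.InWall (faceOf y)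
    · refine ⟨false, y', hy', mem_cellFaces.2 ⟨hf, fun hh => by simp at hh⟩, ?_, hd⟩
      exact (toOrbit_eq_iff hy' h3' hy h3).2 ⟨⟨he, hback⟩, Or.inr hw⟩
    · have hw' : ¬R.InWall (faceOf y') := by
        intro hw'
        have h1 : R.toOrbit true y = R.toOrbit false y' :=
          (toOrbit_eq_iff hy h3 hy' h3').2 ⟨⟨he.symm, k, hk, hco⟩, Or.inr hw'⟩
        have h2 := ((toOrbit_eq_iff hy' h3' hy h3).1 h1.symm).2
        exact hw (h2.resolve_left (by decide))
      refine ⟨ε, y', hy', mem_cellFaces.2 ⟨hf, fun _ => hw'⟩, ?_, hd⟩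
      exact (toOrbit_eq_iff hy' h3' hy h3).2 ⟨⟨he, hback⟩, Or.inl rfl⟩
  ne_base ε y hy hf := by
    rw [toOrbit_of_ne (last_ne (mem_cellFaces.1 hf).1 rfl)]
    exact OnePoint.coe_ne_infty _
  injective ε y hy ε' y' hy' hf hf' he := by
    rw [mem_cellFaces] at hf hf'
    obtain ⟨⟨h1, k, hk, h2⟩, h3⟩ :=
      (toOrbit_eq_iff hy (last_ne hf.1 rfl) hy' (last_ne hf'.1 rfl)).1 he
    obtain rfl := R.injective y hy y' hy' hf.1 hf'.1 h1 k hk h2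
    refine ⟨?_, rfl⟩
    rcases h3 with h3 | h3
    · exact h3
    · cases ε
      · cases ε'
        · rfl
        · exact absurd h3 (hf'.2 rfl)
      · exact absurd h3 (hf.2 rfl)
  exists_map_eq z hz := by
    obtain ⟨z, rfl⟩ := OnePoint.ne_infty_iff_exists.1 hz
    obtain ⟨x, rfl⟩ := Quotient.exists_rep z
    obtain ⟨ε, q, hq, hqx⟩ := exists_orbitMk_flip h x
    obtain ⟨s, hs1, hs2, hs⟩ := exists_excess_eq (sub_nonneg.2 hq.1)
    obtain ⟨y, hy, hys, k, hk, hco⟩ := R.surjective (QuaternionicModular.co q) hq.2 s hs1 hs2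
    have h3 : y 3 ≠ 1 := by rw [hys]; exact hs2.ne
    refine ⟨ε, y, hy, ?_⟩
    rw [toOrbit_of_ne h3]
    refine congrArg _ (Eq.trans ?_ hqx)
    have hqp : q = pyramidPoint (QuaternionicModular.co q) s := by
      refine halfSpace_ext ?_ (by simp)
      refine (sq_eq_sq₀ (ht_pos _).le (ht_pos _).le).1 ?_
      rw [ht_pyramidPoint_sq hq.2 hs1 hs2, hs]
      simp only [nsq]
      ring
    rw [eq_comm, orbitMk_flip_eq_iff hq (hasType_point hy h3).mem]
    refine ⟨⟨k, hk, ?_⟩, Or.inl rfl⟩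
    refine halfSpace_ext ?_ fun i => by simp [point, hco]
    refine (sq_eq_sq₀ (ht_pos _).le (ht_pos _).le).1 ?_
    rw [ht_rot, point, ht_pyramidPoint_sq (R.mem_Icc y hy) (hys ▸ hs1) (hys ▸ hs2), hys, hqp,
      ht_pyramidPoint_sq hq.2 hs1 hs2]
    simp only [hco]
    exact congrArg (fun a => 1 - a + excess s)
      (Equiv.sum_comp (Equiv.addRight k) (fun i => R.co y i ^ 2))

/-- The center of a face of the cube. -/
def center (f : Fin 4 → SignType) (i : Fin 4) : ℝ := (f i : ℝ)

lemma center_mem (f : Fin 4 → SignType) : center f ∈ Metric.closedBall (0 : Fin 4 → ℝ) 1 := by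
  rw [mem_cube_iff]
  intro i
  unfold center
  rcases hs : f i with _ | _ | _ <;> simp

lemma faceOf_center (f : Fin 4 → SignType) : faceOf (center f) = f := by
  ext1 i
  unfold faceOf center
  rcases hs : f i with _ | _ | _ <;> (simp; try norm_num)

lemma stabilizer_point_le {ε : Bool} {y' : Fin 4 → ℝ}
    (hy : y ∈ Metric.closedBall (0 : Fin 4 → ℝ) 1) (h3 : y 3 ≠ 1)
    (hy' : y' ∈ Metric.closedBall (0 : Fin 4 → ℝ) 1) (hyy' : faceOf y = faceOf y') :
    MulAction.stabilizer (modularGroup h) (flip ε (R.point y)) ≤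
      MulAction.stabilizer (modularGroup h) (flip ε (R.point y')) := by
  have h3' : y' 3 ≠ 1 := by
    rwa [ne_eq, ← faceOf_eq_one, ← hyy', faceOf_eq_one]
  have hq := hasType_point (R := R) hy h3
  have hq' := hasType_point (R := R) hy' h3'
  rw [hyy'] at hq
  exact stabilizer_flip_le hq.mem ⟨fun h1 => hq'.sphere_iff.2 (hq.sphere_iff.1 h1),
    fun i => ⟨fun h1 => (hq'.zero_iff i).2 ((hq.zero_iff i).1 h1),
      fun h1 => (hq'.half_iff i).2 ((hq.half_iff i).1 h1)⟩⟩
    fun hh h1 => (hq'.diag_iff hh).2 ((hq.diag_iff hh).1 h1)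

/-- The orbifold Euler characteristic of a modular group, as a sum over the faces. -/
theorem hasOrbifoldEulerChar : HasOrbifoldEulerChar (modularGroup h) HalfSpace
    (∑ c ∈ R.cellFaces, (-1 : ℚ) ^ faceDim c.2 /
      (isotropyOrder h (R.walls c.2) (decide (c.2 3 = -1)) (R.diag c.2) : ℚ)) := by
  have key := hasOrbifoldEulerChar_of_cubicalCover R.cubicalCover
    (fun c => MulAction.stabilizer (modularGroup h) (flip c.1 (R.point (center c.2))))
    (fun c => finite_stabilizer h _) ?_
  · convert key using 1
    refine Finset.sum_congr rfl fun c hc => ?_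
    have hf := faceOf_center c.2
    have hq := hasType_point (R := R) (center_mem c.2) (last_ne (mem_cellFaces.1 hc).1 hf)
    rw [hf] at hq
    rw [card_stabilizer, fixCard_eq hq]
  · intro ε y hy hf x hx
    have h3 : y 3 ≠ 1 := last_ne (mem_cellFaces.1 hf).1 rfl
    have h3' : center (faceOf y) 3 ≠ 1 := last_ne (mem_cellFaces.1 hf).1 (faceOf_center _)
    have hx' : (orbitMk (modularGroup h) x : OnePoint (OrbitSpace (modularGroup h) HalfSpace)) =
      (orbitMk (modularGroup h) (flip ε (R.point y)) : OrbitSpace _ _) :=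
      hx.trans (toOrbit_of_ne h3)
    have hrel : MulAction.orbitRel (modularGroup h) HalfSpace x (flip ε (R.point y)) :=
      Quotient.exact (OnePoint.coe_injective hx')
    have heq : MulAction.stabilizer (modularGroup h) (flip ε (R.point y)) =
        MulAction.stabilizer (modularGroup h) (flip ε (R.point (center (faceOf y)))) :=
      le_antisymm (stabilizer_point_le R hy h3 (center_mem _) (faceOf_center _).symm)
        (stabilizer_point_le R (center_mem _) h3' hy (faceOf_center _))
    exact ⟨(MulAction.stabilizerEquivStabilizerOfOrbitRel hrel).trans (MulEquiv.subgroupCongr heq)⟩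

end RegionCoordinates

/-! ### The two decompositions -/

/-- The coordinates for the Lipschitz modular group: the horizontal coordinates are rescaled. -/
def lipschitzCoordinates : RegionCoordinates false where
  co y i := (1 + y i.castSucc) / 4
  faces := Finset.univ.filter fun f => f 3 ≠ 1
  walls f i := f i.castSucc
  diag _ := false
  continuous := by fun_prop
  mem_Icc y hy i := by
    have := mem_cube_iff.1 hy i.castSucc
    constructor <;> linarith
  zero_iff y _ i := by
    rw [faceOf_eq_neg_one]
    constructor <;> intro h <;> linarith
  half_iff y _ i := by
    rw [faceOf_eq_one]
    constructor <;> intro h <;> linarith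
  diag_iff h := absurd h (by decide)
  faces_ne f hf := (Finset.mem_filter.1 hf).2
  normalize y hy h3 := ⟨y, hy, rfl, by simpa [faceOf_eq_one] using h3, le_rfl, 0, fun _ => rfl,
    fun i => by rw [add_zero]⟩
  injective y _ y' _ _ _ h3 k hk hco := by
    obtain rfl := hk rfl
    ext j
    refine Fin.lastCases h3 (fun i => ?_) j
    have := hco i
    rw [add_zero] at this
    linarith
  surjective ω hω s h1 h2 := by
    refine ⟨Fin.snoc (fun i => 4 * ω i - 1) s, mem_cube_iff.2 fun j => ?_, Fin.snoc_last _ _, 0,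
      fun _ => rfl, fun i => ?_⟩
    · refine Fin.lastCases ?_ (fun i => ?_) j
      · rw [Fin.snoc_last]
        exact ⟨h1, h2.le⟩
      · rw [Fin.snoc_castSucc]
        have := hω i
        constructor <;> linarith
    · rw [add_zero, Fin.snoc_castSucc]
      ring

/-- The faces that represent uniquely the points of the region modulo the cyclic permutations, in
the coordinates `r (1, a, b)`: for `r = 0` the values of `a` and `b` do not matter, and
`r (1, 1, b)` is a cyclic permutation of `r (1, b, 1)`. -/
def IsHurwitzFace (f : Fin 4 → SignType) : Prop :=
  f 3 ≠ 1 ∧ (f 0 = -1 → f 1 = -1 ∧ f 2 = -1) ∧ (f 0 ≠ -1 → f 1 = 1 → f 2 = 1)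

instance : DecidablePred IsHurwitzFace := fun f => by unfold IsHurwitzFace; infer_instance

/-- The walls of a face in the coordinates `r (1, a, b)`. -/
def hurwitzWalls (f : Fin 4 → SignType) : Fin 3 → SignType :=
  if f 0 = -1 then -1 else if f 0 = 1 then ![1, f 1, f 2]
    else ![0, min (f 1) 0, min (f 2) 0]

lemma faceDim_le_of_perm {f g : Fin 4 → SignType} (e : Equiv.Perm (Fin 4))
    (h : ∀ i, f i = 0 → g (e i) = 0) : faceDim f ≤ faceDim g :=
  Fintype.card_le_of_injective (fun i : {i // f i = 0} => (⟨e i.1, h i.1 i.2⟩ : {i // g i = 0}))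
    fun _ _ hij => Subtype.ext (e.injective (congrArg (fun c => c.1) hij))

/-- The coordinates for the Hurwitz modular group: a cyclic permutation brings the largest of the
horizontal coordinates to the first place, and then they are `r (1, a, b)` with `r ≤ 1/2` and
`a, b ≤ 1`. -/
def hurwitzCoordinates : RegionCoordinates true where
  co y := ![(1 + y 0) / 4, (1 + y 0) / 4 * ((1 + y 1) / 2), (1 + y 0) / 4 * ((1 + y 2) / 2)]
  faces := Finset.univ.filter IsHurwitzFace
  walls := hurwitzWalls
  diag f := f 0 = -1 ∨ (f 1 = 1 ∧ f 2 = 1)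
  continuous := by
    refine continuous_pi fun i => ?_
    fin_cases i <;> simp <;> fun_prop
  mem_Icc y hy i := by
    have h0 := mem_cube_iff.1 hy 0
    have h1 := mem_cube_iff.1 hy 1
    have h2 := mem_cube_iff.1 hy 2
    fin_cases i <;> simp <;> constructor <;> nlinarith
  zero_iff y hy i := by
    have hmin : ∀ a : SignType, min a 0 = -1 ↔ a = -1 := by decide
    have hz (x : ℝ) : 1 + x = 0 ↔ x = -1 := by constructor <;> intro h <;> linarith
    by_cases h0 : y 0 = -1
    · rw [hurwitzWalls, if_pos (faceOf_eq_neg_one.2 h0)]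
      fin_cases i <;> simp [h0]
    have h0' : 1 + y 0 ≠ 0 := fun h => h0 (by linarith)
    rw [hurwitzWalls, if_neg (fun h => h0 (faceOf_eq_neg_one.1 h))]
    split_ifs
    · fin_cases i <;> simp [h0', faceOf_eq_neg_one, hz]
    · fin_cases i <;> simp [h0', faceOf_eq_neg_one, hz, hmin]
  half_iff y hy i := by
    have hy0 := mem_cube_iff.1 hy 0
    have hmin : ∀ a : SignType, min a 0 ≠ 1 := by decide
    by_cases h3 : y 0 = 1
    · rw [hurwitzWalls, if_neg (by rw [faceOf_eq_one.2 h3]; decide), if_pos (faceOf_eq_one.2 h3)]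
      have hmul (x : ℝ) : (1 + 1) / 4 * ((1 + x) / 2) = 1 / 2 ↔ x = 1 := by
        constructor <;> intro h <;> linarith
      fin_cases i
      · norm_num [h3]
      · simpa [h3, faceOf_eq_one] using hmul (y 1)
      · simpa [h3, faceOf_eq_one] using hmul (y 2)
    have hlt := lt_of_le_of_ne hy0.2 h3
    have hne (x : ℝ) (hx : x ≤ 1) : (1 + y 0) / 4 * ((1 + x) / 2) ≠ 1 / 2 := by nlinarith
    have hR : hurwitzWalls (faceOf y) i ≠ 1 := by
      rw [hurwitzWalls, if_neg (fun h => h3 (faceOf_eq_one.1 h))]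
      split_ifs
      · simp
      · fin_cases i <;> simp [hmin]
    refine iff_of_false ?_ hR
    fin_cases i
    · have : (1 + y 0) / 4 ≠ 1 / 2 := by linarith
      simpa using this
    · simpa using hne _ (mem_cube_iff.1 hy 1).2
    · simpa using hne _ (mem_cube_iff.1 hy 2).2
  diag_iff _ y _ := by
    simp only [decide_eq_true_eq, faceOf_eq_one, faceOf_eq_neg_one]
    constructor
    · intro h
      have h1 := h 1
      have h2 := h 2
      simp only [Matrix.cons_val] at h1 h2
      by_cases h0 : y 0 = -1
      · exact Or.inl h0
      have h0' : (1 + y 0) / 4 ≠ 0 := fun h => h0 (by linarith)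
      have h1' := mul_left_cancel₀ h0' (h1.trans (mul_one _).symm)
      have h2' := mul_left_cancel₀ h0' (h2.trans (mul_one _).symm)
      exact Or.inr ⟨by linarith, by linarith⟩
    · rintro (h | ⟨h1, h2⟩) i
      · fin_cases i <;> simp [h]
      · fin_cases i <;> norm_num [h1, h2]
  faces_ne f hf := (Finset.mem_filter.1 hf).2.1
  normalize y hy h3 := by
    have hy' := mem_cube_iff.1 hy
    by_cases h0 : y 0 = -1
    · refine ⟨![-1, -1, -1, y 3], mem_cube_iff.2 fun i => ?_, rfl, ?_,
        faceDim_le_of_perm 1 fun i hi => ?_, 0, by simp, fun i => ?_⟩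
      · have := hy' 3
        fin_cases i <;> simp [this]
      · simpa [IsHurwitzFace, faceOf_eq_one, faceOf_eq_neg_one] using h3
      · fin_cases i <;> simp_all [faceOf_eq_zero]
      · fin_cases i <;> simp [h0]
    by_cases h1 : y 1 = 1 ∧ y 2 ≠ 1
    · refine ⟨![y 0, y 2, 1, y 3], mem_cube_iff.2 fun i => ?_, rfl, ?_,
        faceDim_le_of_perm (Equiv.swap 1 2) fun i hi => ?_, 2, by simp, fun i => ?_⟩
      · have h0 := hy' 0
        have h2 := hy' 2
        have h3 := hy' 3
        fin_cases i <;> simp [h0, h2, h3]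
      · simp [IsHurwitzFace, faceOf_eq_one, faceOf_eq_neg_one, h0, h3]
      · fin_cases i
        · simpa [faceOf_eq_zero, Equiv.swap_apply_def] using hi
        · simpa [faceOf_eq_zero, Equiv.swap_apply_def] using hi
        · simp [faceOf_eq_zero] at hi
        · simpa [faceOf_eq_zero, Equiv.swap_apply_def] using hi
      · fin_cases i
        · change (1 + y 0) / 4 = (1 + y 0) / 4 * ((1 + 1) / 2)
          ring
        · change (1 + y 0) / 4 * ((1 + y 1) / 2) = (1 + y 0) / 4
          rw [h1.1]
          ring
        · rfl
    · refine ⟨y, hy, rfl, ?_, le_rfl, 0, by simp, fun i => by rw [add_zero]⟩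
      simp only [Finset.mem_filter, Finset.mem_univ, true_and, IsHurwitzFace, ne_eq,
        faceOf_eq_one, faceOf_eq_neg_one]
      exact ⟨h3, fun h => absurd h h0, fun _ h => by_contra fun h2 => h1 ⟨h, h2⟩⟩
  injective y hy y' hy' hf hf' h3 k _ hco := by
    obtain ⟨-, hf1, hf2⟩ := (Finset.mem_filter.1 hf).2
    obtain ⟨-, hf1', hf2'⟩ := (Finset.mem_filter.1 hf').2
    simp only [ne_eq, faceOf_eq_one, faceOf_eq_neg_one] at hf1 hf2 hf1' hf2'
    rw [mem_cube_iff] at hy hy'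
    have c0 := hco 0
    have c1 := hco 1
    have c2 := hco 2
    have a0 := hy 0
    have a1 := hy 1
    have a2 := hy 2
    have a0' := hy' 0
    have a1' := hy' 1
    have a2' := hy' 2
    -- The first coordinates agree, since they are the largest ones.
    have hr : y 0 = y' 0 := by
      fin_cases k <;> simp at c0 c1 c2 <;> nlinarith
    suffices h : y 1 = y' 1 ∧ y 2 = y' 2 by
      ext j
      fin_cases j
      exacts [hr, h.1, h.2, h3]
    by_cases h0 : y 0 = -1
    · obtain ⟨e1, e2⟩ := hf1 h0
      obtain ⟨e1', e2'⟩ := hf1' (hr ▸ h0)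
      exact ⟨e1.trans e1'.symm, e2.trans e2'.symm⟩
    have h0' : (1 + y 0) / 4 ≠ 0 := fun h => h0 (by linarith)
    replace hf2 := hf2 h0
    replace hf2' := hf2' (hr ▸ h0)
    -- The vectors `(1, a, b)` and `(1, a', b')` differ by a cyclic permutation.
    have hc (i : Fin 3) : ![1, (1 + y 1) / 2, (1 + y 2) / 2] i =
        ![1, (1 + y' 1) / 2, (1 + y' 2) / 2] (i + k) := by
      have hscale (r a b : ℝ) (i : Fin 3) : ![r, r * a, r * b] i = r * ![1, a, b] i := by
        fin_cases i <;> simp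
      refine mul_left_cancel₀ h0' ?_
      have := hco i
      rw [← hr] at this
      rw [← hscale, ← hscale, this]
    have d0 := hc 0
    have d1 := hc 1
    have d2 := hc 2
    fin_cases k
    · change (1 + y 1) / 2 = (1 + y' 1) / 2 at d1
      change (1 + y 2) / 2 = (1 + y' 2) / 2 at d2
      constructor <;> linarith
    · change 1 = (1 + y' 1) / 2 at d0
      change (1 + y 1) / 2 = (1 + y' 2) / 2 at d1
      change (1 + y 2) / 2 = 1 at d2
      have := hf2' (by linarith)
      constructor <;> linarith
    · change 1 = (1 + y' 2) / 2 at d0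
      change (1 + y 1) / 2 = 1 at d1
      change (1 + y 2) / 2 = (1 + y' 1) / 2 at d2
      have := hf2 (by linarith)
      constructor <;> linarith
  surjective ω hω s h1 h2 := by
    obtain ⟨k, hk⟩ := Finite.exists_max ω
    -- If `ω k = 0`, the quotients by `ω k` are `0`.
    have hmul (i : Fin 3) : ω k * (ω i / ω k) = ω i := by
      rcases eq_or_ne (ω k) 0 with h0 | h0
      · rw [h0, zero_mul]
        exact le_antisymm (hω i).1 (h0 ▸ hk i)
      · exact mul_div_cancel₀ _ h0
    have hle (i : Fin 3) : 0 ≤ ω i / ω k ∧ ω i / ω k ≤ 1 :=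
      ⟨div_nonneg (hω i).1 (hω k).1, div_le_one_of_le₀ (hk i) (hω k).1⟩
    refine ⟨![4 * ω k - 1, 2 * (ω (1 + k) / ω k) - 1, 2 * (ω (2 + k) / ω k) - 1, s],
      mem_cube_iff.2 fun j => ?_, rfl, -k, by simp, fun i => ?_⟩
    · have := hω k
      have := hle (1 + k)
      have := hle (2 + k)
      fin_cases j
      · change -1 ≤ 4 * ω k - 1 ∧ 4 * ω k - 1 ≤ 1
        constructor <;> linarith
      · change -1 ≤ 2 * (ω (1 + k) / ω k) - 1 ∧ 2 * (ω (1 + k) / ω k) - 1 ≤ 1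
        constructor <;> linarith
      · change -1 ≤ 2 * (ω (2 + k) / ω k) - 1 ∧ 2 * (ω (2 + k) / ω k) - 1 ≤ 1
        constructor <;> linarith
      · exact ⟨h1, h2.le⟩
    · obtain ⟨j, rfl⟩ : ∃ j, i = j + k := ⟨i - k, (sub_add_cancel _ _).symm⟩
      rw [add_neg_cancel_right]
      have e1 := hmul (1 + k)
      have e2 := hmul (2 + k)
      fin_cases j
      · simp
      · simp
        linarith
      · simp
        linarith

/-- The alternating sum over the 55 cells for the Lipschitz modular group. -/
lemma lipschitz_sum : (∑ c ∈ lipschitzCoordinates.cellFaces, (-1 : ℚ) ^ faceDim c.2 /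
      (isotropyOrder false (lipschitzCoordinates.walls c.2) (decide (c.2 3 = -1))
        (lipschitzCoordinates.diag c.2) : ℚ)) = 1 / 96 := by
  decide +kernel

/-- The alternating sum over the 33 cells for the Hurwitz modular group. -/
lemma hurwitz_sum : (∑ c ∈ hurwitzCoordinates.cellFaces, (-1 : ℚ) ^ faceDim c.2 /
      (isotropyOrder true (hurwitzCoordinates.walls c.2) (decide (c.2 3 = -1))
        (hurwitzCoordinates.diag c.2) : ℚ)) = 1 / 288 := by
  decide +kernel

end QuaternionicModular

end

theorem mainTheorem8 :
    QuaternionicModular.HasOrbifoldEulerChar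
        QuaternionicModular.lipschitzModularGroup QuaternionicModular.HalfSpace (1 / 96) ∧
      QuaternionicModular.HasOrbifoldEulerChar
        QuaternionicModular.hurwitzModularGroup QuaternionicModular.HalfSpace (1 / 288) :=
  ⟨QuaternionicModular.lipschitz_sum ▸
      QuaternionicModular.lipschitzCoordinates.hasOrbifoldEulerChar,
    QuaternionicModular.hurwitz_sum ▸
      QuaternionicModular.hurwitzCoordinates.hasOrbifoldEulerChar⟩
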